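/- Let $\mathfrak g$ be a finite-dimensional simple complex Lie algebra with a non-degenerate ad-invariant bilinear form $(\ ,\ )$, let $\mathfrak h\subset\mathfrak g$ be a Cartan subalgebra, and let $\Delta\subset\mathfrak h^*$ be the set of roots. For $\alpha\in\Delta$ let $e_\alpha\in\mathfrak g$ be a root vector, normalized by $(e_\alpha,e_{-\alpha})=1$. Let $U$ be a finite-dimensional representation of $\mathfrak g$ and $U[0]=\{u\in U\mid \mathfrak h u=0\}$ its zero-weight space. On $U[0]$-valued functions on $\mathfrak h$ consider the operator $$H=-\triangle+\sum_{\alpha\in\Delta}\frac{\pi^2}{\sin^2(\pi\alpha(\lambda))}\,e_\alpha e_{-\alpha},\qquad \triangle=\sum_\nu\frac{\partial^2}{\partial\lambda_\nu^2},$$ where $\lambda_\nu=(b_\nu,\lambda)$ for an orthonormal basis $(b_\nu)$ of $\mathfrak h$. Let $G$ be the simply connected complex Lie group with Lie algebra $\mathfrak g$; it acts on $\mathfrak g$ and on $U$. Let $N$ be the normalizer in $G$ of the Cartan torus $T=\exp\mathfrak h$. The Weyl group $W=N/T$ acts on $\mathfrak h$ and on $U[0]$, hence on $U[0]$-valued functions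 by $(w\psi)(\lambda)=w\cdot\psi(w^{-1}\lambda)$. A function $\psi$ is called Weyl antiinvariant if $w\psi=\epsilon(w)\psi$ for all $w\in W$, where $\epsilon(w)=\det(w|_{\mathfrak h})=\pm1$. Let $$D=\mathfrak h-\bigcup_{m\in\mathbb Z}\bigcup_{\alpha\in\Delta}\{\lambda\in\mathfrak h\mid\alpha(\lambda)=m\},\qquad P^\vee=\{p\in\mathfrak h\mid\alpha(p)\in\mathbb Z\ \text{for all }\alpha\in\Delta\}.$$ Let $\psi$ be a meromorphic $U[0]$-valued function on $\mathfrak h$ that is holomorphic on $D$ and Weyl antiinvariant, that satisfies $H\psi=\epsilon\psi$ on $D$ for some $\epsilon\in\mathbb C$, and that satisfies $\psi(\lambda+p)=\chi(p)\psi(\lambda)$ for all $p\in P^\vee$ and some character $\chi:P^\vee\to\mathbb C^\times$. Then $\psi$ extends to a holomorphic $U[0]$-valued function on $\mathfrak h$. Moreover, for this extension, for all $\alpha\in\Delta$, all $m\in\mathbb Z$ and all integers $l\ge0$, $$e_\alpha^l\,\psi(\lambda)=O\big((\alpha(\lambda)-m)^{l+1}\big)$$ as $\lambda\to\lambda_0$,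 for every point $\lambda_0$ of the hyperplane $\alpha(\lambda)=m$. -/

import Mathlib

open Filter Topology Asymptotics

noncomputable section

namespace CalogeroSutherland

section Holomorphy

variable {E F : Type*} [NormedAddCommGroup E] [NormedSpace ℂ E]
  [NormedAddCommGroup F] [NormedSpace ℂ F]

/-- A function `f` (whose values matter only on the set `D`, typically open and dense) is
meromorphic on the complex vector space `E`: near every point `x` of `E`, including the points
outside `D`, it is a quotient `G / q` of holomorphic functions, where the germ of the
denominator `q` at `x` is not zero. -/
def IsMeromorphicOff (D : Set E) (f : E → F) : Prop :=
  ∀ x : E, ∃ V : Set E, IsOpen V ∧ x ∈ V ∧ ∃ (q : E → ℂ) (G : E → F),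
    DifferentiableOn ℂ q V ∧ DifferentiableOn ℂ G V ∧ ¬ (q =ᶠ[𝓝 x] 0) ∧
      ∀ y ∈ V ∩ D, q y • f y = G y

end Holomorphy

section Group

/-- The exponential `∑ aᵏ / k!` of a nilpotent endomorphism of a complex vector space. -/
def nilExp {V : Type*} [AddCommGroup V] [Module ℂ V] (a : Module.End ℂ V) : Module.End ℂ V :=
  ∑ k ∈ Finset.range (nilpotencyClass a), ((k.factorial : ℂ)⁻¹) • a ^ k

variable {𝔤 : Type*} [LieRing 𝔤] [LieAlgebra ℂ 𝔤] [FiniteDimensional ℂ 𝔤]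
  (H : LieSubalgebra ℂ 𝔤) [H.IsCartanSubalgebra]
  (U : Type*) [AddCommGroup U] [Module ℂ U] [LieRingModule 𝔤 U] [LieModule ℂ 𝔤 U]

/-- The image in `GL(𝔤) × GL(U)` of the simply connected group `G` with Lie algebra `𝔤`, which
acts on `𝔤` by the adjoint representation and on `U` by integrating the given action of `𝔤`.
`G` is generated by its root subgroups, that is, by the exponentials of root vectors `x`, and
`exp x` acts by `exp (ad x)` on `𝔤` and by the exponential of the action of `x` on `U`. -/
def groupImage : Subgroup ((Module.End ℂ 𝔤)ˣ × (Module.End ℂ U)ˣ) :=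
  Subgroup.closure {p | ∃ α ∈ H.root, ∃ x ∈ LieAlgebra.rootSpace H α,
    (p.1 : Module.End ℂ 𝔤) = nilExp (LieAlgebra.ad ℂ 𝔤 x) ∧
    (p.2 : Module.End ℂ U) = nilExp (LieModule.toEnd ℂ 𝔤 U x)}

/-- `w` is the transformation of the Cartan subalgebra, and `n` the transformation of `U`, that
are induced by one and the same element of the normalizer `N` of the Cartan torus `T`, that is,
of an element of `G` whose adjoint action maps the Cartan subalgebra to itself.  The maps `w`
occurring here form the Weyl group `N / T`; on the zero weight space of `U`, where `T` acts
trivially, `n` is the action of the Weyl group element `w`. -/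
def IsWeylLift (w : H ≃ₗ[ℂ] H) (n : (Module.End ℂ U)ˣ) : Prop :=
  ∃ a : (Module.End ℂ 𝔤)ˣ, (a, n) ∈ groupImage H U ∧
    ∀ h : H, (a : Module.End ℂ 𝔤) (h : 𝔤) = (w h : 𝔤)

end Group

section Operators

variable {𝔤 : Type*} [LieRing 𝔤] [LieAlgebra ℂ 𝔤] [FiniteDimensional ℂ 𝔤]
  (H : LieSubalgebra ℂ 𝔤) [H.IsCartanSubalgebra]

/-- The complement in the Cartan subalgebra of all affine root hyperplanes `α(x) = m`,
with `α` a root and `m` an integer. -/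
def regularSet : Set H :=
  {x | ∀ α ∈ H.root, ∀ m : ℤ, α x ≠ (m : ℂ)}

/-- The coweight lattice `P^∨`: the elements of the Cartan subalgebra on which every root
takes an integer value. -/
def coweightLattice : AddSubgroup H where
  carrier := {p | ∀ α ∈ H.root, ∃ m : ℤ, α p = (m : ℂ)}
  zero_mem' := fun α _ => ⟨0, by
    simp⟩
  add_mem' := fun {p q} hp hq α hα => by
    obtain ⟨m, hm⟩ := hp α hα
    obtain ⟨n, hn⟩ := hq α hα
    refine ⟨m + n, ?_⟩
    simp [hm, hn]
  neg_mem' := fun {p} hp α hα => by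
    obtain ⟨m, hm⟩ := hp α hα
    refine ⟨-m, ?_⟩
    simp [hm]

variable {U : Type*} [NormedAddCommGroup U] [NormedSpace ℂ U] [LieRingModule 𝔤 U]
  [LieModule ℂ 𝔤 U]

/-- `ψ` is Weyl antiinvariant: `(w ψ)(x) = w · ψ(w⁻¹ x)` equals `ε(w) ψ(x)` for all elements
`w` of the Weyl group, `ε(w)` being the determinant of `w` on the Cartan subalgebra.
Both sides are compared at the points off the affine root hyperplanes. -/
def IsWeylAntiinvariant (ψ : H → U) : Prop :=
  ∀ (w : H ≃ₗ[ℂ] H) (n : (Module.End ℂ U)ˣ), IsWeylLift H U w n →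
    ∀ x ∈ regularSet H,
      (n : Module.End ℂ U) (ψ (w.symm x)) = LinearMap.det (w : H →ₗ[ℂ] H) • ψ x

/-- The Laplacian `∑_ν ∂² / ∂λ_ν²` in the coordinates of a basis `b` of `V`. -/
def laplacian {ι V : Type*} [Fintype ι] [AddCommGroup V] [Module ℂ V] (b : Module.Basis ι ℂ V)
    (ψ : V → U) (x : V) : U :=
  ∑ ν, iteratedDeriv 2 (fun t : ℂ => ψ (x + t • b ν)) 0

/-- The Schrödinger operator
`(H ψ)(x) = - (△ ψ)(x) + ∑_α π² / sin² (π α(x)) · e_α e_{-α} ψ(x)`,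
the sum running over all roots. -/
def schrodinger {ι : Type*} [Fintype ι] (b : Module.Basis ι ℂ H)
    (e : LieModule.Weight ℂ H 𝔤 → 𝔤) [LieAlgebra.IsKilling ℂ 𝔤] (ψ : H → U) (x : H) : U :=
  -laplacian b ψ x +
    ∑ α ∈ H.root,
      ((Real.pi : ℂ) ^ 2 / Complex.sin (Real.pi * α x) ^ 2) • ⁅e α, ⁅e (-α), ψ x⁆⁆

end Operators

end CalogeroSutherland

end

/-! Near a point lying only on the hyperplane `α = m`, write `ψ = (α - m)^(-k) Φ` with `Φ`
holomorphic. Put `κ = (α, α)` and `f = (2/κ) e_{-α}`, so that `e_α`, `f` and the coroot form an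
`sl₂`-triple. Only the potentials of `±α` are singular at such a point, and the most singular terms
of the eigenvalue equation give `e_α f Φ = k(k+1) Φ` there. So `Φ` takes values in the zero weight
space of the `sl₂`-isotypical component of highest weight `2k`, where a representative of the
reflection acts by `(-1)^k` (`sl2Weyl_apply_zero_weight`). Antiinvariance together with periodicity
gives the affine reflection in `α = m`, under which `ψ` is odd; this forces `(-1)^k Φ = -(-1)^k Φ`
on the hyperplane, so `Φ` vanishes there (`hasNoLeadingCoeff_rootFamily`). This holds for every `k ≥
0`: there is no pole, and the extended function vanishes on the hyperplanes.

Passing from generic points of the hyperplanes to all points is a Hartogs-type argument. Averages of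
`ψ` over circles in a direction transversal to all hyperplanes are holomorphic across them and agree
with `ψ` on a dense set (`extendsAt_of_hasNoLeadingCoeff`).

For the order of vanishing, one shows `e_α^l ψ = O((α - m)^min(k, l+1))` by induction on `k`. Let
`Φ_l` be the coefficient of order `k` of `e_α^l ψ`, with `l ≥ k`. Applying `e_α^l` to the equation
and comparing terms of order `k - 2` gives `k(k-1) Φ_l = l(l+1) Φ_l + f Φ_{l+1}` on the hyperplane.
Since `k(k-1) < l(l+1)` and `e_α` is nilpotent, descending induction on `l` yields `Φ_l = 0`
(`leadingCoeff_eq_zero`). The other roots do not interfere: by invariance of `∑ e_β ⊗ e_{-β}`,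
commuting `i` copies of `e_α` past their potential produces `i`-th differences along `α`-strings
(`ad_pow_rootSum`). Since `1/sin²(π·)` has period one, these are `O((α - m)^i)`
(`isBigO_sum_otherPotential`), which makes up for the order lost in replacing `e_α^l ψ` by
`e_α^(l-i) ψ`. -/

set_option linter.unusedSectionVars false

noncomputable section

namespace CalogeroSutherland

/-! ### Holomorphic functions of several variables, through Cauchy's formula on complex lines. -/

section SeveralVariables

open Metric Real

variable {E F : Type*} [NormedAddCommGroup E] [NormedSpace ℂ E]
  [NormedAddCommGroup F] [NormedSpace ℂ F]

theorem continuousOn_circleAverage_translate {g : E → F} {D V : Set E} {v : E} {r : ℝ}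
    {c : ℂ → ℂ} (hc : ContinuousOn c (sphere 0 |r|)) (hg : ContinuousOn g D)
    (h : ∀ z ∈ V, ∀ ζ ∈ sphere (0 : ℂ) |r|, z + ζ • v ∈ D) :
    ContinuousOn (fun z => circleAverage (fun ζ => c ζ • g (z + ζ • v)) 0 r) V := by
  rw [continuousOn_iff_continuous_domRestrict] at *
  apply (intervalIntegral.continuous_parametric_intervalIntegral_of_continuous' _ _ _).const_smul
  have h1 : Continuous fun x : V × ℝ =>
      (⟨circleMap 0 r x.2, circleMap_mem_sphere' 0 r x.2⟩ : sphere (0 : ℂ) |r|) := by fun_prop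
  have h2 : Continuous fun x : V × ℝ =>
      (⟨x.1 + circleMap 0 r x.2 • v, h x.1 x.1.2 _ (circleMap_mem_sphere' 0 r x.2)⟩ : D) := by
    fun_prop
  exact (hc.comp h1).smul (hg.comp h2)

/-- Cauchy's formula for the first derivative on the disc `ζ ↦ z + ζ w`: a circle average already
contains one factor `1/ζ`, so only one more appears. -/
theorem fderiv_eq_circleAverage [CompleteSpace F] {g : E → F} {D : Set E} (hD : IsOpen D)
    (hg : DifferentiableOn ℂ g D) {z w : E} {r : ℝ} (hr : 0 < r)
    (h : ∀ ζ ∈ closedBall (0 : ℂ) r, z + ζ • w ∈ D) :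
    fderiv ℂ g z w = circleAverage (fun ζ => ζ⁻¹ • g (z + ζ • w)) 0 r := by
  have hd : ∀ ζ ∈ closedBall (0 : ℂ) r,
      HasDerivAt (fun ζ : ℂ => g (z + ζ • w)) (fderiv ℂ g (z + ζ • w) w) ζ := by
    intro ζ hζ
    have h1 := (hg.differentiableAt (hD.mem_nhds (h ζ hζ))).hasFDerivAt
    have h2 : HasDerivAt (fun ζ : ℂ => z + ζ • w) w ζ := by
      simpa using ((hasDerivAt_id ζ).smul_const w).const_add z
    exact h1.comp_hasDerivAt ζ h2
  have h0 := (hd 0 (by simp [hr.le])).deriv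
  simp only [zero_smul, add_zero] at h0
  rw [← h0]
  have hdc : DiffContOnCl ℂ (fun ζ : ℂ => g (z + ζ • w)) (ball 0 r) := by
    apply DifferentiableOn.diffContOnCl
    rw [closure_ball _ hr.ne']
    exact fun ζ hζ => (hd ζ hζ).differentiableAt.differentiableWithinAt
  rw [circleAverage_eq_circleIntegral hr.ne', eq_inv_smul_iff₀ Complex.two_pi_I_ne_zero,
    ← hdc.deriv_eq_smul_circleIntegral hr]
  refine circleIntegral.integral_congr hr.le fun ζ hζ => ?_
  simp only [smul_smul, sub_zero, one_div, sq, mul_inv]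

theorem exists_closedBall_smul_add_mem {D : Set E} (hD : IsOpen D) {z : E} (hz : z ∈ D) (w : E) :
    ∃ r > 0, ∃ V, IsOpen V ∧ z ∈ V ∧ ∀ y ∈ V, ∀ ζ ∈ closedBall (0 : ℂ) r, y + ζ • w ∈ D := by
  have hc : Continuous fun p : E × ℂ => p.1 + p.2 • w := by fun_prop
  have : (fun p : E × ℂ => p.1 + p.2 • w) ⁻¹' D ∈ 𝓝 (z, (0 : ℂ)) :=
    (hD.preimage hc).mem_nhds (by simpa)
  rw [nhds_prod_eq, Filter.mem_prod_iff] at this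
  obtain ⟨s, hs, u, hu, hsu⟩ := this
  obtain ⟨V, hVs, hV, hzV⟩ := _root_.mem_nhds_iff.1 hs
  obtain ⟨r, hr, hru⟩ := Metric.nhds_basis_closedBall.mem_iff.1 hu
  exact ⟨r, hr, V, hV, hzV, fun y hy ζ hζ => hsu (Set.mk_mem_prod (hVs hy) (hru hζ))⟩

variable [FiniteDimensional ℂ E] [CompleteSpace F]

/-- Locally the derivative is an average of `g` over circles of one fixed radius. Continuity of the
derivative supplies the dominating constant for differentiation under the integral below. -/
theorem continuousOn_fderiv_of_differentiableOn {g : E → F} {D : Set E} (hD : IsOpen D)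
    (hg : DifferentiableOn ℂ g D) : ContinuousOn (fderiv ℂ g) D := by
  rw [continuousOn_clm_apply]
  intro w z hz
  obtain ⟨r, hr, V, hV, hzV, h⟩ := exists_closedBall_smul_add_mem hD hz w
  have h1 : ContinuousOn (fun y => circleAverage (fun ζ => ζ⁻¹ • g (y + ζ • w)) 0 r) V := by
    apply continuousOn_circleAverage_translate (D := D) _ hg.continuousOn
    · intro y hy ζ hζ
      exact h y hy ζ (sphere_subset_closedBall (by rwa [abs_of_pos hr] at hζ))
    · exact continuousOn_inv₀.mono fun ζ hζ => by
        simp only [abs_of_pos hr] at hζ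
        exact ne_zero_of_mem_sphere hr.ne' ⟨ζ, hζ⟩
  have h2 : (fun y => fderiv ℂ g y w) =ᶠ[𝓝 z]
      fun y => circleAverage (fun ζ => ζ⁻¹ • g (y + ζ • w)) 0 r := by
    filter_upwards [hV.mem_nhds hzV] with y hy
    exact fderiv_eq_circleAverage hD hg hr (h y hy)
  exact ((h1.continuousAt (hV.mem_nhds hzV)).congr h2.symm).continuousWithinAt

/-- Differentiation under the integral sign. Only the circles have to lie in `D`, not the discs they
bound; this is what allows extension across singularities. -/
theorem differentiableOn_circleAverage_translate {g : E → F} {D V : Set E} (hD : IsOpen D)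
    (hV : IsOpen V) {v : E} {r : ℝ} {c : ℂ → ℂ} (hc : ContinuousOn c (sphere 0 |r|))
    (hg : DifferentiableOn ℂ g D)
    (h : ∀ z ∈ V, ∀ ζ ∈ sphere (0 : ℂ) |r|, z + ζ • v ∈ D) :
    DifferentiableOn ℂ (fun z => circleAverage (fun ζ => c ζ • g (z + ζ • v)) 0 r) V := by
  intro z hz
  obtain ⟨δ, hδ, hδV⟩ := Metric.nhds_basis_closedBall.mem_iff.1 (hV.mem_nhds hz)
  have hcm : Continuous fun θ : ℝ => c (circleMap 0 r θ) := by
    rw [continuousOn_iff_continuous_domRestrict] at hc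
    have h1 : Continuous fun x : ℝ =>
      (⟨circleMap 0 r x, circleMap_mem_sphere' 0 r x⟩ : sphere (0 : ℂ) |r|) := by fun_prop
    exact hc.comp h1
  have hm : ∀ y ∈ V, ContinuousOn (fun θ : ℝ => y + circleMap 0 r θ • v) Set.univ ∧
      Set.MapsTo (fun θ : ℝ => y + circleMap 0 r θ • v) Set.univ D := fun y hy =>
    ⟨by fun_prop, fun θ _ => h y hy _ (circleMap_mem_sphere' 0 r θ)⟩
  have hgm : ∀ y ∈ V, Continuous fun θ : ℝ => g (y + circleMap 0 r θ • v) := fun y hy =>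
    continuousOn_univ.1 (hg.continuousOn.comp (hm y hy).1 (hm y hy).2)
  have hfd := continuousOn_fderiv_of_differentiableOn hD hg
  have hcont : ContinuousOn (fun p : E × ℂ => c p.2 • fderiv ℂ g (p.1 + p.2 • v))
      (closedBall z δ ×ˢ sphere (0 : ℂ) |r|) := by
    refine ContinuousOn.smul (hc.comp continuousOn_snd fun p hp => hp.2) ?_
    exact hfd.comp (by fun_prop) fun p hp => h _ (hδV hp.1) _ hp.2
  have hK : IsCompact (closedBall z δ ×ˢ sphere (0 : ℂ) |r|) := by
    have : ProperSpace E := FiniteDimensional.proper ℂ E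
    exact (isCompact_closedBall z δ).prod (isCompact_sphere _ _)
  obtain ⟨C, hC⟩ := hK.exists_bound_of_continuousOn hcont
  have key := intervalIntegral.hasFDerivAt_integral_of_dominated_of_fderiv_le (𝕜 := ℂ)
    (μ := MeasureTheory.volume) (a := 0) (b := 2 * π) (bound := fun _ => C) (x₀ := z)
    (F := fun y θ => c (circleMap 0 r θ) • g (y + circleMap 0 r θ • v))
    (F' := fun y θ => c (circleMap 0 r θ) • fderiv ℂ g (y + circleMap 0 r θ • v))
    (s := closedBall z δ) (closedBall_mem_nhds z hδ) ?_ ?_ ?_ ?_ ?_ ?_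
  · unfold circleAverage
    exact (key.differentiableAt.const_smul _).differentiableWithinAt
  · filter_upwards [hV.mem_nhds hz] with y hy
    exact (hcm.smul (hgm y hy)).aestronglyMeasurable
  · exact (hcm.smul (hgm z hz)).intervalIntegrable _ _
  · exact (hcm.smul (continuousOn_univ.1 (hfd.comp (hm z hz).1 (hm z hz).2))).aestronglyMeasurable
  · exact Eventually.of_forall fun θ _ y hy => hC (y, circleMap 0 r θ)
      (Set.mk_mem_prod hy (circleMap_mem_sphere' 0 r θ))
  · exact intervalIntegrable_const
  · refine Eventually.of_forall fun θ _ y hy => ?_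
    have h1 := (hg.differentiableAt (hD.mem_nhds (h y (hδV hy) _
      (circleMap_mem_sphere' 0 r θ)))).hasFDerivAt
    have h2 := h1.comp y ((hasFDerivAt_id y).add_const (circleMap 0 r θ • v))
    exact h2.const_smul (c (circleMap 0 r θ))

theorem differentiableOn_fderiv_apply {g : E → F} {D : Set E} (hD : IsOpen D)
    (hg : DifferentiableOn ℂ g D) (w : E) : DifferentiableOn ℂ (fun z => fderiv ℂ g z w) D := by
  intro z hz
  obtain ⟨r, hr, V, hV, hzV, h⟩ := exists_closedBall_smul_add_mem hD hz w
  have h1 : DifferentiableOn ℂ (fun y => circleAverage (fun ζ => ζ⁻¹ • g (y + ζ • w)) 0 r) V := by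
    apply differentiableOn_circleAverage_translate hD hV _ hg
    · intro y hy ζ hζ
      exact h y hy ζ (sphere_subset_closedBall (by rwa [abs_of_pos hr] at hζ))
    · exact continuousOn_inv₀.mono fun ζ hζ => by
        simp only [abs_of_pos hr] at hζ
        exact ne_zero_of_mem_sphere hr.ne' ⟨ζ, hζ⟩
  have h2 : (fun y => fderiv ℂ g y w) =ᶠ[𝓝 z]
      fun y => circleAverage (fun ζ => ζ⁻¹ • g (y + ζ • w)) 0 r := by
    filter_upwards [hV.mem_nhds hzV] with y hy
    exact fderiv_eq_circleAverage hD hg hr (h y hy)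
  exact ((h1.differentiableAt (hV.mem_nhds hzV)).congr_of_eventuallyEq h2).differentiableWithinAt

end SeveralVariables

/-! ### Division by the equation of a hyperplane. -/

section Division

open Metric Real

variable {E F : Type*} [NormedAddCommGroup E] [NormedSpace ℂ E]
  [NormedAddCommGroup F] [NormedSpace ℂ F]

theorem exists_apply_eq_one {a : E →L[ℂ] ℂ} (ha : a ≠ 0) : ∃ v, a v = 1 := by
  obtain ⟨w, hw⟩ : ∃ w, a w ≠ 0 := by
    by_contra! h
    exact ha (ContinuousLinearMap.ext h)
  exact ⟨(a w)⁻¹ • w, by simp [hw]⟩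

theorem hasDerivAt_translate {g : E → F} {z w : E} {ζ : ℂ}
    (hg : DifferentiableAt ℂ g (z + ζ • w)) :
    HasDerivAt (fun ζ : ℂ => g (z + ζ • w)) (fderiv ℂ g (z + ζ • w) w) ζ := by
  have h2 : HasDerivAt (fun ζ : ℂ => z + ζ • w) w ζ := by
    simpa using ((hasDerivAt_id ζ).smul_const w).const_add z
  exact hg.hasFDerivAt.comp_hasDerivAt ζ h2

variable [FiniteDimensional ℂ E] [CompleteSpace F]

theorem circleAverage_of_differentiableOn_closedBall {f : ℂ → F} {r : ℝ} (hr : 0 < r)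
    (hf : DifferentiableOn ℂ f (closedBall 0 r)) : circleAverage f 0 r = f 0 := by
  apply DiffContOnCl.circleAverage
  apply DifferentiableOn.diffContOnCl
  rwa [abs_of_pos hr, closure_ball _ hr.ne']

/-- A holomorphic function which vanishes on an affine hyperplane is divisible by the equation of
the hyperplane. -/
theorem exists_eq_sub_smul_of_eq_zero {V : Set E} (hV : IsOpen V) {q : E → F}
    (hq : DifferentiableOn ℂ q V) {a : E →L[ℂ] ℂ} (ha : a ≠ 0) (m : ℂ)
    (h0 : ∀ z ∈ V, a z = m → q z = 0) :
    ∃ q₁ : E → F, DifferentiableOn ℂ q₁ V ∧ ∀ z ∈ V, q z = (a z - m) • q₁ z := by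
  classical
  obtain ⟨v, hv⟩ := exists_apply_eq_one ha
  set g : E → F := fun z => (a z - m)⁻¹ • q z with hg
  set D : Set E := V ∩ {z | a z ≠ m} with hDdef
  have hD : IsOpen D := hV.inter (isOpen_ne_fun a.continuous continuous_const)
  have hgD : DifferentiableOn ℂ g D := by
    refine DifferentiableOn.smul (DifferentiableOn.inv (by fun_prop) ?_)
      (hq.mono Set.inter_subset_left)
    exact fun z hz => sub_ne_zero.2 hz.2
  -- On the hyperplane the quotient must be the derivative of `q` in the direction `v`, because `a v
  -- = 1`.
  set q₁ : E → F := fun z => if a z = m then fderiv ℂ q z v else g z with hq₁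
  refine ⟨q₁, ?_, ?_⟩
  · intro z hz
    apply DifferentiableAt.differentiableWithinAt
    by_cases hzm : a z = m
    · obtain ⟨r, hr, W, hW, hzW, hWV⟩ := exists_closedBall_smul_add_mem hV hz v
      set W' : Set E := W ∩ {y | ‖a y - m‖ < r} with hW'def
      have hW' : IsOpen W' :=
        hW.inter (isOpen_lt (by fun_prop) continuous_const)
      have hzW' : z ∈ W' := ⟨hzW, by simpa [hzm] using hr⟩
      have hcirc : ∀ y ∈ W', ∀ ζ ∈ sphere (0 : ℂ) |r|, y + ζ • v ∈ D := by
        intro y hy ζ hζ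
        rw [abs_of_pos hr] at hζ
        refine ⟨hWV y hy.1 ζ (sphere_subset_closedBall hζ), fun h => ?_⟩
        have h1 : ‖a y - m‖ < r := hy.2
        have h2 : a y - m = -ζ := by
          simp only [map_add, map_smul, hv, smul_eq_mul, mul_one] at h
          linear_combination h
        rw [h2, norm_neg] at h1
        exact h1.ne (by simpa using hζ)
      have hdiff := differentiableOn_circleAverage_translate hD hW' (v := v) (r := r)
        (c := fun _ => 1) continuousOn_const hgD hcirc
      refine (hdiff.differentiableAt (hW'.mem_nhds hzW')).congr_of_eventuallyEq ?_
      filter_upwards [hW'.mem_nhds hzW'] with y hy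
      -- The line through `y` meets the hyperplane at the parameter `ζ₀`. There `f` vanishes, and
      -- `q₁ y` is its divided difference `dslope f ζ₀` at `0`, hence the mean of that divided
      -- difference over the circle, where it coincides with `g`.
      set f : ℂ → F := fun ζ => q (y + ζ • v) with hf
      set ζ₀ : ℂ := -(a y - m) with hζ₀
      have hfd : ∀ ζ ∈ closedBall (0 : ℂ) r,
          HasDerivAt f (fderiv ℂ q (y + ζ • v) v) ζ := fun ζ hζ =>
        hasDerivAt_translate (hq.differentiableAt (hV.mem_nhds (hWV y hy.1 ζ hζ)))
      have hζ₀r : ζ₀ ∈ ball (0 : ℂ) r := by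
        have : ‖a y - m‖ < r := hy.2
        simpa [hζ₀, ← norm_neg (a y - m)] using this
      have hfζ₀ : f ζ₀ = 0 := by
        apply h0 _ (hWV y hy.1 ζ₀ (ball_subset_closedBall hζ₀r))
        simp [hζ₀, hv]
      have hdsl : DifferentiableOn ℂ (dslope f ζ₀) (closedBall 0 r) := by
        rw [Complex.differentiableOn_dslope (mem_of_superset (isOpen_ball.mem_nhds hζ₀r)
          ball_subset_closedBall)]
        exact fun ζ hζ => (hfd ζ hζ).differentiableAt.differentiableWithinAt
      have h1 := circleAverage_of_differentiableOn_closedBall hr hdsl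
      have h2 : q₁ y = dslope f ζ₀ 0 := by
        by_cases hy0 : a y = m
        · have : ζ₀ = 0 := by simp [hζ₀, hy0]
          rw [this, dslope_same, (hfd 0 (by simp [hr.le])).deriv]
          simp [hq₁, hy0]
        · have : (0 : ℂ) ≠ ζ₀ := by
            rw [hζ₀, ne_comm, neg_ne_zero, sub_ne_zero]; exact hy0
          rw [dslope_of_ne _ this, slope_def_module, hfζ₀]
          simp [hq₁, hy0, hg, hζ₀, hf]
      rw [h2, ← h1]
      refine circleAverage_congr_sphere fun ζ hζ => ?_
      have hne : ζ ≠ ζ₀ := by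
        rintro rfl
        rw [abs_of_pos hr] at hζ
        exact (mem_ball.1 hζ₀r).ne (mem_sphere.1 hζ)
      rw [dslope_of_ne _ hne, slope_def_module, hfζ₀]
      simp only [hg, one_smul, sub_zero, hf]
      congr 2
      simp [hζ₀, hv]; ring
    · refine ((hgD.differentiableAt (hD.mem_nhds ⟨hz, hzm⟩))).congr_of_eventuallyEq ?_
      filter_upwards [hD.mem_nhds ⟨hz, hzm⟩] with y hy
      have hym : a y ≠ m := hy.2
      simp [hq₁, hym]
  · intro z hz
    by_cases hzm : a z = m
    · simp [h0 z hz hzm, hzm]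
    · simp [hq₁, hzm, hg, smul_smul, sub_ne_zero.2 hzm]

/-- A holomorphic function which is not identically zero along a line transversal to an affine
hyperplane is a power of the equation of the hyperplane times a function which is not identically
zero on the hyperplane. -/
theorem exists_eq_sub_pow_mul {V : Set E} (hV : IsOpen V) {a : E →L[ℂ] ℂ}
    {m : ℂ} {v : E} (hv : a v = 1) {y : E} (hy : y ∈ V) (hym : a y = m) (n : ℕ) :
    ∀ {q : E → ℂ}, DifferentiableOn ℂ q V →
      analyticOrderAt (fun s : ℂ => q (y + s • v)) 0 = n →
      ∃ (J : ℕ) (q₁ : E → ℂ) (x : E), DifferentiableOn ℂ q₁ V ∧ x ∈ V ∧ a x = m ∧ q₁ x ≠ 0 ∧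
        ∀ z ∈ V, q z = (a z - m) ^ J * q₁ z := by
  have ha : a ≠ 0 := by rintro rfl; simp at hv
  induction n with
  | zero =>
    intro q hq hord
    refine ⟨0, q, y, hq, hy, hym, ?_, by simp⟩
    have han : AnalyticAt ℂ (fun s : ℂ => q (y + s • v)) 0 := by
      refine DifferentiableOn.analyticAt (s := (fun s : ℂ => y + s • v) ⁻¹' V)
        (hq.comp (by fun_prop) fun s hs => hs)
        ((hV.preimage (by fun_prop)).mem_nhds (by simpa))
    have := (han.analyticOrderAt_eq_zero).1 (by simpa using hord)
    simpa using this
  | succ n ih =>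
    intro q hq hord
    -- If `q` vanishes on the hyperplane, dividing once lowers its order along the line by one;
    -- otherwise nothing more is to be divided out.
    by_cases h0 : ∀ z ∈ V, a z = m → q z = 0
    · obtain ⟨q₁, hq₁, hqq⟩ := exists_eq_sub_smul_of_eq_zero hV hq ha m h0
      have han : AnalyticAt ℂ (fun s : ℂ => q₁ (y + s • v)) 0 := by
        refine DifferentiableOn.analyticAt (s := (fun s : ℂ => y + s • v) ⁻¹' V)
          (hq₁.comp (by fun_prop) fun s hs => hs)
          ((hV.preimage (by fun_prop)).mem_nhds (by simpa))
      have heq : (fun s : ℂ => q (y + s • v)) =ᶠ[𝓝 0]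
          id * (fun s : ℂ => q₁ (y + s • v)) := by
        have : (fun s : ℂ => y + s • v) ⁻¹' V ∈ 𝓝 0 :=
          (hV.preimage (by fun_prop)).mem_nhds (by simpa)
        filter_upwards [this] with s hs
        rw [hqq _ hs]
        simp [hv, hym]
      rw [analyticOrderAt_congr heq, analyticOrderAt_mul analyticAt_id han,
        analyticOrderAt_id] at hord
      have hord' : analyticOrderAt (fun s : ℂ => q₁ (y + s • v)) 0 = n := by
        push_cast at hord
        rw [add_comm] at hord
        exact (ENat.add_left_injective_of_ne_top ENat.one_ne_top) hord
      obtain ⟨J, q₂, x, hq₂, hx, hxm, hqx, hJ⟩ := ih hq₁ hord'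
      refine ⟨J + 1, q₂, x, hq₂, hx, hxm, hqx, fun z hz => ?_⟩
      rw [hqq z hz, hJ z hz, smul_eq_mul, pow_succ]; ring
    · push Not at h0
      obtain ⟨x, hx, hxm, hqx⟩ := h0
      exact ⟨0, q, x, hq, hx, hxm, hqx, by simp⟩

end Division

/-! ### Extension across a locally finite arrangement of hyperplanes. -/

section Extension

open Metric Real

/-- The integers are closed and discrete in `ℂ`. Hence near a point only the hyperplanes through
that point matter. -/
theorem eventually_eq_intCast_imp (c : ℂ) : ∀ᶠ w : ℂ in 𝓝 c, ∀ m : ℤ, w = m → c = m := by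
  by_cases hc : ∃ n : ℤ, c = n
  · obtain ⟨n, rfl⟩ := hc
    filter_upwards [ball_mem_nhds (n : ℂ) one_pos] with w hw m hm
    rw [hm, mem_ball, dist_eq_norm, ← Int.cast_sub, Complex.norm_intCast] at hw
    have : m - n = 0 := by
      have h1 : |m - n| < 1 := by exact_mod_cast hw
      exact Int.abs_lt_one_iff.1 h1
    rw [sub_eq_zero.1 this]
  · have : (Set.range ((↑) : ℤ → ℂ))ᶜ ∈ 𝓝 c :=
      Complex.isClosed_range_intCast.isOpen_compl.mem_nhds fun ⟨n, hn⟩ => hc ⟨n, hn.symm⟩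
    filter_upwards [this] with w hw m hm
    exact absurd ⟨m, hm.symm⟩ hw

variable {E F : Type*} [NormedAddCommGroup E] [NormedSpace ℂ E]
  [NormedAddCommGroup F] [NormedSpace ℂ F] {κ : Type*}

/-- The complement of the affine hyperplanes on which one of the functionals `a i` takes an
integer value. -/
def hyperplaneCompl (a : κ → E →L[ℂ] ℂ) : Set E := {z | ∀ i, ∀ m : ℤ, a i z ≠ m}

/-- The only functionals `a j` with an integer value at `y` are the multiples of `a i`. -/
def IsGenericPoint (a : κ → E →L[ℂ] ℂ) (i : κ) (y : E) : Prop :=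
  ∀ j, ∀ m : ℤ, a j y = m → ∃ c : ℂ, a j = c • a i

/-- Near `x`, the function `ψ` given on `D` is the restriction of a holomorphic function. -/
def ExtendsAt (D : Set E) (ψ : E → F) (x : E) : Prop :=
  ∃ V, IsOpen V ∧ x ∈ V ∧ ∃ Φ : E → F, DifferentiableOn ℂ Φ V ∧ Set.EqOn Φ ψ (V ∩ D)

variable {a : κ → E →L[ℂ] ℂ}

theorem isOpen_setOf_extendsAt (D : Set E) (ψ : E → F) : IsOpen {x | ExtendsAt D ψ x} := by
  rw [isOpen_iff_mem_nhds]
  rintro x ⟨V, hV, hx, Φ, h⟩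
  filter_upwards [hV.mem_nhds hx] with y hy
  exact ⟨V, hV, hy, Φ, h⟩

theorem differentiableAt_extendFrom {D : Set E} (hD : Dense D) {ψ : E → F} {x : E}
    (hx : ExtendsAt D ψ x) : DifferentiableAt ℂ (extendFrom D ψ) x := by
  obtain ⟨V, hV, hxV, Φ, hΦ, hΦψ⟩ := hx
  refine (hΦ.differentiableAt (hV.mem_nhds hxV)).congr_of_eventuallyEq ?_
  filter_upwards [hV.mem_nhds hxV] with y hy
  apply extendFrom_eq (hD y)
  have h1 : Tendsto Φ (𝓝[D] y) (𝓝 (Φ y)) :=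
    (hΦ.differentiableAt (hV.mem_nhds hy)).continuousAt.mono_left nhdsWithin_le_nhds
  refine h1.congr' ?_
  filter_upwards [mem_nhdsWithin_of_mem_nhds (hV.mem_nhds hy), self_mem_nhdsWithin] with z hz hzD
  exact hΦψ ⟨hz, hzD⟩

variable [Finite κ]

theorem eventually_apply_eq_intCast_imp (a : κ → E →L[ℂ] ℂ) (x : E) :
    ∀ᶠ y in 𝓝 x, ∀ i, ∀ m : ℤ, a i y = m → a i x = m := by
  rw [eventually_all]
  exact fun i => (a i).continuous.continuousAt.eventually (eventually_eq_intCast_imp (a i x))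

theorem isOpen_hyperplaneCompl (a : κ → E →L[ℂ] ℂ) : IsOpen (hyperplaneCompl a) := by
  rw [isOpen_iff_mem_nhds]
  intro x hx
  filter_upwards [eventually_apply_eq_intCast_imp a x] with y hy i m h
  exact hx i m (hy i m h)

theorem exists_forall_apply_ne_zero (ha : ∀ i, a i ≠ 0) : ∃ v, ∀ i, a i v ≠ 0 := by
  refine Module.Dual.exists_forall_ne_zero_of_forall_exists
    (fun i => (a i : E →ₗ[ℂ] ℂ)) fun i => ?_
  by_contra! h
  exact ha i (ContinuousLinearMap.ext h)

theorem dense_hyperplaneCompl (ha : ∀ i, a i ≠ 0) : Dense (hyperplaneCompl a) := by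
  intro x
  obtain ⟨v, hv⟩ := exists_forall_apply_ne_zero ha
  have hc : Tendsto (fun s : ℂ => x + s • v) (𝓝[≠] 0) (𝓝 x) := by
    have : Continuous fun s : ℂ => x + s • v := by fun_prop
    simpa using (this.tendsto 0).mono_left nhdsWithin_le_nhds
  refine mem_closure_of_tendsto hc ?_
  filter_upwards [hc.eventually (eventually_apply_eq_intCast_imp a x), self_mem_nhdsWithin]
    with s hs hs0 i m him
  have h1 := hs i m him
  rw [map_add, h1, map_smul, smul_eq_mul, add_eq_left] at him
  exact (mul_ne_zero hs0 (hv i)) him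

/-- A functional not proportional to `a i` is nonzero somewhere on `ker (a i)`. As there are
finitely many, one direction `w` in the kernel works for all of them, and a small move along `w`
leaves every other hyperplane through `x`. -/
theorem exists_isGenericPoint_mem {i : κ} {x : E} {W : Set E} (hW : W ∈ 𝓝 x) :
    ∃ y ∈ W, a i y = a i x ∧ IsGenericPoint a i y := by
  classical
  obtain ⟨w, hw, hwj⟩ := Module.Dual.exists_forall_mem_ne_zero_of_forall_exists
    (LinearMap.ker (a i : E →ₗ[ℂ] ℂ))
    (fun j : {j // ¬ ∃ c : ℂ, a j = c • a i} => (a j : E →ₗ[ℂ] ℂ)) (by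
      rintro ⟨j, hj⟩
      by_contra! h
      apply hj
      have h1 := mem_span_of_iInf_ker_le_ker (ι := Unit) (L := fun _ => (a i : E →ₗ[ℂ] ℂ))
        (K := (a j : E →ₗ[ℂ] ℂ)) (by
          intro z hz
          simp only [iInf_const] at hz
          exact h z hz)
      rw [Set.range_const, Submodule.mem_span_singleton] at h1
      obtain ⟨c, hc⟩ := h1
      exact ⟨c, by ext z; simpa using (LinearMap.congr_fun hc z).symm⟩)
  have hw0 : a i w = 0 := hw
  have hc : Tendsto (fun s : ℂ => x + s • w) (𝓝[≠] 0) (𝓝 x) := by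
    have : Continuous fun s : ℂ => x + s • w := by fun_prop
    simpa using (this.tendsto 0).mono_left nhdsWithin_le_nhds
  have hev : ∀ᶠ s in 𝓝[≠] (0 : ℂ), x + s • w ∈ W ∧ IsGenericPoint a i (x + s • w) := by
    filter_upwards [hc.eventually (eventually_apply_eq_intCast_imp a x), self_mem_nhdsWithin,
      hc.eventually hW] with s hs hs0 hsW
    refine ⟨hsW, fun j m hj => ?_⟩
    by_contra hne
    have h1 := hs j m hj
    rw [map_add, h1, map_smul, smul_eq_mul, add_eq_left] at hj
    exact (mul_ne_zero hs0 (hwj ⟨j, hne⟩)) hj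
  obtain ⟨s, hsW, hsg⟩ := hev.exists
  exact ⟨_, hsW, by simp [hw0], hsg⟩

/-- All hyperplanes through a generic point coincide, their functionals being proportional to `a i`.
-/
theorem eventually_mem_hyperplaneCompl_of_isGenericPoint (ha : ∀ i, a i ≠ 0) {i : κ} {m : ℤ}
    {y : E} (hym : a i y = m) (hy : IsGenericPoint a i y) :
    ∀ᶠ z in 𝓝 y, (a i z ≠ m → z ∈ hyperplaneCompl a) ∧
      (a i z = m → IsGenericPoint a i z) := by
  filter_upwards [eventually_apply_eq_intCast_imp a y] with z hz
  refine ⟨fun hzm j n hj => hzm ?_, fun _ j n hj => hy j n (hz j n hj)⟩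
  have h1 := hz j n hj
  obtain ⟨c, hc⟩ := hy j n h1
  have hc0 : c ≠ 0 := by
    rintro rfl
    exact ha j (ContinuousLinearMap.ext fun w => by rw [hc]; exact zero_mul _)
  have h2 : c * a i z = c * a i y := by
    have e1 : a j z = c * a i z := by rw [hc]; simp
    have e2 : a j y = c * a i y := by rw [hc]; simp
    rw [← e1, ← e2, h1, hj]
  rw [← hym]
  exact mul_left_cancel₀ hc0 h2

/-- A continuous function that vanishes at the generic points of an affine hyperplane vanishes on
the whole hyperplane. -/
theorem eq_zero_of_forall_isGenericPoint {f : E → F} (hf : Continuous f) {i : κ} {m : ℂ}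
    (h : ∀ y, a i y = m → IsGenericPoint a i y → f y = 0) {y : E} (hy : a i y = m) : f y = 0 := by
  by_contra hne
  obtain ⟨z, hz, hzm, hzg⟩ := exists_isGenericPoint_mem (a := a) (i := i)
    ((isOpen_ne_fun hf continuous_const).mem_nhds hne)
  exact hz (h z (hzm.trans hy) hzg)

/-- If `ψ` had a pole along `a i = m`, or a nonzero value there, then its leading coefficient would
not vanish at some generic point: this condition excludes it. -/
def HasNoLeadingCoeff (a : κ → E →L[ℂ] ℂ) (ψ : E → F) : Prop :=
  ∀ (i : κ) (m : ℤ) (y : E), a i y = m → IsGenericPoint a i y →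
    ∀ (k : ℕ) (V : Set E) (Φ : E → F), IsOpen V → y ∈ V → DifferentiableOn ℂ Φ V →
      (∀ z ∈ V ∩ hyperplaneCompl a, Φ z = (a i z - m) ^ k • ψ z) → Φ y = 0

variable [FiniteDimensional ℂ E] [CompleteSpace F]

/-- The pole is removed one order at a time: each leading coefficient vanishes on the hyperplane,
which permits a division by its equation. -/
theorem exists_eqOn_of_pow_smul (ha : ∀ i, a i ≠ 0) {ψ : E → F} (hrem : HasNoLeadingCoeff a ψ)
    {i : κ} {m : ℤ} {V : Set E} (hV : IsOpen V)
    (hgen : ∀ z ∈ V, a i z = m → IsGenericPoint a i z) (k : ℕ) {Φ : E → F}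
    (hΦ : DifferentiableOn ℂ Φ V)
    (hΦψ : ∀ z ∈ V ∩ hyperplaneCompl a, Φ z = (a i z - m) ^ k • ψ z) :
    ∃ Φ' : E → F, DifferentiableOn ℂ Φ' V ∧ Set.EqOn Φ' ψ (V ∩ hyperplaneCompl a) := by
  induction k generalizing Φ with
  | zero => exact ⟨Φ, hΦ, fun z hz => by simpa using hΦψ z hz⟩
  | succ k ih =>
    obtain ⟨Φ₁, hΦ₁, hΦΦ⟩ := exists_eq_sub_smul_of_eq_zero hV hΦ (ha i) m fun z hz hzm =>
      hrem i m z hzm (hgen z hz hzm) (k + 1) V Φ hV hz hΦ hΦψ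
    refine ih hΦ₁ fun z hz => ?_
    have h1 := hΦψ z hz
    rw [hΦΦ z hz.1, pow_succ', mul_smul] at h1
    exact smul_right_injective F (sub_ne_zero.2 (hz.2 i m)) h1

/-- The denominator is a power of `a i - m` times a function `q₁` that is nonzero somewhere on the
hyperplane. Near such a point the singularity is a pole of bounded order along the hyperplane alone,
and it is removable by the hypothesis on leading coefficients. -/
theorem exists_extendsAt_mem (ha : ∀ i, a i ≠ 0) {ψ : E → F}
    (hmero : IsMeromorphicOff (hyperplaneCompl a) ψ) (hrem : HasNoLeadingCoeff a ψ)
    {i : κ} {m : ℤ} {x : E} (hx : a i x = m) {W : Set E} (hW : W ∈ 𝓝 x) :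
    ∃ y ∈ W, a i y = m ∧ ExtendsAt (hyperplaneCompl a) ψ y := by
  obtain ⟨y, hyW, hyx, hyg⟩ := exists_isGenericPoint_mem (a := a) (i := i) (interior_mem_nhds.2 hW)
  have hym : a i y = m := hyx.trans hx
  obtain ⟨U, hU, hyU, q, G, hq, hG, hq0, hqG⟩ := hmero y
  obtain ⟨δ, hδ, hball⟩ := Metric.mem_nhds_iff.1 (inter_mem (isOpen_interior.mem_nhds hyW)
    (inter_mem (hU.mem_nhds hyU) (eventually_mem_hyperplaneCompl_of_isGenericPoint ha hym hyg)))
  set V := ball y δ with hVdef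
  have hVo : IsOpen V := isOpen_ball
  have hqV : DifferentiableOn ℂ q V := hq.mono fun z hz => (hball hz).2.1
  have hGV : DifferentiableOn ℂ G V := hG.mono fun z hz => (hball hz).2.1
  obtain ⟨v, hv⟩ := exists_apply_eq_one (ha i)
  have hproj : Tendsto (fun p : E => p - (a i p - m) • v) (𝓝 y) (𝓝 y) := by
    have : Continuous fun p : E => p - (a i p - m) • v := by fun_prop
    simpa [hym] using this.tendsto y
  -- The denominator may vanish identically on the line through `y`. A nearby point `p` with `q p ≠
  -- 0` is therefore projected along `v` to the hyperplane, so that the line through the projection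
  -- carries a nonzero value of `q`.
  obtain ⟨p, hqp, hpV, hp'V⟩ : ∃ p, q p ≠ 0 ∧ p ∈ V ∧ p - (a i p - m) • v ∈ V :=
    ((not_eventually.1 hq0).and_eventually (Filter.Eventually.and (hVo.mem_nhds (mem_ball_self hδ))
      (hproj.eventually (hVo.mem_nhds (mem_ball_self hδ))))).exists
  set p' := p - (a i p - m) • v with hp'
  have hp'm : a i p' = m := by simp [hp', hv]
  set L : Set ℂ := (fun s : ℂ => p' + s • v) ⁻¹' V with hL
  have hLo : IsOpen L := hVo.preimage (by fun_prop)
  -- `L` is convex because `V` is a ball, so the identity theorem applies on the line.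
  have hLc : IsPreconnected L := by
    have : Convex ℝ L := by
      have hVc : Convex ℝ ((fun z => p' + z) ⁻¹' V) := (convex_ball y δ).translate_preimage_right p'
      exact hVc.linear_preimage
        (((LinearMap.toSpanSingleton ℂ E v).restrictScalars ℝ))
    exact this.isPreconnected
  have hfan : AnalyticOnNhd ℂ (fun s : ℂ => q (p' + s • v)) L :=
    (hqV.comp (by fun_prop) fun s hs => hs : DifferentiableOn ℂ _ L).analyticOnNhd hLo
  have h0L : (0 : ℂ) ∈ L := by simpa [hL] using hp'V
  have hord : analyticOrderAt (fun s : ℂ => q (p' + s • v)) 0 ≠ ⊤ := by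
    intro htop
    rw [analyticOrderAt_eq_top] at htop
    have h1 := hfan.eqOn_zero_of_preconnected_of_eventuallyEq_zero hLc h0L htop
      (x := a i p - m) (by simpa [hL, hp'] using hpV)
    apply hqp
    simpa [hp'] using h1
  obtain ⟨n, hn⟩ := ENat.ne_top_iff_exists.1 hord
  obtain ⟨J, q₁, x₁, hq₁, hx₁V, hx₁m, hqx₁, hqJ⟩ :=
    exists_eq_sub_pow_mul hVo hv hp'V hp'm n hqV hn.symm
  set V₁ : Set E := V ∩ {z | q₁ z ≠ 0} with hV₁
  have hV₁o : IsOpen V₁ := hq₁.continuousOn.isOpen_inter_preimage hVo isOpen_ne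
  obtain ⟨Φ, hΦ, hΦψ⟩ := exists_eqOn_of_pow_smul ha hrem hV₁o (i := i) (m := m)
    (fun z hz hzm => (hball hz.1).2.2.2 hzm) J (Φ := fun z => (q₁ z)⁻¹ • G z)
    (DifferentiableOn.smul ((hq₁.mono Set.inter_subset_left).inv fun z hz => hz.2)
      (hGV.mono Set.inter_subset_left))
    (by
      intro z hz
      have hz0 : q₁ z ≠ 0 := hz.1.2
      have h1 := hqG z ⟨(hball hz.1.1).2.1, hz.2⟩
      rw [← h1, hqJ z hz.1.1, mul_comm, mul_smul, inv_smul_smul₀ hz0])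
  exact ⟨x₁, interior_subset (hball hx₁V).1, hx₁m, V₁, hV₁o, ⟨hx₁V, hqx₁⟩, Φ, hΦ, hΦψ⟩

/-- The average `A` over circles transversal to all hyperplanes is holomorphic near `x`. By the mean
value property it equals `ψ` at each `z` whose disc meets the hyperplanes only at points where `ψ`
extends. Such `z` are dense, so continuity gives equality throughout. -/
theorem extendsAt_of_hasNoLeadingCoeff (ha : ∀ i, a i ≠ 0) {ψ : E → F}
    (hψ : DifferentiableOn ℂ ψ (hyperplaneCompl a))
    (hmero : IsMeromorphicOff (hyperplaneCompl a) ψ) (hrem : HasNoLeadingCoeff a ψ) (x : E) :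
    ExtendsAt (hyperplaneCompl a) ψ x := by
  have hDo := isOpen_hyperplaneCompl a
  have hDd := dense_hyperplaneCompl ha
  obtain ⟨v, hv⟩ := exists_forall_apply_ne_zero ha
  obtain ⟨U, hUx, hU, hxU⟩ := _root_.mem_nhds_iff.1 (eventually_apply_eq_intCast_imp a x)
  obtain ⟨r, hr, W, hW, hxW, hWU⟩ := exists_closedBall_smul_add_mem hU hxU v
  -- The line `z + ζ v` meets the hyperplane of `a i` through `x` at `|ζ| = ‖a i z - a i x‖ / ‖a i
  -- v‖`; this bound keeps the circle of radius `r` off it.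
  set V : Set E := W ∩ ⋂ i, {y | ‖a i y - a i x‖ < r * ‖a i v‖} with hVdef
  have hV : IsOpen V := hW.inter (isOpen_iInter_of_finite fun i =>
    isOpen_lt (by fun_prop) continuous_const)
  have hxV : x ∈ V := ⟨hxW, by
    simp only [Set.mem_iInter, Set.mem_ofPred_eq, sub_self, norm_zero]
    exact fun i => mul_pos hr (norm_pos_iff.2 (hv i))⟩
  have hcirc : ∀ z ∈ V, ∀ ζ ∈ sphere (0 : ℂ) |r|, z + ζ • v ∈ hyperplaneCompl a := by
    intro z hz ζ hζ i m him
    rw [abs_of_pos hr] at hζ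
    have h1 : a i x = m := hUx (hWU z hz.1 ζ (sphere_subset_closedBall hζ)) i m him
    have h2 : ‖a i z - a i x‖ < r * ‖a i v‖ := Set.mem_iInter.1 hz.2 i
    have h3 : a i z - a i x = -(ζ * a i v) := by
      rw [map_add, map_smul, smul_eq_mul] at him
      rw [h1]; linear_combination him
    rw [h3, norm_neg, norm_mul, mem_sphere_zero_iff_norm.1 hζ] at h2
    exact lt_irrefl _ h2
  set A : E → F := fun z => circleAverage (fun ζ => (1 : ℂ) • ψ (z + ζ • v)) 0 r with hA
  have hAd : DifferentiableOn ℂ A V := differentiableOn_circleAverage_translate hDo hV (v := v)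
    (r := r) (c := fun _ => 1) continuousOn_const hψ hcirc
  refine ⟨V, hV, hxV, A, hAd, ?_⟩
  -- The point where the line through `z` in the direction `v` meets the hyperplane of `a i` through
  -- `x`.
  set proj : κ → E → E := fun i z => z - ((a i z - a i x) / a i v) • v with hproj
  set O : Set E := ⋂ i, {z | (∃ m : ℤ, a i x = m) →
    ExtendsAt (hyperplaneCompl a) ψ (proj i z)} with hO
  have hOd : Dense O := by
    have : CompleteSpace E := FiniteDimensional.complete ℂ E
    refine dense_iInter_of_isOpen (fun i => ?_) fun i => ?_
    · by_cases hi : ∃ m : ℤ, a i x = m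
      · simp only [hi, forall_const]
        exact (isOpen_setOf_extendsAt _ ψ).preimage (by fun_prop)
      · simp [hi]
    · by_cases hi : ∃ m : ℤ, a i x = m
      · simp only [hi, forall_const]
        obtain ⟨m, hm⟩ := hi
        intro z
        rw [_root_.mem_closure_iff_nhds]
        intro N hN
        have hpm : a i (proj i z) = m := by
          simp [hproj, hv i, hm]
        have hc : Tendsto (fun p => z + (p - proj i z)) (𝓝 (proj i z)) (𝓝 z) := by
          have : Continuous fun p => z + (p - proj i z) := by fun_prop
          simpa using this.tendsto (proj i z)
        obtain ⟨p, hpN, hpm', hp⟩ := exists_extendsAt_mem ha hmero hrem hpm (hc hN)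
        refine ⟨z + (p - proj i z), hpN, ?_⟩
        have : proj i (z + (p - proj i z)) = p := by
          have h1 : a i (z + (p - proj i z)) = a i z := by simp [hpm, hpm']
          simp only [hproj] at h1 ⊢
          rw [h1]; abel
        rwa [Set.mem_ofPred_eq, this]
      · simp [hi]
  have hOeq : ∀ z ∈ (V ∩ hyperplaneCompl a) ∩ O, A z = ψ z := by
    rintro z ⟨⟨hzV, hzD⟩, hzO⟩
    have hext : ∀ ζ ∈ closedBall (0 : ℂ) r, ExtendsAt (hyperplaneCompl a) ψ (z + ζ • v) := by
      intro ζ hζ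
      by_cases hD : z + ζ • v ∈ hyperplaneCompl a
      · exact ⟨_, hDo, hD, ψ, hψ, fun _ _ => rfl⟩
      · simp only [hyperplaneCompl, Set.mem_ofPred_eq, not_forall, not_not] at hD
        obtain ⟨i, m, him⟩ := hD
        have h1 : a i x = m := hUx (hWU z hzV.1 ζ hζ) i m him
        have h2 := Set.mem_iInter.1 hzO i ⟨m, h1⟩
        have h3 : proj i z = z + ζ • v := by
          have h4 : (a i z - a i x) / a i v = -ζ := by
            rw [div_eq_iff (hv i)]
            rw [map_add, map_smul, smul_eq_mul] at him
            rw [h1]; linear_combination him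
          simp only [hproj, h4]; simp
        rwa [h3] at h2
    have hd : DifferentiableOn ℂ (fun ζ : ℂ => extendFrom (hyperplaneCompl a) ψ (z + ζ • v))
        (closedBall 0 r) := fun ζ hζ =>
      (hasDerivAt_translate (differentiableAt_extendFrom hDd
        (hext ζ hζ))).differentiableAt.differentiableWithinAt
    have h1 := circleAverage_of_differentiableOn_closedBall hr hd
    simp only [zero_smul, add_zero] at h1
    rw [extendFrom_extends hψ.continuousOn z hzD] at h1
    rw [← h1]
    refine circleAverage_congr_sphere fun ζ hζ => ?_
    simp only [one_smul]
    exact (extendFrom_extends hψ.continuousOn _ (hcirc z hzV ζ hζ)).symm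
  intro z hz
  have hVD : IsOpen (V ∩ hyperplaneCompl a) := hV.inter hDo
  have hcl : z ∈ closure ((V ∩ hyperplaneCompl a) ∩ O) :=
    hOd.open_subset_closure_inter hVD hz
  have hne : (𝓝[(V ∩ hyperplaneCompl a) ∩ O] z).NeBot := mem_closure_iff_nhdsWithin_neBot.1 hcl
  have hA' : Tendsto A (𝓝[(V ∩ hyperplaneCompl a) ∩ O] z) (𝓝 (A z)) :=
    (hAd.differentiableAt (hV.mem_nhds hz.1)).continuousAt.mono_left nhdsWithin_le_nhds
  have hψ' : Tendsto ψ (𝓝[(V ∩ hyperplaneCompl a) ∩ O] z) (𝓝 (ψ z)) :=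
    (hψ.differentiableAt (hDo.mem_nhds hz.2)).continuousAt.mono_left nhdsWithin_le_nhds
  refine tendsto_nhds_unique hA' (hψ'.congr' ?_)
  filter_upwards [self_mem_nhdsWithin] with y hy
  exact (hOeq y hy).symm

/-- A meromorphic function, holomorphic off the hyperplanes, without leading coefficients of
order at most zero along the hyperplanes extends to an entire function, which vanishes on the
hyperplanes. -/
theorem exists_differentiable_eqOn (ha : ∀ i, a i ≠ 0) {ψ : E → F}
    (hψ : DifferentiableOn ℂ ψ (hyperplaneCompl a))
    (hmero : IsMeromorphicOff (hyperplaneCompl a) ψ) (hrem : HasNoLeadingCoeff a ψ) :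
    ∃ Ψ : E → F, Differentiable ℂ Ψ ∧ Set.EqOn Ψ ψ (hyperplaneCompl a) ∧
      ∀ (i : κ) (m : ℤ) (y : E), a i y = m → Ψ y = 0 := by
  have hd : Differentiable ℂ (extendFrom (hyperplaneCompl a) ψ) := fun x =>
    differentiableAt_extendFrom (dense_hyperplaneCompl ha)
      (extendsAt_of_hasNoLeadingCoeff ha hψ hmero hrem x)
  have heq : Set.EqOn (extendFrom (hyperplaneCompl a) ψ) ψ (hyperplaneCompl a) := fun z hz =>
    extendFrom_extends hψ.continuousOn z hz
  refine ⟨_, hd, heq, fun i m y hy => ?_⟩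
  refine eq_zero_of_forall_isGenericPoint (a := a) hd.continuous (fun y hy hyg => ?_) hy
  exact hrem i m y hy hyg 0 Set.univ _ isOpen_univ (Set.mem_univ y) hd.differentiableOn
    fun z hz => by simpa using heq hz.2

end Extension

/-! ### Second derivatives of a power of a linear form times a holomorphic function. -/

section LeadingTerm

variable {E F : Type*} [NormedAddCommGroup E] [NormedSpace ℂ E] [FiniteDimensional ℂ E]
  [NormedAddCommGroup F] [NormedSpace ℂ F] [CompleteSpace F]

/-- The factor with exponent `2 - k` clears all negative powers, so the right side is continuous
across `a = m`, where only its last term survives. The integer exponent covers both poles and zeros.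
-/
theorem iteratedDeriv_two_zpow_smul {V : Set E} (hV : IsOpen V) {Φ u : E → F}
    (hΦ : DifferentiableOn ℂ Φ V) {a : E →L[ℂ] ℂ} {m : ℂ} {k : ℤ}
    (hu : ∀ z ∈ V, a z ≠ m → u z = (a z - m) ^ k • Φ z) (w : E) {z : E} (hz : z ∈ V)
    (hzm : a z ≠ m) :
    (a z - m) ^ (2 - k) • iteratedDeriv 2 (fun s : ℂ => u (z + s • w)) 0 =
      (a z - m) ^ 2 • fderiv ℂ (fun x => fderiv ℂ Φ x w) z w +
        (2 * k * a w * (a z - m)) • fderiv ℂ Φ z w + (k * (k - 1) * a w ^ 2) • Φ z := by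
  set t : ℂ := a z - m with ht
  have ht0 : t ≠ 0 := sub_ne_zero.2 hzm
  set c : ℂ := a w with hc
  have hS : ∀ᶠ s : ℂ in 𝓝 0, z + s • w ∈ V ∧ t + s * c ≠ 0 := by
    refine Filter.Eventually.and ?_ ?_
    · exact (hV.preimage (by fun_prop : Continuous fun s : ℂ => z + s • w)).mem_nhds (by simpa)
    · exact (isOpen_ne_fun (by fun_prop : Continuous fun s : ℂ => t + s * c)
        continuous_const).mem_nhds (by simpa)
  have hval : ∀ s : ℂ, a (z + s • w) - m = t + s * c := fun s => by
    simp only [map_add, map_smul, smul_eq_mul, ht]; ring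
  have hfu : (fun s : ℂ => u (z + s • w)) =ᶠ[𝓝 0]
      fun s => (t + s * c) ^ k • Φ (z + s • w) := by
    filter_upwards [hS] with s hs
    rw [hu _ hs.1 (sub_ne_zero.1 (by rw [hval]; exact hs.2)), hval]
  have hlin : ∀ s : ℂ, HasDerivAt (fun s : ℂ => t + s * c) c s := fun s => by
    simpa using ((hasDerivAt_id s).mul_const c).const_add t
  have hpow : ∀ (j : ℤ) (s : ℂ), t + s * c ≠ 0 →
      HasDerivAt (fun s : ℂ => (t + s * c) ^ j) (j * (t + s * c) ^ (j - 1) * c) s :=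
    fun j s hs => HasDerivAt.comp (h₂ := fun x : ℂ => x ^ j) s
      (hasDerivAt_zpow j (t + s * c) (Or.inl hs)) (hlin s)
  have hΦ' := differentiableOn_fderiv_apply hV hΦ w
  have hd1 : deriv (fun s : ℂ => u (z + s • w)) =ᶠ[𝓝 0] fun s =>
      (t + s * c) ^ k • fderiv ℂ Φ (z + s • w) w +
        (k * (t + s * c) ^ (k - 1) * c) • Φ (z + s • w) := by
    refine hfu.deriv.trans ?_
    filter_upwards [hS] with s hs
    exact ((hpow k s hs.2).smul
      (hasDerivAt_translate (hΦ.differentiableAt (hV.mem_nhds hs.1)))).deriv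
  have h0 : t + 0 * c ≠ 0 := by simpa
  have hzV : z + (0 : ℂ) • w ∈ V := by simpa
  have hd2 := ((hpow k 0 h0).smul
      (hasDerivAt_translate (hΦ'.differentiableAt (hV.mem_nhds hzV)))).add
    ((((hpow (k - 1) 0 h0).const_mul (k : ℂ)).mul_const c).smul
      (hasDerivAt_translate (hΦ.differentiableAt (hV.mem_nhds hzV))))
  have h2 : iteratedDeriv 2 (fun s : ℂ => u (z + s • w)) 0 =
      deriv (deriv (fun s : ℂ => u (z + s • w))) 0 := by
    rw [iteratedDeriv_succ, iteratedDeriv_one]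
  rw [h2, hd1.deriv_eq]
  refine (congrArg (t ^ (2 - k) • ·) hd2.deriv).trans ?_
  simp only [zero_mul, add_zero, zero_smul, smul_add, smul_smul]
  have e0 : t ^ (2 - k) * t ^ k = t ^ 2 := by
    rw [← zpow_add₀ ht0]; simp
  have e1 : t ^ (2 - k) * t ^ (k - 1) = t := by
    rw [← zpow_add₀ ht0]; ring_nf; simp
  have e2 : t ^ (2 - k) * t ^ (k - 1 - 1) = 1 := by
    rw [← zpow_add₀ ht0]; ring_nf; simp
  have c1 : t ^ (2 - k) * (↑k * t ^ (k - 1) * c) = k * c * t := by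
    linear_combination (k * c : ℂ) * e1
  have c2 : t ^ (2 - k) * (↑k * (((k - 1 : ℤ) : ℂ) * t ^ (k - 1 - 1) * c) * c) =
      k * (k - 1) * c ^ 2 := by
    push_cast
    linear_combination (k * (k - 1) * c ^ 2 : ℂ) * e2
  rw [e0, c1, c2]
  module

/-- The leading term of a second derivative of `(a - m) ^ k • Φ` along `a = m`. -/
theorem tendsto_zpow_smul_iteratedDeriv_two {V : Set E} (hV : IsOpen V) {Φ u : E → F}
    (hΦ : DifferentiableOn ℂ Φ V) {a : E →L[ℂ] ℂ} {m : ℂ} {k : ℤ}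
    (hu : ∀ z ∈ V, a z ≠ m → u z = (a z - m) ^ k • Φ z) (w : E) {y : E} (hy : y ∈ V)
    (hym : a y = m) :
    Tendsto (fun z => (a z - m) ^ (2 - k) • iteratedDeriv 2 (fun s : ℂ => u (z + s • w)) 0)
      (𝓝[{z | a z ≠ m}] y) (𝓝 ((k * (k - 1) * a w ^ 2 : ℂ) • Φ y)) := by
  have hΦ' := differentiableOn_fderiv_apply hV hΦ w
  have hΦ'' := differentiableOn_fderiv_apply hV hΦ' w
  have c0 := (hΦ.differentiableAt (hV.mem_nhds hy)).continuousAt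
  have c1 := (hΦ'.differentiableAt (hV.mem_nhds hy)).continuousAt
  have c2 := (hΦ''.differentiableAt (hV.mem_nhds hy)).continuousAt
  have ht : ContinuousAt (fun z => a z - m) y := by fun_prop
  have h : ContinuousAt (fun z => (a z - m) ^ 2 • fderiv ℂ (fun x => fderiv ℂ Φ x w) z w +
      (2 * k * a w * (a z - m)) • fderiv ℂ Φ z w + (k * (k - 1) * a w ^ 2 : ℂ) • Φ z) y :=
    (((ht.pow 2).smul c2).add (((continuousAt_const (y := 2 * k * a w)).mul ht).smul c1)).add
      ((continuousAt_const (y := (k * (k - 1) * a w ^ 2 : ℂ))).smul c0)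
  have h1 := h.tendsto.mono_left (nhdsWithin_le_nhds (s := {z | a z ≠ m}))
  simp only [hym, sub_self, mul_zero, zero_smul, ne_eq, OfNat.ofNat_ne_zero, not_false_eq_true,
    zero_pow, zero_add] at h1
  refine h1.congr' ?_
  filter_upwards [self_mem_nhdsWithin, mem_nhdsWithin_of_mem_nhds (hV.mem_nhds hy)] with z hz hzV
  exact (iteratedDeriv_two_zpow_smul hV hΦ hu w hzV hz).symm

end LeadingTerm

/-! ### Iterated differences of analytic functions. -/

section FiniteDifference

open Finset

/-- The `i`-th iterated difference of an analytic function with step `t` is `O(t ^ i)`. -/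
theorem isBigO_sum_choose_mul (f : ℂ → ℂ) {x : ℂ} (hf : AnalyticAt ℂ f x) (i : ℕ) (b c : ℂ) :
    (fun s : ℂ => ∑ j ∈ range (i + 1), (-1) ^ j * (i.choose j : ℂ) * f (x + s * (b + j * c)))
      =O[𝓝 0] fun s => s ^ i := by
  obtain ⟨p, hp⟩ := hf
  -- The remainder after the Taylor polynomial of degree less than `i`; the `i`-th difference
  -- annihilates that polynomial.
  set R : ℂ → ℂ := fun u => f (x + u) - p.partialSum i u with hR
  have hRO : R =O[𝓝 0] fun u => u ^ i := by
    refine (hp.isBigO_sub_partialSum_pow i).trans (isBigO_of_le _ fun u => ?_)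
    simp
  have hterm : ∀ j : ℕ, (fun s : ℂ => R (s * (b + j * c))) =O[𝓝 0] fun s => s ^ i := by
    intro j
    have ht : Tendsto (fun s : ℂ => s * (b + j * c)) (𝓝 0) (𝓝 0) := by
      have : Continuous fun s : ℂ => s * (b + j * c) := by fun_prop
      simpa using this.tendsto 0
    refine (hRO.comp_tendsto ht).trans ?_
    simp only [Function.comp_def, mul_pow, mul_comm _ ((b + j * c) ^ i)]
    exact isBigO_const_mul_self _ _ _
  have hpoly : ∀ s : ℂ, ∑ j ∈ range (i + 1),
      (-1) ^ j * (i.choose j : ℂ) * p.partialSum i (s * (b + j * c)) = 0 := by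
    intro s
    simp only [FormalMultilinearSeries.partialSum, FormalMultilinearSeries.apply_eq_pow_smul_coeff,
      smul_eq_mul, mul_sum]
    rw [sum_comm]
    refine sum_eq_zero fun n hn => ?_
    -- The monomial of degree `n` contributes `s ^ n` times an `i`-th difference of `(b + c X) ^ n`,
    -- which has degree less than `i`.
    set P : Polynomial ℂ := (Polynomial.C b + Polynomial.X * Polynomial.C c) ^ n with hP
    have hdeg : P.natDegree < i := by
      refine lt_of_le_of_lt ?_ (mem_range.1 hn)
      have h1 : (Polynomial.C b + Polynomial.X * Polynomial.C c).natDegree ≤ 1 := by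
        compute_degree
      exact (Polynomial.natDegree_pow_le).trans (by nlinarith)
    have h0 := congrFun (Polynomial.fwdDiff_iter_eq_zero_of_degree_lt hdeg) 0
    rw [fwdDiff_iter_eq_sum_shift] at h0
    have h1 : ∀ j ∈ range (i + 1),
        (-1) ^ j * (i.choose j : ℂ) * ((s * (b + j * c)) ^ n * p.coeff n) =
        (-1) ^ i * s ^ n * p.coeff n *
          (((-1 : ℤ) ^ (i - j) * (i.choose j : ℤ)) • P.eval (0 + j • (1 : ℂ))) := by
      intro j hj
      have hji : j ≤ i := Nat.lt_succ_iff.1 (mem_range.1 hj)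
      have hsgn : (-1 : ℂ) ^ i * (-1) ^ (i - j) = (-1) ^ j := by
        obtain ⟨d, rfl⟩ := Nat.exists_eq_add_of_le hji
        rw [Nat.add_sub_cancel_left, pow_add, mul_assoc, ← mul_pow]
        simp
      simp only [hP, zsmul_eq_mul, Int.cast_mul, Int.cast_pow, Int.cast_neg, Int.cast_one,
        Int.cast_natCast, nsmul_eq_mul, mul_one, zero_add, Polynomial.eval_pow,
        Polynomial.eval_add, Polynomial.eval_mul, Polynomial.eval_C, Polynomial.eval_X, mul_pow]
      rw [← hsgn]; ring
    rw [sum_congr rfl h1, ← mul_sum, h0]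
    simp
  have heq : (fun s : ℂ => ∑ j ∈ range (i + 1),
      (-1) ^ j * (i.choose j : ℂ) * f (x + s * (b + j * c))) =
      fun s => ∑ j ∈ range (i + 1), (-1) ^ j * (i.choose j : ℂ) * R (s * (b + j * c)) := by
    funext s
    simp only [hR, mul_sub, sum_sub_distrib]
    rw [hpoly, sub_zero]
  rw [heq]
  exact IsBigO.fun_sum fun j _ => (hterm j).const_mul_left _

end FiniteDifference

/-! ### Exponentials of nilpotent endomorphisms. -/

section NilpotentExponential

open Finset

variable {V : Type*} [AddCommGroup V] [Module ℂ V]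

theorem nilExp_eq_sum {a : Module.End ℂ V} {k : ℕ} (h : a ^ k = 0) :
    nilExp a = ∑ i ∈ range k, ((i.factorial : ℂ)⁻¹) • a ^ i := by
  have hle : nilpotencyClass a ≤ k := csInf_le' h
  rw [nilExp, ← sum_range_add_sum_Ico _ hle, left_eq_add]
  refine sum_eq_zero fun i hi => ?_
  rw [pow_eq_zero_of_le (mem_Ico.1 hi).1 (pow_nilpotencyClass ⟨k, h⟩), smul_zero]

theorem nilExp_apply_eq_sum {a : Module.End ℂ V} (ha : IsNilpotent a) {x : V} {k : ℕ}
    (h : (a ^ k) x = 0) : nilExp a x = ∑ i ∈ range k, ((i.factorial : ℂ)⁻¹) • (a ^ i) x := by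
  obtain ⟨n, hn⟩ := ha
  have hnk : a ^ (n + k) = 0 := by rw [pow_add, hn, zero_mul]
  rw [nilExp_eq_sum hnk, add_comm n k, sum_range_add]
  simp only [LinearMap.add_apply, LinearMap.sum_apply, LinearMap.smul_apply, add_eq_left]
  refine sum_eq_zero fun i _ => ?_
  rw [add_comm k i, pow_add, Module.End.mul_apply, h, map_zero, smul_zero]

theorem nilExp_mul_nilExp_neg {a : Module.End ℂ V} (ha : IsNilpotent a) :
    nilExp a * nilExp (-a) = 1 := by
  let _ : Module ℚ (Module.End ℂ V) := Module.compHom _ (algebraMap ℚ ℂ)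
  have h : ∀ b : Module.End ℂ V, nilExp b = IsNilpotent.exp b := by
    intro b
    rw [nilExp, IsNilpotent.exp]
    refine sum_congr rfl fun i _ => ?_
    change _ = (algebraMap ℚ ℂ (i.factorial : ℚ)⁻¹) • b ^ i
    simp
  rw [h, h, IsNilpotent.exp_mul_exp_neg_self ha]

theorem nilExp_neg_mul_nilExp {a : Module.End ℂ V} (ha : IsNilpotent a) :
    nilExp (-a) * nilExp a = 1 := by
  simpa using nilExp_mul_nilExp_neg ha.neg

theorem commute_nilExp (a : Module.End ℂ V) : Commute a (nilExp a) := by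
  rw [nilExp]
  exact Commute.sum_right _ _ _ fun i _ => (Commute.pow_right rfl i).smul_right _

/-- The exponential of a nilpotent endomorphism as a unit. -/
def nilExpUnit {a : Module.End ℂ V} (ha : IsNilpotent a) : (Module.End ℂ V)ˣ :=
  ⟨nilExp a, nilExp (-a), nilExp_mul_nilExp_neg ha, nilExp_neg_mul_nilExp ha⟩

@[simp]
theorem val_nilExpUnit {a : Module.End ℂ V} (ha : IsNilpotent a) :
    (nilExpUnit ha : Module.End ℂ V) = nilExp a := rfl

theorem pow_succ_mul_eq_of_sl2 {e f h : Module.End ℂ V} (hef : e * f = f * e + h)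
    (hhe : h * e = e * h + 2 • e) (n : ℕ) :
    e ^ (n + 1) * f = f * e ^ (n + 1) + ((n + 1 : ℕ) : ℂ) • (h * e ^ n) -
      (((n + 1) * n : ℕ) : ℂ) • e ^ n := by
  have heh : e * h = h * e - 2 • e := by rw [hhe]; abel
  induction n with
  | zero => simp [hef]
  | succ n ih =>
    rw [pow_succ' e (n + 1), mul_assoc, ih]
    simp only [mul_add, mul_sub, mul_smul_comm, ← mul_assoc, hef, heh, add_mul, sub_mul,
      smul_mul_assoc]
    simp only [mul_assoc, ← pow_succ']
    push_cast
    module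

/-- This is `exp (ad e) f`: the series stops after the quadratic term, since `[e, f] = h` and `[e,
h] = -2e`. -/
theorem nilExp_mul_eq_of_sl2 {e f h : Module.End ℂ V} (hef : e * f = f * e + h)
    (hhe : h * e = e * h + 2 • e) (he : IsNilpotent e) :
    nilExp e * f = (f + h - e) * nilExp e := by
  obtain ⟨n, hn⟩ := he
  have h1 : e ^ (n + 1) = 0 := by rw [pow_succ, hn, zero_mul]
  have h2 : e ^ (n + 2) = 0 := by rw [pow_succ, h1, zero_mul]
  have h3 : e ^ (n + 3) = 0 := by rw [pow_succ, h2, zero_mul]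
  have key : nilExp e * f = f * nilExp e + h * nilExp e - e * nilExp e := by
    nth_rw 1 [nilExp_eq_sum h3]
    nth_rw 1 [nilExp_eq_sum h3]
    nth_rw 1 [nilExp_eq_sum h2]
    nth_rw 1 [nilExp_eq_sum h1]
    rw [sum_mul, mul_sum, mul_sum, mul_sum]
    rw [sum_range_succ' _ (n + 2), sum_range_succ' _ (n + 2)]
    -- The sum is shifted by one index to match powers of `e`; the factor `(i + 1) * i` makes the
    -- new term at `i = 0` vanish.
    have hs : ∑ i ∈ range (n + 1), e * (((i.factorial : ℂ)⁻¹) • e ^ i) =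
        ∑ i ∈ range (n + 2), (((i + 1).factorial : ℂ)⁻¹ * (((i + 1) * i : ℕ) : ℂ)) • e ^ i := by
      rw [sum_range_succ' _ (n + 1)]
      simp only [mul_zero, Nat.cast_zero, zero_smul, add_zero]
      refine sum_congr rfl fun i _ => ?_
      rw [mul_smul_comm, ← pow_succ']
      congr 1
      have h1 : ((i + 1 + 1 : ℕ) : ℂ) ≠ 0 := by exact_mod_cast Nat.succ_ne_zero (i + 1)
      have h2 : ((i + 1 : ℕ) : ℂ) ≠ 0 := by exact_mod_cast Nat.succ_ne_zero i
      have h3 : ((i.factorial : ℕ) : ℂ) ≠ 0 := by exact_mod_cast Nat.factorial_ne_zero i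
      rw [Nat.factorial_succ (i + 1), Nat.factorial_succ i]
      push_cast at h1 h2 ⊢
      field_simp
    rw [hs, add_sub_assoc, add_comm (∑ i ∈ range (n + 2), f * _), add_assoc,
      ← add_sub_assoc, ← sum_add_distrib, ← sum_sub_distrib, add_comm]
    congr 1
    · simp
    refine sum_congr rfl fun i _ => ?_
    rw [smul_mul_assoc, pow_succ_mul_eq_of_sl2 hef hhe, smul_sub, smul_add, smul_smul, smul_smul,
      mul_smul_comm, mul_smul_comm]
    congr 3
    have h2 : ((i + 1 : ℕ) : ℂ) ≠ 0 := by exact_mod_cast Nat.succ_ne_zero i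
    have h3 : ((i.factorial : ℕ) : ℂ) ≠ 0 := by exact_mod_cast Nat.factorial_ne_zero i
    rw [Nat.factorial_succ i]
    push_cast at h2 ⊢
    field_simp
  rw [key]; noncomm_ring

end NilpotentExponential

/-! ### Zero weight vectors of `sl₂`-modules and the action of the Weyl element. -/

section Sl2

open Finset LieModule

variable {L U : Type*} [LieRing L] [LieAlgebra ℂ L] [AddCommGroup U] [Module ℂ U]
  [LieRingModule L U] [LieModule ℂ L U] {h e f : L}

theorem toEnd_mul_eq_of_sl2 (t : IsSl2Triple h e f) :
    toEnd ℂ L U e * toEnd ℂ L U f = toEnd ℂ L U f * toEnd ℂ L U e + toEnd ℂ L U h := by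
  ext u
  have := lie_lie e f u
  rw [t.lie_e_f] at this
  simp [this]

theorem toEnd_h_mul_eq_of_sl2 (t : IsSl2Triple h e f) :
    toEnd ℂ L U h * toEnd ℂ L U e = toEnd ℂ L U e * toEnd ℂ L U h + 2 • toEnd ℂ L U e := by
  ext u
  have := lie_lie h e u
  rw [t.lie_h_e_nsmul, nsmul_lie] at this
  simp [this]

/-- Since `h` acts on `e^l u` by `2l`, the constant is `(l+1)·2l - (l+1)·l`. It is the source of
`l(l+1)` in the comparison of leading terms. -/
theorem toEnd_pow_lie_lie_of_sl2 (t : IsSl2Triple h e f) {u : U} (hu : ⁅h, u⁆ = 0) (l : ℕ) :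
    (toEnd ℂ L U e ^ l) ⁅e, ⁅f, u⁆⁆ =
      ⁅f, (toEnd ℂ L U e ^ (l + 1)) u⁆ + ((l : ℂ) * (l + 1)) • (toEnd ℂ L U e ^ l) u := by
  have h1 := LinearMap.congr_fun (pow_succ_mul_eq_of_sl2 (toEnd_mul_eq_of_sl2 (U := U) t)
    (toEnd_h_mul_eq_of_sl2 t) l) u
  have h2 := t.lie_h_pow_toEnd_e (R := ℂ) (μ := 0) (m := u) (by simpa using hu) l
  have h3 : (toEnd ℂ L U e ^ l) ⁅e, ⁅f, u⁆⁆ =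
      (toEnd ℂ L U e ^ (l + 1) * toEnd ℂ L U f) u := by
    simp [pow_succ]
  rw [h3, h1]
  simp only [LinearMap.sub_apply, LinearMap.add_apply, LinearMap.smul_apply, Module.End.mul_apply,
    toEnd_apply_apply, h2]
  push_cast
  module

theorem lie_f_toEnd_pow_of_sl2 (t : IsSl2Triple h e f) {u : U} (hu : ⁅h, u⁆ = 0) {c : ℂ}
    (hc : ⁅e, ⁅f, u⁆⁆ = c • u) (l : ℕ) :
    ⁅f, (toEnd ℂ L U e ^ (l + 1)) u⁆ = (c - l * (l + 1)) • (toEnd ℂ L U e ^ l) u := by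
  have := toEnd_pow_lie_lie_of_sl2 t hu l
  rw [hc, map_smul] at this
  rw [sub_smul, this, add_sub_cancel_right]

/-- Otherwise `e^(k+1) u`, which `f` annihilates, would be a lowest weight vector of positive weight
`2(k+1)`, impossible in finite dimension. -/
theorem toEnd_pow_eq_zero_of_sl2 [FiniteDimensional ℂ U] (t : IsSl2Triple h e f) {u : U}
    (hu : ⁅h, u⁆ = 0) {k : ℕ} (hk : ⁅e, ⁅f, u⁆⁆ = ((k : ℂ) * (k + 1)) • u) :
    (toEnd ℂ L U e ^ (k + 1)) u = 0 := by
  by_contra hne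
  have P : t.symm.HasPrimitiveVectorWith ((toEnd ℂ L U e ^ (k + 1)) u) (-(2 * (k + 1)) : ℂ) :=
    { ne_zero := hne
      lie_h := by
        rw [neg_lie, t.lie_h_pow_toEnd_e (R := ℂ) (μ := 0) (by simpa using hu) (k + 1)]
        push_cast
        module
      lie_e := by rw [lie_f_toEnd_pow_of_sl2 t hu hk, sub_self, zero_smul] }
  obtain ⟨n, hn⟩ := P.exists_nat
  have h1 : ((n + 2 * (k + 1) : ℕ) : ℂ) = 0 := by
    push_cast
    rw [← hn]; ring
  have h2 : n + 2 * (k + 1) = 0 := by exact_mod_cast h1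
  omega

/-- The highest weight vector is `e^k u`. Applying `f` to `e^(l+1) u` returns `e^l u` times `k(k+1)
- l(l+1)`, which is nonzero for `l < k`; so one can climb from `u` to the top and descend again. -/
theorem exists_hasPrimitiveVectorWith_of_zero_weight [FiniteDimensional ℂ U]
    (t : IsSl2Triple h e f) {u : U} (hu0 : u ≠ 0) (hu : ⁅h, u⁆ = 0) {k : ℕ}
    (hk : ⁅e, ⁅f, u⁆⁆ = ((k : ℂ) * (k + 1)) • u) :
    ∃ (w : U) (c : ℂ), t.HasPrimitiveVectorWith w ((2 * k : ℕ) : ℂ) ∧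
      u = c • (toEnd ℂ L U f ^ k) w := by
  have hcoef : ∀ l : ℕ, l < k → ((k : ℂ) * (k + 1) - l * (l + 1)) ≠ 0 := by
    intro l hl h0
    have h1 : ((k * (k + 1) : ℕ) : ℂ) = ((l * (l + 1) : ℕ) : ℂ) := by
      push_cast
      linear_combination h0
    have h2 : k * (k + 1) = l * (l + 1) := by exact_mod_cast h1
    nlinarith
  have hf := lie_f_toEnd_pow_of_sl2 t hu hk
  have hne : ∀ l ≤ k, (toEnd ℂ L U e ^ l) u ≠ 0 := by
    intro l
    induction l with
    | zero => simpa using hu0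
    | succ l ih =>
      intro hl h0
      have h1 := hf l
      rw [h0, lie_zero, eq_comm, smul_eq_zero] at h1
      exact h1.elim (hcoef l hl) (ih (by omega))
  have hdesc : ∀ j ≤ k, ∃ c : ℂ, c ≠ 0 ∧
      (toEnd ℂ L U f ^ j) ((toEnd ℂ L U e ^ k) u) = c • (toEnd ℂ L U e ^ (k - j)) u := by
    intro j
    induction j with
    | zero => exact fun _ => ⟨1, one_ne_zero, by simp⟩
    | succ j ih =>
      intro hj
      obtain ⟨c, hc, hcj⟩ := ih (by omega)
      have h1 := hf (k - (j + 1))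
      rw [show k - (j + 1) + 1 = k - j by omega] at h1
      refine ⟨_, mul_ne_zero hc (hcoef (k - (j + 1)) (by omega)), ?_⟩
      rw [pow_succ', Module.End.mul_apply, hcj, map_smul, toEnd_apply_apply, h1, smul_smul]
  obtain ⟨c, hc, hck⟩ := hdesc k le_rfl
  refine ⟨(toEnd ℂ L U e ^ k) u, c⁻¹, ⟨hne k le_rfl, ?_, ?_⟩, ?_⟩
  · rw [t.lie_h_pow_toEnd_e (R := ℂ) (μ := 0) (by simpa using hu) k]
    push_cast
    rw [zero_add]
  · have := toEnd_pow_eq_zero_of_sl2 t hu hk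
    rwa [pow_succ', Module.End.mul_apply, toEnd_apply_apply] at this
  · rw [hck, smul_smul, inv_mul_cancel₀ hc]
    simp

theorem toEnd_e_pow_toEnd_f_pow {t : IsSl2Triple h e f} {w : U} {n : ℕ}
    (P : t.HasPrimitiveVectorWith w (n : ℂ)) (i : ℕ) : ∀ p : ℕ, i + p = n →
    (toEnd ℂ L U e ^ i) ((toEnd ℂ L U f ^ n) w) =
      (i.factorial * n.factorial / p.factorial : ℂ) • (toEnd ℂ L U f ^ p) w := by
  induction i with
  | zero =>
    rintro p rfl
    have : ((0 + p).factorial : ℂ) ≠ 0 := by exact_mod_cast Nat.factorial_ne_zero (0 + p)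
    simp only [zero_add] at this ⊢
    simp [this]
  | succ i ih =>
    intro p hp
    rw [pow_succ', Module.End.mul_apply, ih (p + 1) (by omega), map_smul, toEnd_apply_apply,
      P.lie_e_pow_succ_toEnd_f, smul_smul]
    congr 1
    have h1 : (n : ℂ) - p = i + 1 := by
      have : ((i + 1 + p : ℕ) : ℂ) = n := by rw [hp]
      push_cast at this
      linear_combination -this
    have h2 : ((p + 1 : ℕ) : ℂ) ≠ 0 := by exact_mod_cast Nat.succ_ne_zero p
    have h3 : ((p.factorial : ℕ) : ℂ) ≠ 0 := by exact_mod_cast Nat.factorial_ne_zero p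
    rw [h1, Nat.factorial_succ, Nat.factorial_succ]
    push_cast at h2 ⊢
    field_simp

theorem toEnd_neg_pow_apply (x : L) (i : ℕ) (u : U) :
    ((-toEnd ℂ L U x) ^ i) u = (-1 : ℂ) ^ i • (toEnd ℂ L U x ^ i) u := by
  rw [← neg_one_smul ℂ (toEnd ℂ L U x), smul_pow, LinearMap.smul_apply]

/-- The two exponential sums agree term by term after reversal, the signs matching because `2k` is
even. The identity evaluates the Weyl element on a highest weight vector. -/
theorem nilExp_neg_e_eq_nilExp_neg_f [FiniteDimensional ℂ U] {t : IsSl2Triple h e f} {w : U}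
    {k : ℕ} (P : t.HasPrimitiveVectorWith w ((2 * k : ℕ) : ℂ))
    (he : IsNilpotent (toEnd ℂ L U e)) (hf : IsNilpotent (toEnd ℂ L U f)) :
    nilExp (-toEnd ℂ L U e) ((((2 * k).factorial : ℂ)⁻¹) • (toEnd ℂ L U f ^ (2 * k)) w) =
      nilExp (-toEnd ℂ L U f) w := by
  have hE := toEnd_e_pow_toEnd_f_pow P
  have h0 : (toEnd ℂ L U e ^ (2 * k + 1)) ((toEnd ℂ L U f ^ (2 * k)) w) = 0 := by
    rw [pow_succ', Module.End.mul_apply, hE (2 * k) 0 (by omega), map_smul]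
    simp [P.lie_e]
  have h1 : (toEnd ℂ L U f ^ (2 * k + 1)) w = 0 := P.pow_toEnd_f_eq_zero_of_eq_nat rfl
  rw [map_smul, nilExp_apply_eq_sum he.neg (k := 2 * k + 1) (by rw [toEnd_neg_pow_apply, h0,
    smul_zero]), nilExp_apply_eq_sum hf.neg (k := 2 * k + 1) (by rw [toEnd_neg_pow_apply, h1,
    smul_zero]), ← sum_range_reflect, smul_sum]
  refine sum_congr rfl fun i hi => ?_
  have hi' : i ≤ 2 * k := Nat.lt_succ_iff.1 (mem_range.1 hi)
  obtain ⟨p, hp⟩ := Nat.exists_eq_add_of_le hi'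
  have hsub : 2 * k + 1 - 1 - i = p := by omega
  rw [hsub, toEnd_neg_pow_apply, toEnd_neg_pow_apply, hE p i (by omega)]
  simp only [smul_smul]
  congr 1
  have hs : (-1 : ℂ) ^ p = (-1) ^ i := by
    have : (-1 : ℂ) ^ (i + p) = 1 := by rw [← hp]; simp
    rw [pow_add] at this
    rcases neg_one_pow_eq_or ℂ i with h | h <;> rw [h] at this ⊢
    · linear_combination this
    · linear_combination -this
  have f1 : ((p.factorial : ℕ) : ℂ) ≠ 0 := by exact_mod_cast Nat.factorial_ne_zero p
  have f2 : ((i.factorial : ℕ) : ℂ) ≠ 0 := by exact_mod_cast Nat.factorial_ne_zero i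
  have f3 : (((2 * k).factorial : ℕ) : ℂ) ≠ 0 := by exact_mod_cast Nat.factorial_ne_zero (2 * k)
  rw [hs]
  field_simp

/-- The action on `U` of the standard representative of the nontrivial Weyl group element of an
`sl₂`-triple. -/
def sl2Weyl (U : Type*) [AddCommGroup U] [Module ℂ U] [LieRingModule L U] [LieModule ℂ L U]
    (e f : L) : Module.End ℂ U :=
  nilExp (toEnd ℂ L U e) * (nilExp (-toEnd ℂ L U f) * nilExp (toEnd ℂ L U e))

/-- Conjugation by `exp e` sends `f` to `f + h - e`, conjugation by `exp (-f)` sends this to `-e`,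
and the last `exp e` commutes with `e`. -/
theorem sl2Weyl_mul_f (t : IsSl2Triple h e f)
    (he : IsNilpotent (toEnd ℂ L U e)) (hf : IsNilpotent (toEnd ℂ L U f)) :
    sl2Weyl U e f * toEnd ℂ L U f = -(toEnd ℂ L U e) * sl2Weyl U e f := by
  set E := toEnd ℂ L U e with hE
  set F := toEnd ℂ L U f with hF
  set X := toEnd ℂ L U h with hX
  have h1 : nilExp E * F = (F + X - E) * nilExp E :=
    nilExp_mul_eq_of_sl2 (toEnd_mul_eq_of_sl2 t) (toEnd_h_mul_eq_of_sl2 t) he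
  have h2 : nilExp F * E = (E + -X - F) * nilExp F := by
    have := nilExp_mul_eq_of_sl2 (toEnd_mul_eq_of_sl2 (U := U) t.symm)
      (toEnd_h_mul_eq_of_sl2 t.symm) hf
    simpa using this
  have h3 : nilExp (-F) * (F + X - E) = -E * nilExp (-F) := by
    have h4 : nilExp (-F) * (nilExp F * E) * nilExp (-F) =
        nilExp (-F) * ((E + -X - F) * nilExp F) * nilExp (-F) := by rw [h2]
    rw [← mul_assoc, nilExp_neg_mul_nilExp hf, one_mul, mul_assoc, mul_assoc,
      nilExp_mul_nilExp_neg hf, mul_one] at h4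
    rw [neg_mul, h4]; noncomm_ring
  have h5 : nilExp E * -E = -E * nilExp E := by
    rw [mul_neg, neg_mul, (commute_nilExp E).eq]
  calc sl2Weyl U e f * F = nilExp E * (nilExp (-F) * (nilExp E * F)) := by
        simp only [sl2Weyl, mul_assoc, ← hE, ← hF]
    _ = nilExp E * ((nilExp (-F) * (F + X - E)) * nilExp E) := by rw [h1, mul_assoc]
    _ = (nilExp E * -E) * (nilExp (-F) * nilExp E) := by rw [h3]; simp only [mul_assoc]
    _ = -E * sl2Weyl U e f := by rw [h5]; simp only [sl2Weyl, mul_assoc, ← hE, ← hF]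

theorem sl2Weyl_mul_f_pow (t : IsSl2Triple h e f)
    (he : IsNilpotent (toEnd ℂ L U e)) (hf : IsNilpotent (toEnd ℂ L U f)) (k : ℕ) :
    sl2Weyl U e f * toEnd ℂ L U f ^ k = (-(toEnd ℂ L U e)) ^ k * sl2Weyl U e f := by
  induction k with
  | zero => simp
  | succ k ih => rw [pow_succ, ← mul_assoc, ih, mul_assoc, sl2Weyl_mul_f t he hf, pow_succ,
      mul_assoc]

/-- The Weyl group element of an `sl₂`-triple acts by `(-1) ^ k` on the zero weight space of the
isotypical component of highest weight `2 * k`. -/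
theorem sl2Weyl_apply_zero_weight [FiniteDimensional ℂ U] (t : IsSl2Triple h e f)
    (he : IsNilpotent (toEnd ℂ L U e)) (hf : IsNilpotent (toEnd ℂ L U f)) {u : U}
    (hu : ⁅h, u⁆ = 0) {k : ℕ} (hk : ⁅e, ⁅f, u⁆⁆ = ((k : ℂ) * (k + 1)) • u) :
    sl2Weyl U e f u = (-1 : ℂ) ^ k • u := by
  by_cases hu0 : u = 0
  · simp [hu0]
  obtain ⟨w, c, P, rfl⟩ := exists_hasPrimitiveVectorWith_of_zero_weight t hu0 hu hk
  have hw : sl2Weyl U e f w = (((2 * k).factorial : ℂ)⁻¹) • (toEnd ℂ L U f ^ (2 * k)) w := by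
    have h1 : nilExp (toEnd ℂ L U e) w = w := by
      rw [nilExp_apply_eq_sum he (k := 1) (by simpa using P.lie_e)]
      simp
    rw [sl2Weyl, Module.End.mul_apply, Module.End.mul_apply, h1,
      ← nilExp_neg_e_eq_nilExp_neg_f P he hf, ← Module.End.mul_apply, nilExp_mul_nilExp_neg he,
      Module.End.one_apply]
  -- The zero weight vector is a multiple of `f^k w`. The Weyl element turns it into `(-e)^k`
  -- applied to the lowest weight vector, which leads back to `f^k w` with the sign `(-1)^k`.
  have h2 := LinearMap.congr_fun (sl2Weyl_mul_f_pow (U := U) t he hf k) w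
  rw [Module.End.mul_apply, Module.End.mul_apply, hw, toEnd_neg_pow_apply, map_smul,
    toEnd_e_pow_toEnd_f_pow P k k (by omega), smul_smul] at h2
  rw [map_smul, h2]
  simp only [smul_smul]
  congr 1
  have f1 : ((k.factorial : ℕ) : ℂ) ≠ 0 := by exact_mod_cast Nat.factorial_ne_zero k
  have f3 : (((2 * k).factorial : ℕ) : ℂ) ≠ 0 := by exact_mod_cast Nat.factorial_ne_zero (2 * k)
  field_simp

end Sl2

/-! ### Normalized root vectors and their `sl₂`-triples. -/

section RootVectors

open LieModule LieAlgebra LieAlgebra.IsKilling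

variable {𝔤 : Type*} [LieRing 𝔤] [LieAlgebra ℂ 𝔤] [FiniteDimensional ℂ 𝔤] [IsKilling ℂ 𝔤]
  {B : LinearMap.BilinForm ℂ 𝔤} {H : LieSubalgebra ℂ 𝔤} [H.IsCartanSubalgebra]
  {ι : Type*} [Fintype ι] [DecidableEq ι] {b : Module.Basis ι ℂ H}

theorem neg_mem_root {α : Weight ℂ H 𝔤} (hα : α ∈ H.root) : -α ∈ H.root := by
  simpa using hα

theorem isNonZero_of_mem_root {α : Weight ℂ H 𝔤} (hα : α ∈ H.root) : α.IsNonZero := by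
  simpa using hα

/-- The square length `(α, α)` of a root, computed in an orthonormal basis of the Cartan
subalgebra. -/
def rootLength (b : Module.Basis ι ℂ H) (α : Weight ℂ H 𝔤) : ℂ := ∑ ν, α (b ν) ^ 2

variable (hBinv : B.lieInvariant 𝔤)
  (hb : ∀ i j, B (b i : 𝔤) (b j : 𝔤) = if i = j then 1 else 0)

include hBinv in
theorem form_lie_rootVector {α : Weight ℂ H 𝔤} {e f : 𝔤}
    (hf : f ∈ rootSpace H (-α)) (hef : B e f = 1) (y : H) : B ⁅e, f⁆ y = α y := by
  have h1 : ⁅(y : 𝔤), f⁆ = -(α y) • f := by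
    have := lie_eq_smul_of_mem_rootSpace (H := H) hf y
    simpa using this
  rw [← lie_skew, map_neg, LinearMap.neg_apply, hBinv, neg_neg, ← lie_skew, h1, map_neg, map_smul,
    hef]
  simp

include hBinv hb in
-- The bracket lies in the Cartan subalgebra, and by invariance its pairing with `b ν` under `B` is
-- `α (b ν)`; orthonormality makes these pairings its coordinates.
theorem lie_rootVector_eq_sum {α : Weight ℂ H 𝔤} {e f : 𝔤} (he : e ∈ rootSpace H α)
    (hf : f ∈ rootSpace H (-α)) (hef : B e f = 1) :
    ⁅e, f⁆ = ((∑ ν, α (b ν) • b ν : H) : 𝔤) := by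
  obtain ⟨x, hx⟩ : ∃ x : H, ⁅e, f⁆ = x :=
    ⟨killingForm ℂ 𝔤 e f • (cartanEquivDual H).symm α, by
      rw [lie_eq_killingForm_smul_of_mem_rootSpace_of_mem_rootSpace_neg (H := H) he hf]; simp⟩
  have hrepr : ∀ ν, b.repr x ν = α (b ν) := by
    intro ν
    have h1 : (x : 𝔤) = ∑ i, b.repr x i • (b i : 𝔤) := by
      have := congrArg H.toSubmodule.subtype (b.sum_repr x)
      rw [map_sum] at this
      exact this.symm
    rw [← form_lie_rootVector hBinv hf hef (b ν), hx, h1, map_sum, LinearMap.sum_apply]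
    simp [hb]
  rw [hx]
  conv_lhs => rw [← b.sum_repr x]
  simp only [hrepr]

include hBinv hb in
-- A sum of complex squares could vanish, so `α([e, f])` is compared with its expression through the
-- Killing form. Neither factor there is zero: a vanishing Killing product of `e` and `f` would give
-- `[e, f] = 0` and hence `α = 0`.
theorem rootLength_ne_zero {α : Weight ℂ H 𝔤} (hα : α.IsNonZero) {e f : 𝔤}
    (he : e ∈ rootSpace H α) (hf : f ∈ rootSpace H (-α)) (hef : B e f = 1) :
    rootLength b α ≠ 0 := by
  have h1 := lie_eq_killingForm_smul_of_mem_rootSpace_of_mem_rootSpace_neg (H := H) he hf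
  have h2 := lie_rootVector_eq_sum hBinv hb he hf hef
  have h3 : (∑ ν, α (b ν) • b ν : H) = killingForm ℂ 𝔤 e f • (cartanEquivDual H).symm α := by
    apply Subtype.ext
    rw [← h2, h1]; simp
  have h4 : rootLength b α = killingForm ℂ 𝔤 e f * α ((cartanEquivDual H).symm α) := by
    have := congrArg (Weight.toLinear ℂ H 𝔤 α) h3
    simpa [rootLength, sq] using this
  rw [h4]
  refine mul_ne_zero (fun h0 => hα ?_) (root_apply_cartanEquivDual_symm_ne_zero hα)
  funext y
  rw [← form_lie_rootVector hBinv hf hef y, h1, h0]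
  simp

include hBinv hb in
-- The root `α` takes the value `rootLength b α` on `[e, f]`; the factor `2 / rootLength b α`
-- rescales this to `2`.
theorem isSl2Triple_rootVector {α : Weight ℂ H 𝔤} (hα : α.IsNonZero) {e f : 𝔤}
    (he : e ∈ rootSpace H α) (hf : f ∈ rootSpace H (-α)) (hef : B e f = 1) :
    IsSl2Triple (coroot α : 𝔤) e ((2 / rootLength b α) • f) := by
  have hκ := rootLength_ne_zero hBinv hb hα he hf hef
  have h2 := lie_rootVector_eq_sum hBinv hb he hf hef
  set x : H := ∑ ν, α (b ν) • b ν with hx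
  have hαx : α x = rootLength b α := by
    have : Weight.toLinear ℂ H 𝔤 α x = rootLength b α := by
      rw [hx, map_sum]
      simp [rootLength, sq]
    exact this
  have hxe : ⁅(x : 𝔤), e⁆ = rootLength b α • e := by
    rw [← hαx]; exact lie_eq_smul_of_mem_rootSpace he x
  have hxf : ⁅(x : 𝔤), f⁆ = -(rootLength b α) • f := by
    rw [← hαx]; exact lie_eq_smul_of_mem_rootSpace hf x
  have t : IsSl2Triple ((2 / rootLength b α) • (x : 𝔤)) e ((2 / rootLength b α) • f) := by
    refine ⟨?_, ?_, ?_, ?_⟩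
    · refine smul_ne_zero (div_ne_zero two_ne_zero hκ) fun h0 => hκ ?_
      have h0' : x = 0 := by simpa using h0
      rw [← hαx, h0']
      exact map_zero (Weight.toLinear ℂ H 𝔤 α)
    · rw [lie_smul, h2]
    · rw [smul_lie, hxe, smul_smul, div_mul_cancel₀ _ hκ, ofNat_smul_eq_nsmul]
    · rw [smul_lie, lie_smul, hxf, ← ofNat_smul_eq_nsmul ℂ 2, smul_smul, smul_smul, smul_smul,
        ← neg_smul]
      congr 1
      field_simp
  rw [← t.h_eq_coroot hα he (Submodule.smul_mem _ _ hf)]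
  exact t

end RootVectors

/-! ### Root reflections lifted to the group. -/

section WeylLift

open LieModule LieAlgebra LieAlgebra.IsKilling

variable {𝔤 : Type*} [LieRing 𝔤] [LieAlgebra ℂ 𝔤] [FiniteDimensional ℂ 𝔤] [IsKilling ℂ 𝔤]
  {H : LieSubalgebra ℂ 𝔤} [H.IsCartanSubalgebra]
  {U : Type*} [AddCommGroup U] [Module ℂ U] [FiniteDimensional ℂ U] [LieRingModule 𝔤 U]
  [LieModule ℂ 𝔤 U]

/-- The reflection of the Cartan subalgebra in a root. -/
def rootReflection {α : Weight ℂ H 𝔤} (hα : α.IsNonZero) : H ≃ₗ[ℂ] H :=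
  Module.reflection (f := Weight.toLinear ℂ H 𝔤 α) (x := coroot α) (root_apply_coroot hα)

theorem rootReflection_apply {α : Weight ℂ H 𝔤} (hα : α.IsNonZero) (x : H) :
    rootReflection hα x = x - α x • coroot α :=
  Module.reflection_apply _ _

theorem rootReflection_symm {α : Weight ℂ H 𝔤} (hα : α.IsNonZero) :
    (rootReflection hα).symm = rootReflection hα := Module.reflection_symm _

theorem det_rootReflection {α : Weight ℂ H 𝔤} (hα : α.IsNonZero) :
    LinearMap.det (rootReflection hα : H →ₗ[ℂ] H) = -1 := by
  have h1 : (rootReflection hα : H →ₗ[ℂ] H) =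
      LinearMap.transvection (Weight.toLinear ℂ H 𝔤 α) (-coroot α) := by
    ext x
    simp [rootReflection_apply, LinearMap.transvection.apply, sub_eq_add_neg]
  rw [h1, LinearMap.transvection.det, map_neg]
  have : Weight.toLinear ℂ H 𝔤 α (coroot α) = 2 := root_apply_coroot hα
  rw [this]; norm_num

theorem isNilpotent_toEnd_of_isNonZero {α : Weight ℂ H 𝔤} (hα : α.IsNonZero) {x : 𝔤}
    (hx : x ∈ rootSpace H α) : IsNilpotent (toEnd ℂ 𝔤 U x) :=
  isNilpotent_toEnd_of_mem_rootSpace U H hα hx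

theorem sl2Weyl_ad_apply {α : Weight ℂ H 𝔤} (hα : α.IsNonZero) {e f : 𝔤}
    (t : IsSl2Triple (coroot α : 𝔤) e f)
    (he : e ∈ rootSpace H α) (hf : f ∈ rootSpace H (-α)) (x : H) :
    sl2Weyl 𝔤 e f (x : 𝔤) = (rootReflection hα x : H) := by
  have hne : IsNilpotent (toEnd ℂ 𝔤 𝔤 e) := isNilpotent_toEnd_of_isNonZero hα he
  have hnf : IsNilpotent (-toEnd ℂ 𝔤 𝔤 f) :=
    (isNilpotent_toEnd_of_isNonZero (U := 𝔤) hα.neg hf).neg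
  have hex : ∀ x : H, ⁅e, (x : 𝔤)⁆ = -(α x) • e := fun x => by
    rw [← lie_skew, neg_smul]
    exact congrArg (-·) (lie_eq_smul_of_mem_rootSpace he x)
  have hfx : ∀ x : H, ⁅f, (x : 𝔤)⁆ = α x • f := fun x => by
    have := lie_eq_smul_of_mem_rootSpace hf x
    rw [← lie_skew]
    change -⁅x, f⁆ = _
    rw [this]; simp
  have hEx : ∀ x : H, nilExp (toEnd ℂ 𝔤 𝔤 e) (x : 𝔤) = (x : 𝔤) - α x • e := fun x => by
    rw [nilExp_apply_eq_sum hne (k := 2)]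
    · simp [Finset.sum_range_succ, hex, sub_eq_add_neg]
    · simp [sq, hex]
  have hEe : nilExp (toEnd ℂ 𝔤 𝔤 e) e = e := by
    rw [nilExp_apply_eq_sum hne (k := 1)] <;> simp
  have hFx : ∀ x : H, nilExp (-toEnd ℂ 𝔤 𝔤 f) (x : 𝔤) = (x : 𝔤) - α x • f := fun x => by
    rw [nilExp_apply_eq_sum hnf (k := 2)]
    · simp [Finset.sum_range_succ, hfx, sub_eq_add_neg]
    · simp [sq, hfx]
  have hfe : ⁅f, e⁆ = -(coroot α : 𝔤) := by rw [← lie_skew, t.lie_e_f]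
  have hfh : ⁅f, (coroot α : 𝔤)⁆ = 2 • f := by rw [← lie_skew, t.lie_h_f_nsmul, neg_neg]
  have hFe : nilExp (-toEnd ℂ 𝔤 𝔤 f) e = e + coroot α - f := by
    rw [nilExp_apply_eq_sum hnf (k := 3)]
    · simp only [Finset.sum_range_succ, Finset.range_zero, Finset.sum_empty, pow_zero, pow_one, sq,
        Module.End.mul_apply, LinearMap.neg_apply, toEnd_apply_apply, hfe, hfh, neg_neg,
        Module.End.one_apply]
      simp only [Nat.factorial]
      rw [← ofNat_smul_eq_nsmul ℂ 2]
      push_cast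
      module
    · simp [pow_succ, hfe, hfh]
  rw [sl2Weyl, Module.End.mul_apply, Module.End.mul_apply, hEx, map_sub, map_smul, hFx, hFe,
    rootReflection_apply]
  -- The `f` terms cancel. Because `α` changes sign under the reflection, the final `exp e` removes
  -- the remaining `e` term.
  have h1 : (x : 𝔤) - α x • f - α x • (e + coroot α - f) =
      (((x - α x • coroot α : H)) : 𝔤) - α x • e := by
    push_cast
    module
  have h2 : α (x - α x • coroot α) = -α x := by
    have : Weight.toLinear ℂ H 𝔤 α (x - α x • coroot α) = -α x := by
      rw [map_sub, map_smul]
      have : Weight.toLinear ℂ H 𝔤 α (coroot α) = 2 := root_apply_coroot hα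
      rw [this, smul_eq_mul, Weight.toLinear_apply]; ring
    exact this
  rw [h1, map_sub, hEx, map_smul, hEe, h2]
  module

/-- The three exponentials come from the root vectors `e`, `-f`, `e`, so the same word in the
generators acts on both `𝔤` and `U`. This makes antiinvariance applicable to `sl2Weyl`. -/
theorem exists_isWeylLift_rootReflection {α : Weight ℂ H 𝔤} (hα : α ∈ H.root) {e f : 𝔤}
    (t : IsSl2Triple (coroot α : 𝔤) e f)
    (he : e ∈ rootSpace H α) (hf : f ∈ rootSpace H (-α)) :
    ∃ n : (Module.End ℂ U)ˣ, (n : Module.End ℂ U) = sl2Weyl U e f ∧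
      IsWeylLift H U (rootReflection (isNonZero_of_mem_root hα)) n := by
  have hα' := isNonZero_of_mem_root hα
  have hne := isNilpotent_toEnd_of_isNonZero (U := U) hα' he
  have hnf := (isNilpotent_toEnd_of_isNonZero (U := U) hα'.neg hf).neg
  have hae := isNilpotent_toEnd_of_isNonZero (U := 𝔤) hα' he
  have haf := (isNilpotent_toEnd_of_isNonZero (U := 𝔤) hα'.neg hf).neg
  have hgE : (nilExpUnit hae, nilExpUnit hne) ∈ groupImage H U :=
    Subgroup.subset_closure ⟨α, hα, e, he, rfl, rfl⟩
  have hgF : (nilExpUnit haf, nilExpUnit hnf) ∈ groupImage H U := by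
    refine Subgroup.subset_closure ⟨-α, neg_mem_root hα, -f, Submodule.neg_mem _ hf, ?_, ?_⟩
    · simp only [val_nilExpUnit, map_neg]; rfl
    · simp only [val_nilExpUnit, map_neg]
  refine ⟨nilExpUnit hne * (nilExpUnit hnf * nilExpUnit hne), rfl,
    nilExpUnit hae * (nilExpUnit haf * nilExpUnit hae), mul_mem hgE (mul_mem hgF hgE), fun x => ?_⟩
  exact sl2Weyl_ad_apply hα' t he hf x

end WeylLift

/-! ### Stability of the regular set, and coweights. -/

section CoweightLattice

open LieModule LieAlgebra LieAlgebra.IsKilling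

variable {𝔤 : Type*} [LieRing 𝔤] [LieAlgebra ℂ 𝔤] [FiniteDimensional ℂ 𝔤] [IsKilling ℂ 𝔤]
  {H : LieSubalgebra ℂ 𝔤} [H.IsCartanSubalgebra]

theorem apply_rootReflection {α : Weight ℂ H 𝔤} (hα : α.IsNonZero) (β : Weight ℂ H 𝔤) (x : H) :
    β (rootReflection hα x) = reflectRoot α β x := by
  have h : Weight.toLinear ℂ H 𝔤 β (x - α x • coroot α) = β x - α x * β (coroot α) := by
    rw [map_sub, map_smul]; rfl
  rw [rootReflection_apply]
  refine (show β _ = _ from h).trans ?_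
  change _ = β x - β (coroot α) * α x
  ring

theorem rootReflection_mem_regularSet {α : Weight ℂ H 𝔤} (hα : α.IsNonZero) {x : H}
    (hx : x ∈ regularSet H) : rootReflection hα x ∈ regularSet H := by
  intro β hβ m
  rw [apply_rootReflection]
  exact hx _ (by simpa using reflectRoot_isNonZero α β (isNonZero_of_mem_root hβ)) m

theorem add_mem_regularSet {x p : H} (hx : x ∈ regularSet H) (hp : p ∈ coweightLattice H) :
    x + p ∈ regularSet H := by
  intro β hβ m h
  obtain ⟨n, hn⟩ := hp β hβ
  refine hx β hβ (m - n) ?_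
  have h1 : β (x + p) = β x + β p := map_add (Weight.toLinear ℂ H 𝔤 β) x p
  push_cast
  rw [← h, h1, hn]; ring

/-- Every root takes the value `1` on the coweight lattice. -/
theorem exists_coweight_apply_eq_one {α : Weight ℂ H 𝔤} (hα : α ∈ H.root) :
    ∃ p ∈ coweightLattice H, α p = 1 := by
  obtain ⟨base⟩ := (rootSystem H).nonempty_base
  have key : ∀ i : H.root, ∃ p ∈ coweightLattice H, (i : Weight ℂ H 𝔤) p = 1 := by
    intro i
    have hrefl : ∀ i j : H.root, (∃ p ∈ coweightLattice H, (i : Weight ℂ H 𝔤) p = 1) →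
        ∃ p ∈ coweightLattice H, ((rootSystem H).reflectionPerm j i : Weight ℂ H 𝔤) p = 1 := by
      rintro i ⟨j, hj⟩ ⟨p, hp, hip⟩
      have hj' := isNonZero_of_mem_root hj
      have hrp : ∀ x : H, ((rootSystem H).reflectionPerm ⟨j, hj⟩ i : Weight ℂ H 𝔤) x =
          (i : Weight ℂ H 𝔤) (rootReflection hj' x) := by
        intro x
        change (rootSystem H).root ((rootSystem H).reflectionPerm ⟨j, hj⟩ i) x = _
        rw [RootPairing.root_reflectionPerm, RootPairing.reflection_apply, apply_rootReflection]
        rfl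
      refine ⟨rootReflection hj' p, fun β hβ => ?_, ?_⟩
      · rw [apply_rootReflection]
        exact hp _ (by simpa using reflectRoot_isNonZero j β (isNonZero_of_mem_root hβ))
      · rw [hrp]
        have : rootReflection hj' (rootReflection hj' p) = p := by
          nth_rw 1 [← rootReflection_symm]
          simp
        rw [this, hip]
    -- Every root is obtained from a simple one by reflections, and these preserve the coweight
    -- lattice.
    refine base.induction_reflect i (fun i h => hrefl i i h) ?_ fun i j h _ => hrefl i j h
    intro i hi
    classical
    -- The fundamental coweight dual to the simple root `i`; it is integral on all roots, as they
    -- are integral combinations of simple ones.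
    set p : H := (Module.evalEquiv ℂ H).symm (base.toWeightBasis.coord ⟨i, hi⟩) with hp
    have happ : ∀ φ : Module.Dual ℂ H, φ p = base.toWeightBasis.repr φ ⟨i, hi⟩ := fun φ => by
      rw [hp, Module.apply_evalEquiv_symm_apply, Module.Basis.coord_apply]
    have hroot : ∀ j : base.support, base.toWeightBasis.repr ((rootSystem H).root j) ⟨i, hi⟩ =
        if j = ⟨i, hi⟩ then 1 else 0 := fun j => by
      rw [RootPairing.Base.toWeightBasis_repr_root, Finsupp.single_apply]
    refine ⟨p, fun β hβ => ?_, ?_⟩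
    · obtain ⟨f, -, -, hf⟩ := base.exists_root_eq_sum_int ⟨β, hβ⟩
      refine ⟨f i, ?_⟩
      change (rootSystem H).root ⟨β, hβ⟩ p = _
      rw [hf, happ, map_sum, Finsupp.finsetSum_apply, ← Finset.sum_coe_sort]
      simp only [map_zsmul, Finsupp.smul_apply, hroot]
      simp
    · change (rootSystem H).root i p = _
      rw [happ]
      exact (hroot ⟨i, hi⟩).trans (if_pos rfl)
  exact key ⟨α, hα⟩

end CoweightLattice

/-! ### Zeros, period and double pole of the trigonometric potential. -/

section Potential

theorem sin_sq_pi_mul_add_intCast (w : ℂ) (m : ℤ) :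
    Complex.sin (Real.pi * (w + m)) ^ 2 = Complex.sin (Real.pi * w) ^ 2 := by
  have h : (Real.pi : ℂ) * (w + m) = Real.pi * w + m * Real.pi := by ring
  rw [h, Complex.sin_add, Complex.sin_int_mul_pi, mul_zero, add_zero, mul_pow, Complex.cos_sq',
    Complex.sin_int_mul_pi]
  ring

theorem sin_pi_mul_ne_zero {w : ℂ} (hw : ∀ m : ℤ, w ≠ m) : Complex.sin (Real.pi * w) ≠ 0 := by
  rw [Ne, Complex.sin_eq_zero_iff]
  rintro ⟨m, hm⟩
  refine hw m ?_
  have hπ : (Real.pi : ℂ) ≠ 0 := by exact_mod_cast Real.pi_ne_zero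
  exact mul_left_cancel₀ hπ (by rw [hm]; ring)

theorem tendsto_sq_mul_div_sin_sq :
    Tendsto (fun t : ℂ => t ^ 2 * ((Real.pi : ℂ) ^ 2 / Complex.sin (Real.pi * t) ^ 2)) (𝓝[≠] 0)
      (𝓝 1) := by
  have hπ : (Real.pi : ℂ) ≠ 0 := by exact_mod_cast Real.pi_ne_zero
  have h1 : HasDerivAt (fun t : ℂ => Complex.sin (Real.pi * t)) Real.pi 0 := by
    simpa using ((hasDerivAt_id (0 : ℂ)).const_mul (Real.pi : ℂ)).csin
  have h2 := (((hasDerivAt_iff_tendsto_slope.1 h1).inv₀ hπ).const_mul (Real.pi : ℂ)).pow 2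
  rw [mul_inv_cancel₀ hπ, one_pow] at h2
  refine h2.congr fun t => ?_
  simp only [slope_def_field, mul_zero, Complex.sin_zero, sub_zero, inv_div, div_pow, mul_pow]
  ring

end Potential

/-! ### The eigenvalue equation in coordinates. -/

section Coordinates

open LieModule LieAlgebra LieAlgebra.IsKilling

variable {𝔤 : Type*} [LieRing 𝔤] [LieAlgebra ℂ 𝔤] [FiniteDimensional ℂ 𝔤] [IsKilling ℂ 𝔤]
  {H : LieSubalgebra ℂ 𝔤} [H.IsCartanSubalgebra]
  {ι : Type*} [Fintype ι] [DecidableEq ι] (b : Module.Basis ι ℂ H)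

/-- A root as a functional of the coordinates with respect to a basis of the Cartan subalgebra. -/
def rootFunctional (α : Weight ℂ H 𝔤) : (ι → ℂ) →L[ℂ] ℂ :=
  LinearMap.toContinuousLinearMap
    (Weight.toLinear ℂ H 𝔤 α ∘ₗ (b.equivFun.symm : (ι → ℂ) →ₗ[ℂ] H))

theorem rootFunctional_apply (α : Weight ℂ H 𝔤) (z : ι → ℂ) :
    rootFunctional b α z = α (b.equivFun.symm z) := rfl

theorem rootFunctional_neg (α : Weight ℂ H 𝔤) (z : ι → ℂ) :
    rootFunctional b (-α) z = -rootFunctional b α z := rfl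

theorem rootFunctional_single (α : Weight ℂ H 𝔤) (ν : ι) :
    rootFunctional b α (Pi.single ν 1) = α (b ν) := by
  rw [rootFunctional_apply]
  congr 1
  simp [Module.Basis.equivFun_symm_apply, Pi.single_apply]

theorem rootFunctional_ne_zero {α : Weight ℂ H 𝔤} (hα : α.IsNonZero) :
    rootFunctional b α ≠ 0 := by
  intro h
  apply hα
  funext x
  have := DFunLike.congr_fun h (b.equivFun x)
  rwa [rootFunctional_apply, LinearEquiv.symm_apply_apply] at this

/-- The roots as a family of functionals of the coordinates. -/
def rootFamily : H.root → (ι → ℂ) →L[ℂ] ℂ := fun α => rootFunctional b α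

theorem rootFamily_ne_zero (α : H.root) : rootFamily b α ≠ 0 :=
  rootFunctional_ne_zero b (isNonZero_of_mem_root α.2)

theorem mem_hyperplaneCompl_rootFamily {z : ι → ℂ} :
    z ∈ hyperplaneCompl (rootFamily b) ↔ b.equivFun.symm z ∈ regularSet H :=
  ⟨fun h α hα m => h ⟨α, hα⟩ m, fun h α m => h α α.2 m⟩

theorem eq_or_eq_neg_of_isGenericPoint {α : H.root} {y : ι → ℂ}
    (hy : IsGenericPoint (rootFamily b) α y) {β : Weight ℂ H 𝔤} (hβ : β ∈ H.root) {m : ℤ}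
    (hm : rootFunctional b β y = m) : β = -(α : Weight ℂ H 𝔤) ∨ β = α := by
  obtain ⟨c, hc⟩ := hy ⟨β, hβ⟩ m hm
  refine eq_neg_or_eq_of_eq_smul _ _ (isNonZero_of_mem_root hβ) c ?_
  funext x
  have := DFunLike.congr_fun hc (b.equivFun x)
  simpa [rootFamily, rootFunctional_apply] using this

/-- At a generic point of `α = m` only `±α` take integer values. Their potentials have a double pole
with coefficient one, and all others are continuous there. -/
theorem tendsto_potential {α : H.root} {m : ℤ} {y : ι → ℂ}
    (hym : rootFunctional b (α : Weight ℂ H 𝔤) y = m)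
    (hy : IsGenericPoint (rootFamily b) α y) {β : Weight ℂ H 𝔤} (hβ : β ∈ H.root) [Decidable
      (β = -(α : Weight ℂ H 𝔤) ∨ β = α)] :
    Tendsto (fun z => (rootFunctional b (α : Weight ℂ H 𝔤) z - m) ^ 2 *
      ((Real.pi : ℂ) ^ 2 / Complex.sin (Real.pi * rootFunctional b β z) ^ 2))
      (𝓝[{z | rootFunctional b (α : Weight ℂ H 𝔤) z ≠ m}] y)
      (𝓝 (if β = -(α : Weight ℂ H 𝔤) ∨ β = α then 1 else 0)) := by
  have ht : Tendsto (fun z => rootFunctional b (α : Weight ℂ H 𝔤) z - m)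
      (𝓝[{z | rootFunctional b (α : Weight ℂ H 𝔤) z ≠ m}] y) (𝓝[≠] 0) := by
    refine tendsto_nhdsWithin_iff.2 ⟨?_, ?_⟩
    · have : Continuous fun z => rootFunctional b (α : Weight ℂ H 𝔤) z - m := by fun_prop
      simpa [hym] using (this.tendsto y).mono_left nhdsWithin_le_nhds
    · filter_upwards [self_mem_nhdsWithin] with z hz using sub_ne_zero.2 hz
  split_ifs with h
  · refine (tendsto_sq_mul_div_sin_sq.comp ht).congr fun z => ?_
    have hsin : Complex.sin (Real.pi * rootFunctional b β z) ^ 2 =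
        Complex.sin (Real.pi * (rootFunctional b (α : Weight ℂ H 𝔤) z - m)) ^ 2 := by
      rw [← sin_sq_pi_mul_add_intCast (rootFunctional b (α : Weight ℂ H 𝔤) z - m) m,
        sub_add_cancel]
      rcases h with rfl | rfl
      · rw [rootFunctional_neg, mul_neg, Complex.sin_neg, neg_sq]
      · rfl
    simp only [Function.comp_apply, hsin]
  · have hs : Complex.sin (Real.pi * rootFunctional b β y) ^ 2 ≠ 0 :=
      pow_ne_zero 2 (sin_pi_mul_ne_zero fun n hn =>
        h (eq_or_eq_neg_of_isGenericPoint b hy hβ hn))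
    have hc : ContinuousAt (fun z => (rootFunctional b (α : Weight ℂ H 𝔤) z - m) ^ 2 *
        ((Real.pi : ℂ) ^ 2 / Complex.sin (Real.pi * rootFunctional b β z) ^ 2)) y := by
      refine ContinuousAt.mul (by fun_prop) (ContinuousAt.div (by fun_prop) ?_ hs)
      exact (Complex.continuous_sin.comp (by fun_prop)).continuousAt.pow 2
    have := hc.tendsto.mono_left (nhdsWithin_le_nhds
      (s := {z | rootFunctional b (α : Weight ℂ H 𝔤) z ≠ m}))
    simpa [hym] using this

variable {U : Type*} [NormedAddCommGroup U] [NormedSpace ℂ U] [LieRingModule 𝔤 U]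

/-- The eigenvalue equation of the Schrödinger operator in coordinates. -/
def SolvesSchrodinger (e : Weight ℂ H 𝔤 → 𝔤) (ε : ℂ) (f : (ι → ℂ) → U) : Prop :=
  ∀ z ∈ hyperplaneCompl (rootFamily b),
    ∑ ν, iteratedDeriv 2 (fun t : ℂ => f (z + t • Pi.single ν 1)) 0 =
      ∑ β ∈ H.root, ((Real.pi : ℂ) ^ 2 / Complex.sin (Real.pi * rootFunctional b β z) ^ 2) •
        ⁅e β, ⁅e (-β), f z⁆⁆ - ε • f z

theorem solvesSchrodinger_of_schrodinger_eq [LieModule ℂ 𝔤 U] {e : Weight ℂ H 𝔤 → 𝔤} {ε : ℂ}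
    {ψ : H → U} (h : ∀ x ∈ regularSet H, schrodinger H b e ψ x = ε • ψ x) :
    SolvesSchrodinger b e ε fun z => ψ (b.equivFun.symm z) := by
  intro z hz
  have h1 := h _ ((mem_hyperplaneCompl_rootFamily b).1 hz)
  rw [schrodinger, neg_add_eq_iff_eq_add] at h1
  have h2 : laplacian b ψ (b.equivFun.symm z) = ∑ ν, iteratedDeriv 2
      (fun t : ℂ => ψ (b.equivFun.symm (z + t • Pi.single ν 1))) 0 := by
    rw [laplacian]
    refine Finset.sum_congr rfl fun ν _ => ?_
    have : ∀ t : ℂ, b.equivFun.symm (z + t • Pi.single ν 1) = b.equivFun.symm z + t • b ν := by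
      intro t
      rw [map_add, map_smul]
      congr 2
      simp [Module.Basis.equivFun_symm_apply, Pi.single_apply]
    simp only [this]
  rw [← h2]
  simp only [rootFunctional_apply]
  rw [h1]; abel

end Coordinates

/-! ### Vanishing of the leading coefficients along root hyperplanes. -/

section LeadingCoefficient

open LieModule LieAlgebra LieAlgebra.IsKilling

variable {𝔤 : Type*} [LieRing 𝔤] [LieAlgebra ℂ 𝔤] [FiniteDimensional ℂ 𝔤] [IsKilling ℂ 𝔤]
  {B : LinearMap.BilinForm ℂ 𝔤} {H : LieSubalgebra ℂ 𝔤} [H.IsCartanSubalgebra]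
  {ι : Type*} [Fintype ι] [DecidableEq ι] (b : Module.Basis ι ℂ H)
  {U : Type*} [NormedAddCommGroup U] [NormedSpace ℂ U] [FiniteDimensional ℂ U]
  [LieRingModule 𝔤 U] [LieModule ℂ 𝔤 U]

theorem continuous_lie_right (x : 𝔤) : Continuous fun u : U => ⁅x, u⁆ :=
  (toEnd ℂ 𝔤 U x).continuous_of_finiteDimensional

theorem hyperplaneCompl_subset_ne (α : H.root) (m : ℤ) :
    hyperplaneCompl (rootFamily b) ⊆ {z | rootFunctional b (α : Weight ℂ H 𝔤) z ≠ m} :=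
  fun _ hz => hz α m

theorem neBot_nhdsWithin_hyperplaneCompl (y : ι → ℂ) :
    (𝓝[hyperplaneCompl (rootFamily (𝔤 := 𝔤) b)] y).NeBot :=
  mem_closure_iff_nhdsWithin_neBot.1 (dense_hyperplaneCompl (rootFamily_ne_zero b) y)

theorem neg_ne_self_of_isNonZero {α : Weight ℂ H 𝔤} (hα : α.IsNonZero) : -α ≠ α := by
  intro h
  refine hα ?_
  funext x
  have h' : -α x = α x := DFunLike.congr_fun h x
  simpa [neg_eq_self] using h'

theorem sum_root_ite_smul {M : Type*} [AddCommGroup M] [Module ℂ M] {α : Weight ℂ H 𝔤}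
    (hα : α ∈ H.root) (p : Weight ℂ H 𝔤 → ℂ) (F : Weight ℂ H 𝔤 → M) [DecidableEq (Weight ℂ H 𝔤)] :
    ∑ β ∈ H.root, (if β = -α ∨ β = α then p β else 0) • F β = p α • F α + p (-α) • F (-α) := by
  simp only [ite_smul, zero_smul]
  rw [← Finset.sum_filter]
  have : Finset.filter (fun β => β = -α ∨ β = α) H.root = {α, -α} := by
    ext β
    rw [Finset.mem_filter, Finset.mem_insert, Finset.mem_singleton]
    constructor
    · rintro ⟨-, h⟩; exact h.symm
    · rintro (rfl | rfl)
      · exact ⟨hα, Or.inr rfl⟩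
      · exact ⟨neg_mem_root hα, Or.inl rfl⟩
  rw [this, Finset.sum_pair (neg_ne_self_of_isNonZero (isNonZero_of_mem_root hα)).symm]

/-- The most singular terms of the eigenvalue equation at a generic point of a root hyperplane. -/
theorem smul_leadingCoeff_eq_lie_lie_add {e : Weight ℂ H 𝔤 → 𝔤} {ε : ℂ} {f : (ι → ℂ) → U}
    (hf : SolvesSchrodinger b e ε f) {α : H.root} {m : ℤ} {y : ι → ℂ}
    (hym : rootFunctional b (α : Weight ℂ H 𝔤) y = m) (hy : IsGenericPoint (rootFamily b) α y)
    {k : ℤ} {V : Set (ι → ℂ)} (hV : IsOpen V) (hyV : y ∈ V) {Φ : (ι → ℂ) → U}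
    (hΦ : DifferentiableOn ℂ Φ V)
    (hΦf : ∀ z ∈ V, rootFunctional b (α : Weight ℂ H 𝔤) z ≠ m →
      f z = (rootFunctional b (α : Weight ℂ H 𝔤) z - m) ^ k • Φ z) :
    (k * (k - 1) * rootLength b (α : Weight ℂ H 𝔤)) • Φ y =
      ⁅e α, ⁅e (-α), Φ y⁆⁆ + ⁅e (-α), ⁅e α, Φ y⁆⁆ := by
  classical
  set a := rootFunctional b (α : Weight ℂ H 𝔤) with ha
  set D := hyperplaneCompl (rootFamily (𝔤 := 𝔤) b) with hD
  have := neBot_nhdsWithin_hyperplaneCompl (𝔤 := 𝔤) b y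
  have hle : 𝓝[D] y ≤ 𝓝[{z | a z ≠ m}] y :=
    nhdsWithin_mono _ (hyperplaneCompl_subset_ne b α m)
  have hΦc : Tendsto Φ (𝓝[D] y) (𝓝 (Φ y)) :=
    (hΦ.continuousOn.continuousAt (hV.mem_nhds hyV)).tendsto.mono_left nhdsWithin_le_nhds
  have h1 : Tendsto (fun z => ∑ ν, (a z - m) ^ (2 - k) •
      iteratedDeriv 2 (fun s : ℂ => f (z + s • Pi.single ν 1)) 0) (𝓝[D] y)
      (𝓝 ((k * (k - 1) * rootLength b (α : Weight ℂ H 𝔤)) • Φ y)) := by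
    rw [rootLength, Finset.mul_sum, Finset.sum_smul]
    refine tendsto_finsetSum _ fun ν _ => ?_
    have := (tendsto_zpow_smul_iteratedDeriv_two hV hΦ hΦf (Pi.single ν 1) hyV hym).mono_left hle
    rwa [ha, rootFunctional_single] at this
  -- The other side of the equation after the same rescaling: the nonsingular potentials and the
  -- eigenvalue term carry a factor tending to zero, which leaves only `±α`.
  have h2 : Tendsto (fun z => ∑ β ∈ H.root, ((a z - m) ^ 2 *
      ((Real.pi : ℂ) ^ 2 / Complex.sin (Real.pi * rootFunctional b β z) ^ 2)) •
        ⁅e β, ⁅e (-β), Φ z⁆⁆ - (ε * (a z - m) ^ 2) • Φ z) (𝓝[D] y)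
      (𝓝 (∑ β ∈ H.root, (if β = -(α : Weight ℂ H 𝔤) ∨ β = α then (1 : ℂ) else 0) •
        ⁅e β, ⁅e (-β), Φ y⁆⁆ - (ε * (a y - m) ^ 2) • Φ y)) := by
    refine Tendsto.sub (tendsto_finsetSum _ fun β hβ => ?_) (Tendsto.smul ?_ hΦc)
    · refine ((tendsto_potential b hym hy hβ).mono_left hle).smul ?_
      exact (((continuous_lie_right (e β)).comp (continuous_lie_right (e (-β)))).tendsto
        (Φ y)).comp hΦc
    · have : Continuous fun z => ε * (a z - m) ^ 2 := by fun_prop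
      exact (this.tendsto y).mono_left nhdsWithin_le_nhds
  have h3 : (fun z => ∑ ν, (a z - m) ^ (2 - k) •
      iteratedDeriv 2 (fun s : ℂ => f (z + s • Pi.single ν 1)) 0) =ᶠ[𝓝[D] y]
      fun z => ∑ β ∈ H.root, ((a z - m) ^ 2 *
        ((Real.pi : ℂ) ^ 2 / Complex.sin (Real.pi * rootFunctional b β z) ^ 2)) •
          ⁅e β, ⁅e (-β), Φ z⁆⁆ - (ε * (a z - m) ^ 2) • Φ z := by
    filter_upwards [self_mem_nhdsWithin, mem_nhdsWithin_of_mem_nhds (hV.mem_nhds hyV)] with z hz hzV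
    have hzm : a z ≠ m := hz α m
    have hz0 : a z - m ≠ 0 := sub_ne_zero.2 hzm
    have hzk : (a z - m) ^ (2 - k) * (a z - m) ^ k = (a z - m) ^ 2 := by
      rw [← zpow_add₀ hz0, sub_add_cancel]; rfl
    rw [← Finset.smul_sum, hf z hz, hΦf z hzV hzm, smul_sub, Finset.smul_sum]
    congr 1
    · refine Finset.sum_congr rfl fun β _ => ?_
      rw [lie_smul, lie_smul, smul_smul, smul_smul, ← hzk]
      congr 1; ring
    · rw [smul_smul, smul_smul, ← hzk]
      congr 1; ring
  have h4 := tendsto_nhds_unique (h1.congr' h3) h2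
  rw [h4, sum_root_ite_smul α.2 (fun _ => 1) fun β => ⁅e β, ⁅e (-β), Φ y⁆⁆, hym, neg_neg]
  simp

theorem mem_maxTrivSubmodule_of_eventually {f : (ι → ℂ) → U} {y : ι → ℂ} (hf : ContinuousAt f y)
    (h : ∀ᶠ z in 𝓝[hyperplaneCompl (rootFamily (𝔤 := 𝔤) b)] y, f z ∈ maxTrivSubmodule ℂ H U) :
    f y ∈ maxTrivSubmodule ℂ H U := by
  have := neBot_nhdsWithin_hyperplaneCompl (𝔤 := 𝔤) b y
  exact (Submodule.closed_of_finiteDimensional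
    (maxTrivSubmodule ℂ H U).toSubmodule).mem_of_tendsto
    (hf.tendsto.mono_left nhdsWithin_le_nhds) h

/-- The point is moved by `-p`, reflected, and moved back by `p`, so the two values of the character
cancel and only the determinant `-1` remains. -/
theorem apply_affine_reflection {ψ : H → U} (hψ : IsWeylAntiinvariant H ψ)
    {χ : AddChar (coweightLattice H) ℂ}
    (hper : ∀ p : coweightLattice H, ∀ x ∈ regularSet H, ψ (x + (p : H)) = χ p • ψ x)
    {α : Weight ℂ H 𝔤} (hα : α.IsNonZero) {n : (Module.End ℂ U)ˣ}
    (hn : IsWeylLift H U (rootReflection hα) n) (p : coweightLattice H) {x : H}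
    (hx : x ∈ regularSet H) :
    (n : Module.End ℂ U) (ψ (rootReflection hα (x - p) + p)) = -ψ x := by
  have hxp : x - p ∈ regularSet H := by
    rw [sub_eq_add_neg]; exact add_mem_regularSet hx (neg_mem p.2)
  have h1 := hψ _ n hn _ hxp
  rw [rootReflection_symm, det_rootReflection, neg_one_smul] at h1
  rw [hper p _ (rootReflection_mem_regularSet hα hxp), map_smul, h1, smul_neg, ← hper p _ hxp,
    sub_add_cancel]

/-- Two computations of the reflection on `Φ y` conflict unless `Φ y = 0`: the `sl₂`-module
structure gives `(-1)^k`, whereas antiinvariance gives `-(-1)^k`, the factor `(-1)^k` coming from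
the sign change of `α - m`. -/
theorem hasNoLeadingCoeff_rootFamily (hBinv : B.lieInvariant 𝔤)
    (hb : ∀ i j, B (b i : 𝔤) (b j : 𝔤) = if i = j then 1 else 0)
    {e : Weight ℂ H 𝔤 → 𝔤} (he : ∀ α ∈ H.root, e α ∈ rootSpace H α)
    (he_norm : ∀ α ∈ H.root, B (e α) (e (-α)) = 1) {ψ : H → U}
    (hzero : ∀ x ∈ regularSet H, ψ x ∈ maxTrivSubmodule ℂ H U)
    (hanti : IsWeylAntiinvariant H ψ) {ε : ℂ}
    (hf : SolvesSchrodinger b e ε fun z => ψ (b.equivFun.symm z))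
    {χ : AddChar (coweightLattice H) ℂ}
    (hper : ∀ p : coweightLattice H, ∀ x ∈ regularSet H, ψ (x + (p : H)) = χ p • ψ x) :
    HasNoLeadingCoeff (rootFamily (𝔤 := 𝔤) b) fun z => ψ (b.equivFun.symm z) := by
  intro α m y hym hy k V Φ hV hyV hΦ hΦψ
  have hα := isNonZero_of_mem_root α.2
  have heα := he α α.2
  have hfα := he (-α) (neg_mem_root α.2)
  rw [Weight.coe_neg] at hfα
  have hef := he_norm α α.2
  have hκ := rootLength_ne_zero hBinv hb hα heα hfα hef
  have t := isSl2Triple_rootVector hBinv hb hα heα hfα hef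
  have hfα' : (2 / rootLength b (α : Weight ℂ H 𝔤)) • e (-α) ∈
      rootSpace H (-(α : Weight ℂ H 𝔤)) := Submodule.smul_mem _ _ hfα
  have := neBot_nhdsWithin_hyperplaneCompl (𝔤 := 𝔤) b y
  have hΦy := hΦ.continuousOn.continuousAt (hV.mem_nhds hyV)
  -- the leading coefficient has weight zero
  have hΦ0 : Φ y ∈ maxTrivSubmodule ℂ H U := by
    refine mem_maxTrivSubmodule_of_eventually (𝔤 := 𝔤) b hΦy ?_
    filter_upwards [self_mem_nhdsWithin, mem_nhdsWithin_of_mem_nhds (hV.mem_nhds hyV)] with z hz hzV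
    rw [hΦψ z ⟨hzV, hz⟩]
    exact Submodule.smul_mem _ _ (hzero _ ((mem_hyperplaneCompl_rootFamily b).1 hz))
  have hΦH : ∀ x : H, ⁅(x : 𝔤), Φ y⁆ = 0 := (mem_maxTrivSubmodule ℂ H U _).1 hΦ0
  -- the leading coefficient is an eigenvector of `e f`
  have hlead : ((k : ℂ) * (k + 1) * rootLength b (α : Weight ℂ H 𝔤)) • Φ y =
      ⁅e α, ⁅e (-α), Φ y⁆⁆ + ⁅e (-α), ⁅e α, Φ y⁆⁆ := by
    obtain ⟨W, hW, hWo, hyW⟩ := eventually_nhds_iff.1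
      (eventually_mem_hyperplaneCompl_of_isGenericPoint (rootFamily_ne_zero b) hym hy)
    -- A pole of order `k` is the exponent `-k`, for which `(-k)(-k - 1) = k(k + 1)`.
    have := smul_leadingCoeff_eq_lie_lie_add b hf hym hy (k := -(k : ℤ)) (hV.inter hWo) ⟨hyV, hyW⟩
      (hΦ.mono Set.inter_subset_left) (by
        rintro z ⟨hzV, hzW⟩ hzm
        rw [hΦψ z ⟨hzV, (hW z hzW).1 hzm⟩, smul_smul]
        have h0 : rootFunctional b (α : Weight ℂ H 𝔤) z - m ≠ 0 := sub_ne_zero.2 hzm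
        change _ = (_ * (rootFunctional b (α : Weight ℂ H 𝔤) z - m) ^ k) • _
        rw [zpow_neg, zpow_natCast, inv_mul_cancel₀ (pow_ne_zero _ h0), one_smul])
    rw [← this]
    congr 1
    push_cast; ring
  have hk : ⁅e α, ⁅(2 / rootLength b (α : Weight ℂ H 𝔤)) • e (-α), Φ y⁆⁆ =
      ((k : ℂ) * (k + 1)) • Φ y := by
    have h1 : ⁅e (-α), ⁅e α, Φ y⁆⁆ = ⁅e α, ⁅e (-α), Φ y⁆⁆ := by
      have := lie_lie (e α) (e (-α)) (Φ y)
      rw [lie_rootVector_eq_sum hBinv hb heα hfα hef, hΦH] at this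
      exact (sub_eq_zero.1 this.symm).symm
    rw [h1, ← two_smul ℂ] at hlead
    rw [smul_lie, lie_smul, div_eq_mul_inv, mul_comm, mul_smul, ← hlead, smul_smul]
    congr 1
    field_simp
  -- the action of the reflection on the leading coefficient
  obtain ⟨n, hn, hnlift⟩ := exists_isWeylLift_rootReflection (U := U) α.2 t heα hfα'
  have hnΦ : (n : Module.End ℂ U) (Φ y) = (-1 : ℂ) ^ k • Φ y := by
    rw [hn]
    exact sl2Weyl_apply_zero_weight t (isNilpotent_toEnd_of_isNonZero hα heα)
      (isNilpotent_toEnd_of_isNonZero (H := H) hα.neg hfα') (hΦH _) hk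
  obtain ⟨p₁, hp₁, hαp₁⟩ := exists_coweight_apply_eq_one α.2
  set p : coweightLattice H := m • ⟨p₁, hp₁⟩ with hp
  have hαp : (α : Weight ℂ H 𝔤) (p : H) = m := by
    have h : (p : H) = (m : ℂ) • p₁ := by
      rw [Int.cast_smul_eq_zsmul, hp]; rfl
    have h2 : Weight.toLinear ℂ H 𝔤 α ((m : ℂ) • p₁) = m * (α : Weight ℂ H 𝔤) p₁ := by
      rw [map_smul]; rfl
    rw [h]
    refine (show _ = _ from h2).trans ?_
    rw [hαp₁, mul_one]
  have hαsub : ∀ x : H, (α : Weight ℂ H 𝔤) (x - p) = (α : Weight ℂ H 𝔤) x - m := fun x =>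
    (map_sub (Weight.toLinear ℂ H 𝔤 α) x p).trans (congrArg _ hαp)
  have hαadd : ∀ x : H, (α : Weight ℂ H 𝔤) (x + p) = (α : Weight ℂ H 𝔤) x + m := fun x =>
    (map_add (Weight.toLinear ℂ H 𝔤 α) x p).trans (congrArg _ hαp)
  -- The affine reflection in the hyperplane `α = m`; it fixes `y` because `α p = m`.
  set σ : (ι → ℂ) → ι → ℂ := fun z =>
    b.equivFun (rootReflection hα (b.equivFun.symm z - p) + p) with hσ
  have hσsymm : ∀ z, b.equivFun.symm (σ z) = rootReflection hα (b.equivFun.symm z - p) + p :=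
    fun z => b.equivFun.symm_apply_apply _
  have hσc : Continuous σ := by
    have h1 : Continuous (b.equivFun.toLinearMap ∘ₗ (rootReflection hα).toLinearMap ∘ₗ
        b.equivFun.symm.toLinearMap) := LinearMap.continuous_of_finiteDimensional _
    have h2 : σ = fun z => (b.equivFun.toLinearMap ∘ₗ (rootReflection hα).toLinearMap ∘ₗ
        b.equivFun.symm.toLinearMap) z +
          (b.equivFun p - b.equivFun (rootReflection hα p)) := by
      funext z
      simp only [hσ, map_add, map_sub, LinearMap.comp_apply, LinearEquiv.coe_coe]
      abel
    rw [h2]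
    exact h1.add continuous_const
  have hσy : σ y = y := by
    have h0 : (α : Weight ℂ H 𝔤) (b.equivFun.symm y - p) = 0 := by
      rw [hαsub]; exact sub_eq_zero.2 hym
    simp only [hσ]
    rw [rootReflection_apply, h0, zero_smul, sub_zero, sub_add_cancel, LinearEquiv.apply_symm_apply]
  have hσa : ∀ z, rootFunctional b (α : Weight ℂ H 𝔤) (σ z) - m =
      -(rootFunctional b (α : Weight ℂ H 𝔤) z - m) := by
    intro z
    rw [rootFunctional_apply, rootFunctional_apply, hσsymm, hαadd, add_sub_cancel_right,
      apply_rootReflection, ← hαsub]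
    set x := b.equivFun.symm z - (p : H)
    rw [← apply_rootReflection hα, rootReflection_apply]
    have : Weight.toLinear ℂ H 𝔤 α (x - (α : Weight ℂ H 𝔤) x • coroot (α : Weight ℂ H 𝔤)) =
        -(α : Weight ℂ H 𝔤) x := by
      rw [map_sub, map_smul]
      have h2 : Weight.toLinear ℂ H 𝔤 α (coroot (α : Weight ℂ H 𝔤)) = 2 := root_apply_coroot hα
      rw [h2, smul_eq_mul, Weight.toLinear_apply]; ring
    exact this
  have hσV : ∀ᶠ z in 𝓝 y, σ z ∈ V :=
    hσc.continuousAt.eventually (by rw [hσy]; exact hV.mem_nhds hyV)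
  have hev : (fun z => (n : Module.End ℂ U) (Φ (σ z))) =ᶠ[
      𝓝[hyperplaneCompl (rootFamily (𝔤 := 𝔤) b)] y] fun z => (-(-1 : ℂ) ^ k) • Φ z := by
    filter_upwards [self_mem_nhdsWithin, mem_nhdsWithin_of_mem_nhds (hV.mem_nhds hyV),
      mem_nhdsWithin_of_mem_nhds hσV] with z hz hzV hzσ
    have hx := (mem_hyperplaneCompl_rootFamily b).1 hz
    have hσD : σ z ∈ hyperplaneCompl (rootFamily (𝔤 := 𝔤) b) := by
      rw [mem_hyperplaneCompl_rootFamily, hσsymm]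
      refine add_mem_regularSet (rootReflection_mem_regularSet hα ?_) p.2
      rw [sub_eq_add_neg]; exact add_mem_regularSet hx (neg_mem p.2)
    have h1 : Φ (σ z) = (rootFamily b α (σ z) - m) ^ k • ψ (b.equivFun.symm (σ z)) :=
      hΦψ _ ⟨hzσ, hσD⟩
    rw [hσsymm] at h1
    rw [h1, hΦψ z ⟨hzV, hz⟩, map_smul, apply_affine_reflection hanti hper hα hnlift p hx]
    change (rootFunctional b (α : Weight ℂ H 𝔤) (σ z) - m) ^ k • _ =
      _ • (rootFunctional b (α : Weight ℂ H 𝔤) z - m) ^ k • _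
    rw [hσa, smul_smul, smul_neg, ← neg_smul, neg_pow]
    congr 1; ring
  have hlim1 : Tendsto (fun z => (n : Module.End ℂ U) (Φ (σ z)))
      (𝓝[hyperplaneCompl (rootFamily (𝔤 := 𝔤) b)] y) (𝓝 ((n : Module.End ℂ U) (Φ y))) := by
    have h1 : Tendsto σ (𝓝 y) (𝓝 y) := by simpa [hσy] using hσc.tendsto y
    exact ((((n : Module.End ℂ U).continuous_of_finiteDimensional.tendsto (Φ y)).comp
      hΦy.tendsto).comp h1).mono_left nhdsWithin_le_nhds
  have hlim2 : Tendsto (fun z => (-(-1 : ℂ) ^ k) • Φ z)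
      (𝓝[hyperplaneCompl (rootFamily (𝔤 := 𝔤) b)] y) (𝓝 ((-(-1 : ℂ) ^ k) • Φ y)) :=
    (hΦy.tendsto.mono_left nhdsWithin_le_nhds).const_smul _
  have h := tendsto_nhds_unique (hlim1.congr' hev) hlim2
  rw [hnΦ, neg_smul] at h
  have h0 : (-1 : ℂ) ^ k • Φ y = 0 := by
    rw [eq_neg_iff_add_eq_zero, ← two_smul ℂ] at h
    exact (smul_eq_zero.1 h).resolve_left two_ne_zero
  exact (smul_eq_zero.1 h0).resolve_left (pow_ne_zero _ (by norm_num))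

end LeadingCoefficient

/-! ### Commutators of a root vector with sums over the roots. -/

section RootSum

attribute [local instance] LieRing.ofAssociativeRing

open LieModule LieAlgebra LieAlgebra.IsKilling fwdDiff

variable {𝔤 : Type*} [LieRing 𝔤] [LieAlgebra ℂ 𝔤] [FiniteDimensional ℂ 𝔤] [IsKilling ℂ 𝔤]
  {B : LinearMap.BilinForm ℂ 𝔤} {H : LieSubalgebra ℂ 𝔤} [H.IsCartanSubalgebra]
  {e : Weight ℂ H 𝔤 → 𝔤}

/-- The expansion of a root vector in a family of root vectors, in terms of functionals which are
normalized on that family. -/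
theorem eq_sum_of_mem_rootSpace (he : ∀ α ∈ H.root, e α ∈ rootSpace H α)
    {φ : Weight ℂ H 𝔤 → 𝔤 →ₗ[ℂ] ℂ} (hφ : ∀ α ∈ H.root, φ α (e α) = 1) {χ : H → ℂ} (hχ : χ ≠ 0)
    {x : 𝔤} (hx : x ∈ rootSpace H χ) [DecidableEq (H → ℂ)] :
    x = ∑ γ ∈ H.root, if (γ : H → ℂ) = χ then φ γ x • e γ else 0 := by
  by_cases hx0 : x = 0
  · subst hx0; simp
  have hbot : genWeightSpace 𝔤 χ ≠ ⊥ := fun h => hx0 <| by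
    have hx' : x ∈ genWeightSpace 𝔤 χ := hx
    rw [h] at hx'; simpa using hx'
  obtain ⟨γ₀, rfl⟩ : ∃ γ₀ : Weight ℂ H 𝔤, χ = γ₀ := ⟨⟨χ, hbot⟩, rfl⟩
  have hγ : γ₀ ∈ H.root := Finset.mem_filter.2 ⟨Finset.mem_univ _, hχ⟩
  rw [Finset.sum_eq_single_of_mem γ₀ hγ fun γ _ hne => if_neg fun h => hne (DFunLike.coe_injective h),
    if_pos rfl]
  have hn1 := hφ γ₀ hγ
  have he0 : (⟨e γ₀, he γ₀ hγ⟩ : rootSpace H γ₀) ≠ 0 := by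
    intro h0
    have h0' : e γ₀ = 0 := congrArg Subtype.val h0
    simp [h0'] at hn1
  obtain ⟨c, hc⟩ := exists_smul_eq_of_finrank_eq_one
    (finrank_rootSpace_eq_one γ₀ (isNonZero_of_mem_root hγ)) he0 ⟨x, hx⟩
  have hc' : c • e γ₀ = x := congrArg Subtype.val hc
  rw [← hc', map_smul, hn1, smul_eq_mul, mul_one]

theorem eq_sum_neg_of_mem_rootSpace (he : ∀ α ∈ H.root, e α ∈ rootSpace H α)
    {φ : Weight ℂ H 𝔤 → 𝔤 →ₗ[ℂ] ℂ} (hφ : ∀ α ∈ H.root, φ α (e α) = 1) {χ : H → ℂ} (hχ : χ ≠ 0)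
    {x : 𝔤} (hx : x ∈ rootSpace H χ) [DecidableEq (H → ℂ)] :
    x = ∑ β ∈ H.root, if -(β : H → ℂ) = χ then φ (-β) x • e (-β) else 0 := by
  conv_lhs => rw [eq_sum_of_mem_rootSpace he hφ hχ hx]
  refine Finset.sum_equiv (Equiv.neg _) (fun γ => ?_) fun γ _ => ?_
  · simp
  · simp

variable {M : Type*} [AddCommGroup M] [Module ℂ M]

/-- Invariance of `∑ e_β ⊗ e_{-β}`. Both sides expand into pairs with `γ = α + β`, whose
coefficients match by invariance of `B`. The conditions `c 0 = 0` and `c α = 0` discard the terms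
where the bracket falls into the Cartan subalgebra. -/
theorem sum_root_lie_neg (hBinv : B.lieInvariant 𝔤) (he : ∀ α ∈ H.root, e α ∈ rootSpace H α)
    (he_norm : ∀ α ∈ H.root, B (e α) (e (-α)) = 1) {α : Weight ℂ H 𝔤} (hα : α ∈ H.root)
    (c : (H → ℂ) → ℂ) (h0 : c 0 = 0) (h1 : c α = 0) (T : 𝔤 →ₗ[ℂ] 𝔤 →ₗ[ℂ] M) :
    ∑ γ ∈ H.root, c γ • T (e γ) ⁅e α, e (-γ)⁆ =
      -∑ β ∈ H.root, c (β + α) • T ⁅e α, e β⁆ (e (-β)) := by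
  classical
  have hφ : ∀ γ ∈ H.root, B.flip (e (-γ)) (e γ) = 1 := he_norm
  have hφ' : ∀ γ ∈ H.root, B (e (-γ)) (e γ) = 1 := fun γ hγ => by
    simpa using he_norm (-γ) (neg_mem_root hγ)
  have hL : ∀ γ ∈ H.root, c γ • T (e γ) ⁅e α, e (-γ)⁆ = ∑ β ∈ H.root,
      if (γ : H → ℂ) = α + β then
        (c γ * B ⁅e α, e (-γ)⁆ (e β)) • T (e γ) (e (-β)) else 0 := by
    intro γ hγ
    by_cases hγα : (γ : H → ℂ) = α
    · rw [hγα, h1]; simp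
    have hx : ⁅e α, e (-γ)⁆ ∈ rootSpace H ((α : H → ℂ) + ((-γ : Weight ℂ H 𝔤) : H → ℂ)) :=
      lie_mem_genWeightSpace_of_mem_genWeightSpace (he α hα) (he (-γ) (neg_mem_root hγ))
    have hne : (α : H → ℂ) + ((-γ : Weight ℂ H 𝔤) : H → ℂ) ≠ 0 := by
      rw [Weight.coe_neg, ← sub_eq_add_neg, sub_ne_zero]
      exact Ne.symm hγα
    conv_lhs => rw [eq_sum_neg_of_mem_rootSpace (φ := fun γ => B.flip (e (-γ))) he hφ hne hx]
    rw [map_sum, Finset.smul_sum]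
    refine Finset.sum_congr rfl fun β _ => ?_
    have hiff : (-(β : H → ℂ) = (α : H → ℂ) + ((-γ : Weight ℂ H 𝔤) : H → ℂ)) ↔
        (γ : H → ℂ) = α + β := by
      rw [Weight.coe_neg]
      constructor <;> intro h
      · rw [eq_add_neg_iff_add_eq, neg_add_eq_iff_eq_add] at h
        rw [h, add_comm]
      · rw [h]; abel
    simp only [hiff]
    split_ifs
    · rw [map_smul, smul_smul, neg_neg]; rfl
    · simp
  have hR : ∀ β ∈ H.root, c (β + α) • T ⁅e α, e β⁆ (e (-β)) = ∑ γ ∈ H.root,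
      if (γ : H → ℂ) = α + β then
        (c γ * B (e (-γ)) ⁅e α, e β⁆) • T (e γ) (e (-β)) else 0 := by
    intro β hβ
    by_cases hβα : (α : H → ℂ) + β = 0
    · rw [add_comm, hβα, h0, zero_smul]
      refine (Finset.sum_eq_zero fun γ _ => ?_).symm
      split_ifs with h
      · rw [h, h0]; simp
      · rfl
    have hx : ⁅e α, e β⁆ ∈ rootSpace H ((α : H → ℂ) + (β : H → ℂ)) :=
      lie_mem_genWeightSpace_of_mem_genWeightSpace (he α hα) (he β hβ)
    conv_lhs => rw [eq_sum_of_mem_rootSpace (φ := fun γ => B (e (-γ))) he hφ' hβα hx]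
    rw [map_sum, LinearMap.sum_apply, Finset.smul_sum]
    refine Finset.sum_congr rfl fun γ _ => ?_
    split_ifs with h
    · rw [map_smul, LinearMap.smul_apply, smul_smul, h, add_comm (β : H → ℂ)]
    · simp
  rw [Finset.sum_congr rfl hL, Finset.sum_congr rfl hR, Finset.sum_comm, ← Finset.sum_neg_distrib]
  refine Finset.sum_congr rfl fun β _ => ?_
  rw [← Finset.sum_neg_distrib]
  refine Finset.sum_congr rfl fun γ _ => ?_
  split_ifs
  · rw [hBinv, mul_neg, neg_smul]
  · simp

/-- The operator `∑ c(β) (ad e_α)ⁱ(e_β) e_{-β}` on a representation. -/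
def rootSum (U : Type*) [AddCommGroup U] [Module ℂ U] [LieRingModule 𝔤 U] [LieModule ℂ 𝔤 U]
    (e : Weight ℂ H 𝔤 → 𝔤) (α : Weight ℂ H 𝔤) (c : (H → ℂ) → ℂ) (i : ℕ) : Module.End ℂ U :=
  ∑ β ∈ H.root, c β • (toEnd ℂ 𝔤 U ((ad ℂ 𝔤 (e α) ^ i) (e β)) * toEnd ℂ 𝔤 U (e (-β)))

variable {U : Type*} [AddCommGroup U] [Module ℂ U] [LieRingModule 𝔤 U] [LieModule ℂ 𝔤 U]

theorem rootSum_apply (α : Weight ℂ H 𝔤) (c : (H → ℂ) → ℂ) (i : ℕ) (u : U) :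
    rootSum U e α c i u = ∑ β ∈ H.root, c β • ⁅(ad ℂ 𝔤 (e α) ^ i) (e β), ⁅e (-β), u⁆⁆ := by
  simp [rootSum, LinearMap.sum_apply]

/-- By the Leibniz rule the commutator acts on `e_β` and on `e_{-β}`. The invariance identity moves
the second action onto the first factor at the cost of shifting the coefficient by `α`. Coefficients
live on all functions of `H` so that this shift makes sense off the roots. -/
theorem lie_rootSum (hBinv : B.lieInvariant 𝔤) (he : ∀ α ∈ H.root, e α ∈ rootSpace H α)
    (he_norm : ∀ α ∈ H.root, B (e α) (e (-α)) = 1) {α : Weight ℂ H 𝔤} (hα : α ∈ H.root)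
    (c : (H → ℂ) → ℂ) (h0 : c 0 = 0) (h1 : c α = 0) (i : ℕ) :
    ⁅toEnd ℂ 𝔤 U (e α), rootSum U e α c i⁆ =
      rootSum U e α (fun χ => c χ - c (χ + α)) (i + 1) := by
  have h := sum_root_lie_neg hBinv he he_norm hα c h0 h1
    ((LinearMap.mul ℂ (Module.End ℂ U)).compl₁₂
      ((toEnd ℂ 𝔤 U : 𝔤 →ₗ[ℂ] Module.End ℂ U) ∘ₗ (ad ℂ 𝔤 (e α) ^ i))
      (toEnd ℂ 𝔤 U : 𝔤 →ₗ[ℂ] Module.End ℂ U))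
  simp only [LinearMap.compl₁₂_apply, LinearMap.comp_apply, LieHom.coe_toLinearMap,
    LinearMap.mul_apply'] at h
  have hcomm : ∀ x y : 𝔤, ⁅toEnd ℂ 𝔤 U (e α), toEnd ℂ 𝔤 U x * toEnd ℂ 𝔤 U y⁆ =
      toEnd ℂ 𝔤 U ⁅e α, x⁆ * toEnd ℂ 𝔤 U y + toEnd ℂ 𝔤 U x * toEnd ℂ 𝔤 U ⁅e α, y⁆ := by
    intro x y
    rw [LieHom.map_lie, LieHom.map_lie, Ring.lie_def, Ring.lie_def, Ring.lie_def]
    noncomm_ring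
  simp only [rootSum, lie_sum, lie_smul, hcomm, smul_add, Finset.sum_add_distrib, h, sub_smul,
    Finset.sum_sub_distrib, pow_succ', Module.End.mul_apply, ad_apply]
  rw [← sub_eq_add_neg]
  congr 1
  refine Finset.sum_congr rfl fun β _ => ?_
  have : (ad ℂ 𝔤 (e α) ^ i) ⁅e α, e β⁆ = ⁅e α, (ad ℂ 𝔤 (e α) ^ i) (e β)⁆ := by
    rw [← ad_apply ℂ, ← ad_apply ℂ, ← Module.End.mul_apply, ← Module.End.mul_apply, ← pow_succ,
      pow_succ']
  rw [this]

/-- Iterated commutators with `e_α` replace the coefficients of a sum over the roots by their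
iterated differences in the direction of `α`. -/
theorem ad_pow_rootSum (hBinv : B.lieInvariant 𝔤) (he : ∀ α ∈ H.root, e α ∈ rootSpace H α)
    (he_norm : ∀ α ∈ H.root, B (e α) (e (-α)) = 1) {α : Weight ℂ H 𝔤} (hα : α ∈ H.root)
    (c : (H → ℂ) → ℂ) (hc : ∀ j : ℕ, c (j • (α : H → ℂ)) = 0) (i : ℕ) :
    (ad ℂ (Module.End ℂ U) (toEnd ℂ 𝔤 U (e α)) ^ i) (rootSum U e α c 0) =
      rootSum U e α (fun χ => ∑ j ∈ Finset.range (i + 1),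
        (-1) ^ j * (i.choose j : ℂ) * c (χ + j • (α : H → ℂ))) i := by
  have key : ∀ i, (ad ℂ (Module.End ℂ U) (toEnd ℂ 𝔤 U (e α)) ^ i) (rootSum U e α c 0) =
      rootSum U e α ((-1 : ℂ) ^ i • (fwdDiff (α : H → ℂ))^[i] c) i := by
    intro i
    induction i with
    | zero => simp
    | succ i ih =>
      have h0 : ∀ n : ℕ, ((-1 : ℂ) ^ i • (fwdDiff (α : H → ℂ))^[i] c) (n • (α : H → ℂ)) = 0 := by
        intro n
        rw [Pi.smul_apply, fwdDiff_iter_eq_sum_shift, Finset.sum_eq_zero, smul_zero]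
        intro k _
        rw [← add_smul, hc, smul_zero]
      rw [pow_succ', Module.End.mul_apply, ih, ad_apply, lie_rootSum hBinv he he_norm hα _
        (by simpa using h0 0) (by simpa using h0 1)]
      congr 1
      funext χ
      simp only [Pi.smul_apply, Function.iterate_succ_apply', fwdDiff, smul_eq_mul]
      ring
  rw [key]
  congr 1
  funext χ
  rw [Pi.smul_apply, fwdDiff_iter_eq_sum_shift, smul_eq_mul, Finset.mul_sum]
  refine Finset.sum_congr rfl fun j hj => ?_
  have hji : j ≤ i := Nat.lt_succ_iff.1 (Finset.mem_range.1 hj)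
  have hs : (-1 : ℂ) ^ i * (-1) ^ (i - j) = (-1) ^ j := by
    obtain ⟨d, rfl⟩ := Nat.exists_eq_add_of_le hji
    rw [add_tsub_cancel_left, pow_add, mul_assoc, ← mul_pow]
    simp
  rw [zsmul_eq_mul]
  push_cast
  rw [← hs]; ring

theorem toEnd_pow_rootSum (hBinv : B.lieInvariant 𝔤) (he : ∀ α ∈ H.root, e α ∈ rootSpace H α)
    (he_norm : ∀ α ∈ H.root, B (e α) (e (-α)) = 1) {α : Weight ℂ H 𝔤} (hα : α ∈ H.root)
    (c : (H → ℂ) → ℂ) (hc : ∀ j : ℕ, c (j • (α : H → ℂ)) = 0) (l : ℕ) (u : U) :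
    (toEnd ℂ 𝔤 U (e α) ^ l) (∑ β ∈ H.root, c β • ⁅e β, ⁅e (-β), u⁆⁆) =
      ∑ ij ∈ Finset.HasAntidiagonal.antidiagonal l, (l.choose ij.1 : ℂ) • ∑ β ∈ H.root,
        (∑ j ∈ Finset.range (ij.1 + 1),
          (-1) ^ j * (ij.1.choose j : ℂ) * c (β + j • (α : H → ℂ))) •
            ⁅(ad ℂ 𝔤 (e α) ^ ij.1) (e β), ⁅e (-β), (toEnd ℂ 𝔤 U (e α) ^ ij.2) u⁆⁆ := by
  have h := toEnd_pow_lie ℂ (toEnd ℂ 𝔤 U (e α)) (rootSum U e α c 0) u l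
  simp only [toEnd_module_end, LieHom.id_apply, Module.End.lie_apply,
    ad_pow_rootSum hBinv he he_norm hα c hc, rootSum_apply, pow_zero, Module.End.one_apply] at h
  rw [h]
  refine Finset.sum_congr rfl fun ij _ => ?_
  rw [Nat.cast_smul_eq_nsmul]

end RootSum

/-! ### Order of vanishing of powers of a root vector applied to the solution. -/

section VanishingOrder

open LieModule LieAlgebra LieAlgebra.IsKilling

variable {𝔤 : Type*} [LieRing 𝔤] [LieAlgebra ℂ 𝔤] [FiniteDimensional ℂ 𝔤] [IsKilling ℂ 𝔤]
  {B : LinearMap.BilinForm ℂ 𝔤} {H : LieSubalgebra ℂ 𝔤} [H.IsCartanSubalgebra]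
  {ι : Type*} [Fintype ι] [DecidableEq ι] (b : Module.Basis ι ℂ H)
  {e : Weight ℂ H 𝔤 → 𝔤}

open Classical in
/-- The potential of the roots other than `α` and `-α`, extended by zero to all functions on the
Cartan subalgebra. -/
def otherPotential (α : Weight ℂ H 𝔤) (z : ι → ℂ) (χ : H → ℂ) : ℂ :=
  if ∃ γ ∈ H.root, ¬ (γ = -α ∨ γ = α) ∧ (γ : H → ℂ) = χ then
    (Real.pi : ℂ) ^ 2 / Complex.sin (Real.pi * χ (b.equivFun.symm z)) ^ 2 else 0

theorem eq_or_eq_neg_of_coe_eq_smul {α γ : Weight ℂ H 𝔤} (hγ : γ ∈ H.root) {t : ℂ}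
    (h : (γ : H → ℂ) = t • (α : H → ℂ)) : γ = -α ∨ γ = α :=
  eq_neg_or_eq_of_eq_smul _ _ (isNonZero_of_mem_root hγ) t h

theorem otherPotential_smul (α : Weight ℂ H 𝔤) (z : ι → ℂ) (t : ℂ) :
    otherPotential b α z (t • (α : H → ℂ)) = 0 := by
  rw [otherPotential, if_neg]
  rintro ⟨γ, hγ, hne, h⟩
  exact hne (eq_or_eq_neg_of_coe_eq_smul hγ h)

theorem otherPotential_of_mem_root {α : Weight ℂ H 𝔤} (z : ι → ℂ) {β : Weight ℂ H 𝔤}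
    (hβ : β ∈ H.root) [Decidable (β = -α ∨ β = α)] :
    otherPotential b α z β = if β = -α ∨ β = α then 0 else
      (Real.pi : ℂ) ^ 2 / Complex.sin (Real.pi * rootFunctional b β z) ^ 2 := by
  rw [otherPotential]
  by_cases h : β = -α ∨ β = α
  · rw [if_pos h, if_neg]
    rintro ⟨γ, -, hne, hγ⟩
    exact hne (DFunLike.coe_injective hγ ▸ h)
  · rw [if_neg h, if_pos ⟨β, hβ, h, rfl⟩, rootFunctional_apply]

theorem analyticAt_potential {w : ℂ} (hw : ∀ m : ℤ, w ≠ m) :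
    AnalyticAt ℂ (fun x : ℂ => (Real.pi : ℂ) ^ 2 / Complex.sin (Real.pi * x) ^ 2) w := by
  have h := pow_ne_zero 2 (sin_pi_mul_ne_zero hw)
  refine AnalyticAt.div analyticAt_const (AnalyticAt.pow ?_ 2) h
  exact (Complex.differentiable_sin.comp (by fun_prop)).analyticAt w

/-- A finite difference of the potentials along a root string vanishes to high order. -/
theorem isBigO_sum_otherPotential (he : ∀ α ∈ H.root, e α ∈ rootSpace H α) {α : H.root} {m : ℤ}
    {y : ι → ℂ} (hym : rootFunctional b (α : Weight ℂ H 𝔤) y = m)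
    (hy : IsGenericPoint (rootFamily b) α y) (v : ι → ℂ) {β : Weight ℂ H 𝔤} (hβ : β ∈ H.root)
    (i : ℕ) (hE : (ad ℂ 𝔤 (e α) ^ i) (e β) ≠ 0) :
    (fun s : ℂ => ∑ j ∈ Finset.range (i + 1), (-1) ^ j * (i.choose j : ℂ) *
      otherPotential b (α : Weight ℂ H 𝔤) (y + s • v) ((β : H → ℂ) + j • ((α : Weight ℂ H 𝔤) : H → ℂ)))
      =O[𝓝 0] fun s => s ^ i := by
  by_cases hβα : β = -(α : Weight ℂ H 𝔤) ∨ β = α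
  · have : ∃ t : ℂ, (β : H → ℂ) = t • ((α : Weight ℂ H 𝔤) : H → ℂ) := by
      rcases hβα with rfl | rfl
      · exact ⟨-1, by simp⟩
      · exact ⟨1, by simp⟩
    obtain ⟨t, ht⟩ := this
    have h0 : ∀ (z : ι → ℂ) (j : ℕ),
        otherPotential b (α : Weight ℂ H 𝔤) z ((β : H → ℂ) + j • ((α : Weight ℂ H 𝔤) : H → ℂ)) = 0 := by
      intro z j
      rw [ht, ← Nat.cast_smul_eq_nsmul ℂ, ← add_smul, otherPotential_smul]
    simp only [h0, mul_zero, Finset.sum_const_zero]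
    exact isBigO_zero _ _
  · have hβy : ∀ n : ℤ, rootFunctional b β y ≠ n := fun n hn =>
      hβα (eq_or_eq_neg_of_isGenericPoint b hy hβ hn)
    refine (isBigO_sum_choose_mul _ (analyticAt_potential hβy) i (rootFunctional b β v)
      (rootFunctional b (α : Weight ℂ H 𝔤) v)).congr_left fun s => ?_
    refine Finset.sum_congr rfl fun j hj => ?_
    have hji : j ≤ i := Nat.lt_succ_iff.1 (Finset.mem_range.1 hj)
    congr 1
    -- All earlier brackets are then nonzero too, so each `β + jα` is a root and `otherPotential`
    -- has its genuine value there rather than the default zero.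
    have hEj : (ad ℂ 𝔤 (e α) ^ j) (e β) ≠ 0 := by
      intro h0
      obtain ⟨d, rfl⟩ := Nat.exists_eq_add_of_le hji
      rw [add_comm, pow_add, Module.End.mul_apply, h0, map_zero] at hE
      exact hE rfl
    have hmem : (ad ℂ 𝔤 (e α) ^ j) (e β) ∈
        genWeightSpace 𝔤 (j • ((α : Weight ℂ H 𝔤) : H → ℂ) + (β : H → ℂ)) :=
      toEnd_pow_apply_mem (he α α.2) (he β hβ) j
    obtain ⟨γ, hγ⟩ : ∃ γ : Weight ℂ H 𝔤,
        (γ : H → ℂ) = (β : H → ℂ) + j • ((α : Weight ℂ H 𝔤) : H → ℂ) := by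
      refine ⟨⟨j • ((α : Weight ℂ H 𝔤) : H → ℂ) + (β : H → ℂ), fun h => hEj ?_⟩, add_comm _ _⟩
      rw [h] at hmem; simpa using hmem
    have hnot : ∀ t : ℂ, (γ : H → ℂ) ≠ t • ((α : Weight ℂ H 𝔤) : H → ℂ) := by
      intro t ht
      refine hβα (eq_or_eq_neg_of_coe_eq_smul hβ (t := t - j) ?_)
      rw [sub_smul, ← ht, hγ, Nat.cast_smul_eq_nsmul, add_sub_cancel_right]
    have hγroot : γ ∈ H.root :=
      Finset.mem_filter.2 ⟨Finset.mem_univ _, fun h0 => hnot 0 (by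
        rw [zero_smul]; exact h0)⟩
    have hγα : ¬ (γ = -(α : Weight ℂ H 𝔤) ∨ γ = α) := by
      rintro (h | h)
      · exact hnot (-1) (by rw [h]; simp)
      · exact hnot 1 (by rw [h]; simp)
    classical
    rw [← hγ, otherPotential_of_mem_root b _ hγroot, if_neg hγα]
    -- Since `α y = m`, the root `β + jα` differs at `y` from `β` by the integer `j m`, which the
    -- period of the potential absorbs. What remains is one analytic function sampled at steps
    -- proportional to `s`.
    have hval : rootFunctional b γ (y + s • v) = (rootFunctional b β y +
        s * (rootFunctional b β v + j * rootFunctional b (α : Weight ℂ H 𝔤) v)) +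
          ((j * m : ℤ) : ℂ) := by
      have h1 : ∀ z, rootFunctional b γ z =
          rootFunctional b β z + j * rootFunctional b (α : Weight ℂ H 𝔤) z := by
        intro z
        simp only [rootFunctional_apply, hγ]
        simp
      rw [h1, map_add, map_add, map_smul, map_smul, hym]
      push_cast
      simp only [smul_eq_mul]
      ring
    rw [hval, sin_sq_pi_mul_add_intCast]

variable {U : Type*} [NormedAddCommGroup U] [NormedSpace ℂ U] [FiniteDimensional ℂ U]
  [LieRingModule 𝔤 U] [LieModule ℂ 𝔤 U]

/-- The contribution of the other roots to the eigenvalue equation is of high order. -/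
theorem isBigO_toEnd_pow_otherPotential (hBinv : B.lieInvariant 𝔤)
    (he : ∀ α ∈ H.root, e α ∈ rootSpace H α)
    (he_norm : ∀ α ∈ H.root, B (e α) (e (-α)) = 1) {α : H.root} {m : ℤ}
    {y : ι → ℂ} (hym : rootFunctional b (α : Weight ℂ H 𝔤) y = m)
    (hy : IsGenericPoint (rootFamily b) α y) {v : ι → ℂ}
    (hv : rootFunctional b (α : Weight ℂ H 𝔤) v = 1) {Ψ : (ι → ℂ) → U} {k : ℕ}
    {Φ : ℕ → (ι → ℂ) → U} (hΦ : ∀ l, Continuous (Φ l))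
    (hΨ : ∀ l z, (toEnd ℂ 𝔤 U (e α) ^ l) (Ψ z) =
      (rootFunctional b (α : Weight ℂ H 𝔤) z - m) ^ min k (l + 1) • Φ l z) {l : ℕ} (hkl : k ≤ l) :
    (fun s : ℂ => (toEnd ℂ 𝔤 U (e α) ^ l) (∑ β ∈ H.root,
      otherPotential b (α : Weight ℂ H 𝔤) (y + s • v) β • ⁅e β, ⁅e (-β), Ψ (y + s • v)⁆⁆))
      =O[𝓝 0] fun s => s ^ k := by
  have hc : ∀ z (j : ℕ), otherPotential b (α : Weight ℂ H 𝔤) z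
      (j • ((α : Weight ℂ H 𝔤) : H → ℂ)) = 0 := fun z j => by
    rw [← Nat.cast_smul_eq_nsmul ℂ, otherPotential_smul]
  simp only [toEnd_pow_rootSum hBinv he he_norm α.2 _ (hc _)]
  refine IsBigO.fun_sum fun ij hij => ?_
  refine IsBigO.const_smul_left (IsBigO.fun_sum fun β hβ => ?_) _
  by_cases hE : (ad ℂ 𝔤 (e α) ^ ij.1) (e β) = 0
  · simp only [hE, zero_lie, smul_zero]
    exact isBigO_zero _ _
  have h1 := isBigO_sum_otherPotential b he hym hy v hβ ij.1 hE
  have h2 : (fun s : ℂ => ⁅(ad ℂ 𝔤 (e α) ^ ij.1) (e β), ⁅e (-β),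
      (toEnd ℂ 𝔤 U (e α) ^ ij.2) (Ψ (y + s • v))⁆⁆) =O[𝓝 0]
      fun s => s ^ min k (ij.2 + 1) := by
    have hs : ∀ s : ℂ, ⁅(ad ℂ 𝔤 (e α) ^ ij.1) (e β), ⁅e (-β),
        (toEnd ℂ 𝔤 U (e α) ^ ij.2) (Ψ (y + s • v))⁆⁆ = s ^ min k (ij.2 + 1) •
          ⁅(ad ℂ 𝔤 (e α) ^ ij.1) (e β), ⁅e (-β), Φ ij.2 (y + s • v)⁆⁆ := by
      intro s
      rw [hΨ, lie_smul, lie_smul, map_add, map_smul, hym, hv]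
      simp
    simp only [hs]
    have hcont : Continuous fun s : ℂ =>
        ⁅(ad ℂ 𝔤 (e α) ^ ij.1) (e β), ⁅e (-β), Φ ij.2 (y + s • v)⁆⁆ :=
      (continuous_lie_right _).comp ((continuous_lie_right _).comp
        ((hΦ ij.2).comp (by fun_prop)))
    have := (isBigO_refl (fun s : ℂ => s ^ min k (ij.2 + 1)) (𝓝 0)).smul
      ((hcont.tendsto 0).isBigO_one ℂ)
    simpa using this
  have h3 := h1.smul h2
  simp only [smul_eq_mul, ← pow_add] at h3
  refine h3.trans ?_
  have hij' : ij.1 + ij.2 = l := Finset.HasAntidiagonal.mem_antidiagonal.1 hij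
  -- The difference contributes order `i` and `e_α^(l-i) Ψ` contributes `min k (l - i + 1)`;
  -- together these are at least `k` because `k ≤ l`.
  obtain ⟨d, hd⟩ := Nat.exists_eq_add_of_le (show k ≤ ij.1 + min k (ij.2 + 1) by omega)
  rw [hd]
  simp only [pow_add]
  have hone : (fun s : ℂ => s ^ d) =O[𝓝 0] fun _ => (1 : ℂ) :=
    ((continuous_pow d).tendsto (0 : ℂ)).isBigO_one ℂ
  simpa using (isBigO_refl (fun s : ℂ => s ^ k) (𝓝 0)).mul hone

theorem iteratedDeriv_two_clm_comp (A : U →L[ℂ] U) {g : ℂ → U} (hg : Differentiable ℂ g) (x : ℂ) :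
    iteratedDeriv 2 (fun s => A (g s)) x = A (iteratedDeriv 2 g x) := by
  have h1 : ∀ {g : ℂ → U}, Differentiable ℂ g →
      deriv (fun s => A (g s)) = fun s => A (deriv g s) := fun hg =>
    funext fun s => (A.hasFDerivAt.comp_hasDerivAt s (hg s).hasDerivAt).deriv
  have hd : Differentiable ℂ (deriv g) :=
    differentiableOn_univ.1 (hg.differentiableOn.deriv isOpen_univ)
  simp only [iteratedDeriv_succ, iteratedDeriv_zero]
  rw [h1 hg, h1 hd]

theorem schrodinger_split {α : Weight ℂ H 𝔤} (hα : α ∈ H.root) (z : ι → ℂ) (u : U) :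
    ∑ β ∈ H.root, ((Real.pi : ℂ) ^ 2 / Complex.sin (Real.pi * rootFunctional b β z) ^ 2) •
        ⁅e β, ⁅e (-β), u⁆⁆ =
      ((Real.pi : ℂ) ^ 2 / Complex.sin (Real.pi * rootFunctional b α z) ^ 2) •
        (⁅e α, ⁅e (-α), u⁆⁆ + ⁅e (-α), ⁅e α, u⁆⁆) +
      ∑ β ∈ H.root, otherPotential b α z β • ⁅e β, ⁅e (-β), u⁆⁆ := by
  classical
  have h := sum_root_ite_smul hα
    (fun β => (Real.pi : ℂ) ^ 2 / Complex.sin (Real.pi * rootFunctional b β z) ^ 2)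
    (fun β => ⁅e β, ⁅e (-β), u⁆⁆)
  have hneg : Complex.sin (Real.pi * rootFunctional b (-α) z) ^ 2 =
      Complex.sin (Real.pi * rootFunctional b α z) ^ 2 := by
    rw [rootFunctional_neg, mul_neg, Complex.sin_neg, neg_sq]
  rw [hneg, neg_neg, ← smul_add] at h
  rw [← h, ← Finset.sum_add_distrib]
  refine Finset.sum_congr rfl fun β hβ => ?_
  rw [otherPotential_of_mem_root b z hβ, ← add_smul]
  split_ifs <;> simp

/-- Along a line transversal to the hyperplane, the terms of order `k - 2` of `e_α^l` applied to the
equation give `k(k-1) Φ_l = l(l+1) Φ_l` at `y`, once `Φ_{l+1}` is known to vanish there. The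
remaining roots and the eigenvalue term enter only at order `k`. -/
theorem leadingCoeff_eq_zero (hBinv : B.lieInvariant 𝔤)
    (hb : ∀ i j, B (b i : 𝔤) (b j : 𝔤) = if i = j then 1 else 0)
    (he : ∀ α ∈ H.root, e α ∈ rootSpace H α)
    (he_norm : ∀ α ∈ H.root, B (e α) (e (-α)) = 1) {α : H.root} {m : ℤ}
    {y : ι → ℂ} (hym : rootFunctional b (α : Weight ℂ H 𝔤) y = m)
    (hy : IsGenericPoint (rootFamily b) α y) {Ψ : (ι → ℂ) → U} {ε : ℂ}
    (hΨd : Differentiable ℂ Ψ) (hΨ0 : ∀ z, Ψ z ∈ maxTrivSubmodule ℂ H U)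
    (hΨs : SolvesSchrodinger b e ε Ψ) {k : ℕ} (hk : 1 ≤ k)
    {Φ : ℕ → (ι → ℂ) → U} (hΦ : ∀ l, Differentiable ℂ (Φ l))
    (hΨ : ∀ l z, (toEnd ℂ 𝔤 U (e α) ^ l) (Ψ z) =
      (rootFunctional b (α : Weight ℂ H 𝔤) z - m) ^ min k (l + 1) • Φ l z) {l : ℕ} (hkl : k ≤ l)
    (hnext : Φ (l + 1) y = 0) :
    Φ l y = 0 := by
  have hα := isNonZero_of_mem_root α.2
  have heα := he α α.2
  have hfα := he (-α) (neg_mem_root α.2)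
  rw [Weight.coe_neg] at hfα
  have hef := he_norm α α.2
  have hκ := rootLength_ne_zero hBinv hb hα heα hfα hef
  have t := isSl2Triple_rootVector hBinv hb hα heα hfα hef
  set κ := rootLength b (α : Weight ℂ H 𝔤) with hκdef
  set f := (2 / κ) • e (-α) with hf
  set a := rootFunctional b (α : Weight ℂ H 𝔤) with ha
  obtain ⟨v, hv⟩ := exists_apply_eq_one (rootFunctional_ne_zero b hα)
  set A : U →L[ℂ] U := LinearMap.toContinuousLinearMap (toEnd ℂ 𝔤 U (e α) ^ l) with hA
  have hΨH : ∀ z, ∀ x : H, ⁅(x : 𝔤), Ψ z⁆ = 0 := fun z => (mem_maxTrivSubmodule ℂ H U _).1 (hΨ0 z)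
  -- the line through `y` in the direction `v`
  have hline : Tendsto (fun s : ℂ => y + s • v) (𝓝[≠] 0) (𝓝 y) := by
    have : Continuous fun s : ℂ => y + s • v := by fun_prop
    simpa using (this.tendsto 0).mono_left nhdsWithin_le_nhds
  have hal : ∀ s : ℂ, a (y + s • v) - m = s := by
    intro s
    rw [map_add, map_smul, hym, hv]; simp
  have hline' : Tendsto (fun s : ℂ => y + s • v) (𝓝[≠] 0) (𝓝[{z | a z ≠ m}] y) := by
    refine tendsto_nhdsWithin_iff.2 ⟨hline, ?_⟩
    filter_upwards [self_mem_nhdsWithin] with s hs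
    rw [← sub_ne_zero, hal]
    exact hs
  have hD : ∀ᶠ s : ℂ in 𝓝[≠] 0, y + s • v ∈ hyperplaneCompl (rootFamily (𝔤 := 𝔤) b) := by
    have h1 := hline.eventually
      (eventually_mem_hyperplaneCompl_of_isGenericPoint (rootFamily_ne_zero b) hym hy)
    filter_upwards [h1, self_mem_nhdsWithin] with s hs hs0
    refine hs.1 ?_
    change a (y + s • v) ≠ m
    rw [← sub_ne_zero, hal]
    exact hs0
  -- the limit of the Laplacian
  have hmin : ∀ {l'}, l ≤ l' → min k (l' + 1) = k := fun h => min_eq_left (by omega)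
  have hu : ∀ z, A (Ψ z) = (a z - m) ^ (k : ℤ) • Φ l z := fun z => by
    rw [zpow_natCast, ← hmin le_rfl]; exact hΨ l z
  have hlap : Tendsto (fun s : ℂ => ∑ ν, s ^ (2 - (k : ℤ)) •
      A (iteratedDeriv 2 (fun r : ℂ => Ψ (y + s • v + r • Pi.single ν 1)) 0)) (𝓝[≠] 0)
      (𝓝 ((k * (k - 1) * κ : ℂ) • Φ l y)) := by
    rw [hκdef, rootLength, Finset.mul_sum, Finset.sum_smul]
    refine tendsto_finsetSum _ fun ν _ => ?_
    have := (tendsto_zpow_smul_iteratedDeriv_two isOpen_univ (hΦ l).differentiableOn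
      (fun z _ _ => hu z) (Pi.single ν 1) (Set.mem_univ y) hym).comp hline'
    rw [ha, rootFunctional_single] at this
    refine Tendsto.congr (fun s => ?_) this
    rw [Function.comp_apply, ← ha, hal, iteratedDeriv_two_clm_comp]
    exact hΨd.comp (by fun_prop)
  -- the limit of the potential
  have hpot : Tendsto (fun s : ℂ => s ^ 2 *
      ((Real.pi : ℂ) ^ 2 / Complex.sin (Real.pi * a (y + s • v)) ^ 2)) (𝓝[≠] 0) (𝓝 1) := by
    classical
    have := (tendsto_potential b hym hy α.2).comp hline'
    rw [if_pos (Or.inr rfl)] at this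
    refine this.congr fun s => ?_
    rw [Function.comp_apply, ← ha, hal]
  have hΦl : ∀ l', Tendsto (fun s : ℂ => Φ l' (y + s • v)) (𝓝[≠] 0) (𝓝 (Φ l' y)) := fun l' =>
    ((hΦ l').continuous.tendsto y).comp hline
  have hmain : Tendsto (fun s : ℂ => (s ^ 2 *
      ((Real.pi : ℂ) ^ 2 / Complex.sin (Real.pi * a (y + s • v)) ^ 2)) • κ •
        (⁅f, Φ (l + 1) (y + s • v)⁆ + ((l : ℂ) * (l + 1)) • Φ l (y + s • v))) (𝓝[≠] 0)
      (𝓝 ((l * (l + 1) * κ : ℂ) • Φ l y)) := by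
    have h1 := (((continuous_lie_right (U := U) f).tendsto _).comp (hΦl (l + 1))).add
      ((hΦl l).const_smul ((l : ℂ) * (l + 1)))
    have h2 := hpot.smul (h1.const_smul κ)
    rw [hnext, lie_zero, zero_add, one_smul, smul_smul, mul_comm κ] at h2
    exact h2
  have hother : Tendsto (fun s : ℂ => s ^ (2 - (k : ℤ)) •
      A (∑ β ∈ H.root, otherPotential b (α : Weight ℂ H 𝔤) (y + s • v) β •
        ⁅e β, ⁅e (-β), Ψ (y + s • v)⁆⁆)) (𝓝[≠] 0) (𝓝 0) := by
    have h1 := (isBigO_toEnd_pow_otherPotential b hBinv he he_norm hym hy hv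
      (fun l => (hΦ l).continuous) hΨ hkl).mono (nhdsWithin_le_nhds (s := {0}ᶜ))
    have h2 := (isBigO_refl (fun s : ℂ => s ^ (2 - (k : ℤ))) (𝓝[≠] 0)).smul h1
    refine h2.trans_tendsto ?_
    have h3 : Tendsto (fun s : ℂ => s ^ 2) (𝓝[≠] 0) (𝓝 0) := by
      simpa using ((continuous_pow 2).tendsto (0 : ℂ)).mono_left nhdsWithin_le_nhds
    refine h3.congr' ?_
    filter_upwards [self_mem_nhdsWithin] with s hs
    have hs' : s ≠ 0 := hs
    rw [smul_eq_mul, ← zpow_natCast s k, ← zpow_add₀ hs', sub_add_cancel]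
    rfl
  have hε : Tendsto (fun s : ℂ => (ε * s ^ 2) • Φ l (y + s • v)) (𝓝[≠] 0) (𝓝 0) := by
    have h1 : Tendsto (fun s : ℂ => ε * s ^ 2) (𝓝[≠] 0) (𝓝 0) := by
      have : Continuous fun s : ℂ => ε * s ^ 2 := by fun_prop
      simpa using (this.tendsto 0).mono_left nhdsWithin_le_nhds
    simpa using h1.smul (hΦl l)
  have heq : (fun s : ℂ => ∑ ν, s ^ (2 - (k : ℤ)) •
      A (iteratedDeriv 2 (fun r : ℂ => Ψ (y + s • v + r • Pi.single ν 1)) 0)) =ᶠ[𝓝[≠] 0]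
      fun s => (s ^ 2 * ((Real.pi : ℂ) ^ 2 / Complex.sin (Real.pi * a (y + s • v)) ^ 2)) • κ •
        (⁅f, Φ (l + 1) (y + s • v)⁆ + ((l : ℂ) * (l + 1)) • Φ l (y + s • v)) +
      s ^ (2 - (k : ℤ)) • A (∑ β ∈ H.root, otherPotential b (α : Weight ℂ H 𝔤) (y + s • v) β •
        ⁅e β, ⁅e (-β), Ψ (y + s • v)⁆⁆) - (ε * s ^ 2) • Φ l (y + s • v) := by
    filter_upwards [hD, self_mem_nhdsWithin] with s hs hs0
    have hs' : s ≠ 0 := hs0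
    set z := y + s • v with hz
    have hsk : s ^ (2 - (k : ℤ)) * s ^ k = s ^ 2 := by
      rw [← zpow_natCast s k, ← zpow_add₀ hs', sub_add_cancel]; rfl
    have hul : A (Ψ z) = s ^ k • Φ l z := by rw [hu, hal, zpow_natCast]
    have hul1 : (toEnd ℂ 𝔤 U (e α) ^ (l + 1)) (Ψ z) = s ^ k • Φ (l + 1) z := by
      rw [hΨ, hmin (Nat.le_succ l), hz, hal]
    have hX : A (⁅e α, ⁅e (-α), Ψ z⁆⁆ + ⁅e (-α), ⁅e α, Ψ z⁆⁆) =
        (s ^ k * κ) • (⁅f, Φ (l + 1) z⁆ + ((l : ℂ) * (l + 1)) • Φ l z) := by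
      have h1 : ⁅e (-α), ⁅e α, Ψ z⁆⁆ = ⁅e α, ⁅e (-α), Ψ z⁆⁆ := by
        have := lie_lie (e α) (e (-α)) (Ψ z)
        rw [lie_rootVector_eq_sum hBinv hb heα hfα hef, hΨH] at this
        exact (sub_eq_zero.1 this.symm).symm
      have h2 : ⁅e α, ⁅e (-α), Ψ z⁆⁆ + ⁅e (-α), ⁅e α, Ψ z⁆⁆ = κ • ⁅e α, ⁅f, Ψ z⁆⁆ := by
        rw [h1, hf, smul_lie, lie_smul, smul_smul, mul_div_cancel₀ _ hκ, two_smul]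
      have h3 := toEnd_pow_lie_lie_of_sl2 t (hΨH z _) l
      rw [hul1, lie_smul] at h3
      rw [h2, map_smul, show A ⁅e α, ⁅f, Ψ z⁆⁆ = _ from h3,
        show (toEnd ℂ 𝔤 U (e α) ^ l) (Ψ z) = _ from hul]
      module
    rw [← Finset.smul_sum, ← map_sum, hΨs z hs, schrodinger_split b α.2, map_sub, map_add, map_smul,
      map_smul, hX, hul, ← ha, smul_sub, smul_add, ← hsk]
    module
  have h := tendsto_nhds_unique (hlap.congr' heq) ((hmain.add hother).sub hε)
  rw [add_zero, sub_zero, ← sub_eq_zero, ← sub_smul] at h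
  refine (smul_eq_zero.1 h).resolve_left ?_
  rw [← sub_mul]
  refine mul_ne_zero (fun h0 => ?_) hκ
  -- The two constants differ exactly because `l ≥ k`, which is why the vanishing order of `e_α^l Ψ`
  -- stops increasing at `l + 1`.
  have h1 : k * (k - 1) < l * (l + 1) :=
    Nat.mul_lt_mul_of_le_of_lt hkl (by omega) (by omega)
  have h2 : ((k * (k - 1) : ℕ) : ℂ) = ((l * (l + 1) : ℕ) : ℂ) := by
    push_cast [Nat.cast_sub hk]
    exact sub_eq_zero.1 h0
  exact h1.ne (by exact_mod_cast h2)

/-- The order of vanishing of `e_α ^ l Ψ` on the hyperplanes of the root `α`. -/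
theorem exists_toEnd_pow_eq_pow_smul (hBinv : B.lieInvariant 𝔤)
    (hb : ∀ i j, B (b i : 𝔤) (b j : 𝔤) = if i = j then 1 else 0)
    (he : ∀ α ∈ H.root, e α ∈ rootSpace H α)
    (he_norm : ∀ α ∈ H.root, B (e α) (e (-α)) = 1) (α : H.root) (m : ℤ)
    {Ψ : (ι → ℂ) → U} {ε : ℂ}
    (hΨd : Differentiable ℂ Ψ) (hΨ0 : ∀ z, Ψ z ∈ maxTrivSubmodule ℂ H U)
    (hΨs : SolvesSchrodinger b e ε Ψ)
    (hΨz : ∀ y, rootFunctional b (α : Weight ℂ H 𝔤) y = m → Ψ y = 0) (k l : ℕ) :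
    ∃ Φ : (ι → ℂ) → U, Differentiable ℂ Φ ∧ ∀ z, (toEnd ℂ 𝔤 U (e α) ^ l) (Ψ z) =
      (rootFunctional b (α : Weight ℂ H 𝔤) z - m) ^ min (k + 1) (l + 1) • Φ z := by
  have hα := isNonZero_of_mem_root α.2
  set a := rootFunctional b (α : Weight ℂ H 𝔤) with ha
  have ha0 : a ≠ 0 := rootFunctional_ne_zero b hα
  have hdiv : ∀ {q : (ι → ℂ) → U}, Differentiable ℂ q → (∀ y, a y = m → q y = 0) →
      ∃ q₁, Differentiable ℂ q₁ ∧ ∀ z, q z = (a z - m) • q₁ z := by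
    intro q hq h0
    obtain ⟨q₁, h1, h2⟩ := exists_eq_sub_smul_of_eq_zero isOpen_univ hq.differentiableOn ha0 m
      fun z _ => h0 z
    exact ⟨q₁, differentiableOn_univ.1 h1, fun z => h2 z (Set.mem_univ z)⟩
  induction k generalizing l with
  | zero =>
    obtain ⟨Φ, hΦ, h⟩ := hdiv hΨd hΨz
    refine ⟨fun z => (toEnd ℂ 𝔤 U (e α) ^ l) (Φ z),
      (LinearMap.toContinuousLinearMap (toEnd ℂ 𝔤 U (e α) ^ l)).differentiable.comp hΦ, fun z => ?_⟩
    rw [h z, map_smul, min_eq_left (by omega), zero_add, pow_one]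
  | succ k ih =>
    choose Φ hΦd hΦ using ih
    obtain ⟨N, hN⟩ := isNilpotent_toEnd_of_isNonZero (U := U) hα (he α α.2)
    -- Descending induction on `l`, with `d` bounding the distance to the nilpotency exponent `N`,
    -- beyond which `e_α^l Ψ` is identically zero.
    have hzero : ∀ d l, k + 1 ≤ l → N ≤ l + d → ∀ y, a y = m → Φ l y = 0 := by
      intro d
      induction d with
      | zero =>
        intro l _ hNl y _
        have hd : Dense (hyperplaneCompl (rootFamily (𝔤 := 𝔤) b)) :=
          dense_hyperplaneCompl (rootFamily_ne_zero b)
        have : Φ l = fun _ => 0 := by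
          refine Continuous.ext_on hd (hΦd l).continuous continuous_const fun z hz => ?_
          have h1 := hΦ l z
          rw [pow_eq_zero_of_le (show N ≤ l from hNl) hN, LinearMap.zero_apply] at h1
          exact (smul_eq_zero.1 h1.symm).resolve_left
            (pow_ne_zero _ (sub_ne_zero.2 (hz α m)))
        rw [this]
      | succ d ihd =>
        intro l hkl hNl y hy
        refine eq_zero_of_forall_isGenericPoint (a := rootFamily b) (i := α) (hΦd l).continuous
          (fun y hy hgen => ?_) hy
        exact leadingCoeff_eq_zero b hBinv hb he he_norm hy hgen hΨd hΨ0 hΨs (by omega) hΦd hΦ hkl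
          (ihd (l + 1) (by omega) (by omega) y hy)
    by_cases hkl : k + 1 ≤ l
    · obtain ⟨q, hq, h⟩ := hdiv (hΦd l) (hzero N l hkl (by omega))
      refine ⟨q, hq, fun z => ?_⟩
      rw [hΦ, h, smul_smul, min_eq_left (by omega), min_eq_left (by omega), pow_succ _ (k + 1)]
    -- For `l ≤ k` the exponent has already reached its final value `l + 1`.
    · refine ⟨Φ l, hΦd l, fun z => ?_⟩
      rw [hΦ, min_eq_right (by omega), min_eq_right (by omega)]

theorem isBigO_toEnd_pow (hBinv : B.lieInvariant 𝔤)
    (hb : ∀ i j, B (b i : 𝔤) (b j : 𝔤) = if i = j then 1 else 0)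
    (he : ∀ α ∈ H.root, e α ∈ rootSpace H α)
    (he_norm : ∀ α ∈ H.root, B (e α) (e (-α)) = 1) (α : H.root) (m : ℤ)
    {Ψ : (ι → ℂ) → U} {ε : ℂ}
    (hΨd : Differentiable ℂ Ψ) (hΨ0 : ∀ z, Ψ z ∈ maxTrivSubmodule ℂ H U)
    (hΨs : SolvesSchrodinger b e ε Ψ)
    (hΨz : ∀ y, rootFunctional b (α : Weight ℂ H 𝔤) y = m → Ψ y = 0) (l : ℕ) (y : ι → ℂ) :
    (fun z => (toEnd ℂ 𝔤 U (e α) ^ l) (Ψ z)) =O[𝓝 y]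
      fun z => (rootFunctional b (α : Weight ℂ H 𝔤) z - m) ^ (l + 1) := by
  obtain ⟨Φ, hΦd, hΦ⟩ := exists_toEnd_pow_eq_pow_smul b hBinv hb he he_norm α m hΨd hΨ0 hΨs hΨz l l
  simp only [hΦ, min_self]
  have := (isBigO_refl (fun z => (rootFunctional b (α : Weight ℂ H 𝔤) z - m) ^ (l + 1)) (𝓝 y)).smul
    ((hΦd.continuous.tendsto y).isBigO_one ℂ)
  simpa using this

theorem SolvesSchrodinger.congr {ε : ℂ} {f g : (ι → ℂ) → U} (hf : SolvesSchrodinger b e ε f)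
    (hfg : Set.EqOn g f (hyperplaneCompl (rootFamily b))) : SolvesSchrodinger b e ε g := by
  intro z hz
  have hnhds := (isOpen_hyperplaneCompl (rootFamily b)).mem_nhds hz
  rw [hfg hz, ← hf z hz]
  refine Finset.sum_congr rfl fun ν _ => Filter.EventuallyEq.iteratedDeriv_eq 2 ?_
  have hc : ContinuousAt (fun t : ℂ => z + t • (Pi.single ν 1 : ι → ℂ)) 0 := by fun_prop
  rw [ContinuousAt, zero_smul, add_zero] at hc
  filter_upwards [hc.eventually hnhds] with t ht using hfg ht

end VanishingOrder

end CalogeroSutherland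

end

/-! ### Assembly of the extension and the vanishing orders. -/

theorem proposition6p1
    {𝔤 : Type*} [LieRing 𝔤] [LieAlgebra ℂ 𝔤] [FiniteDimensional ℂ 𝔤] [LieAlgebra.IsSimple ℂ 𝔤]
    (B : LinearMap.BilinForm ℂ 𝔤) (hBnondeg : B.Nondegenerate) (hBinv : B.lieInvariant 𝔤)
    (H : LieSubalgebra ℂ 𝔤) [H.IsCartanSubalgebra]
    -- root vectors, normalized by `(e_α, e_{-α}) = 1`
    (e : LieModule.Weight ℂ H 𝔤 → 𝔤)
    (he : ∀ α ∈ H.root, e α ∈ LieAlgebra.rootSpace H α)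
    (he_norm : ∀ α ∈ H.root, B (e α) (e (-α)) = 1)
    -- an orthonormal basis of the Cartan subalgebra
    {ι : Type*} [Fintype ι] [DecidableEq ι] (b : Module.Basis ι ℂ H)
    (hb : ∀ i j, B (b i : 𝔤) (b j : 𝔤) = if i = j then 1 else 0)
    {U : Type*} [NormedAddCommGroup U] [NormedSpace ℂ U] [FiniteDimensional ℂ U]
    [LieRingModule 𝔤 U] [LieModule ℂ 𝔤 U]
    -- a function with values in the zero weight space, given off the affine root hyperplanes
    (ψ : H → U)
    (hψ_zero : ∀ x ∈ CalogeroSutherland.regularSet H, ψ x ∈ LieModule.maxTrivSubmodule ℂ H U)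
    (hψ_mero : CalogeroSutherland.IsMeromorphicOff
      (b.equivFun.symm ⁻¹' CalogeroSutherland.regularSet H)
      (fun z : ι → ℂ => ψ (b.equivFun.symm z)))
    (hψ_reg : DifferentiableOn ℂ (fun z : ι → ℂ => ψ (b.equivFun.symm z))
      (b.equivFun.symm ⁻¹' CalogeroSutherland.regularSet H))
    (hψ_anti : CalogeroSutherland.IsWeylAntiinvariant H ψ)
    (ε : ℂ)
    (hψ_eigen : ∀ x ∈ CalogeroSutherland.regularSet H,
      CalogeroSutherland.schrodinger H b e ψ x = ε • ψ x)
    (χ : AddChar (CalogeroSutherland.coweightLattice H) ℂ)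
    (hψ_per : ∀ (p : CalogeroSutherland.coweightLattice H),
      ∀ x ∈ CalogeroSutherland.regularSet H, ψ (x + (p : H)) = χ p • ψ x) :
    ∃ Ψ : H → U,
      (∀ x, Ψ x ∈ LieModule.maxTrivSubmodule ℂ H U) ∧
      Set.EqOn Ψ ψ (CalogeroSutherland.regularSet H) ∧
      Differentiable ℂ (fun z : ι → ℂ => Ψ (b.equivFun.symm z)) ∧
      ∀ α ∈ H.root, ∀ (m : ℤ) (l : ℕ) (z₀ : ι → ℂ), α (b.equivFun.symm z₀) = (m : ℂ) →
        (fun z : ι → ℂ => ((LieModule.toEnd ℂ 𝔤 U (e α)) ^ l) (Ψ (b.equivFun.symm z)))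
          =O[𝓝 z₀] (fun z : ι → ℂ => (α (b.equivFun.symm z) - (m : ℂ)) ^ (l + 1)) := by
  set f : (ι → ℂ) → U := fun z => ψ (b.equivFun.symm z) with hf
  have hpre : b.equivFun.symm ⁻¹' CalogeroSutherland.regularSet H =
      CalogeroSutherland.hyperplaneCompl (CalogeroSutherland.rootFamily b) :=
    Set.ext fun z => (CalogeroSutherland.mem_hyperplaneCompl_rootFamily b).symm
  rw [hpre] at hψ_mero hψ_reg
  have hsol := CalogeroSutherland.solvesSchrodinger_of_schrodinger_eq b hψ_eigen
  obtain ⟨Ψ, hΨd, hΨf, hΨz⟩ := CalogeroSutherland.exists_differentiable_eqOn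
    (CalogeroSutherland.rootFamily_ne_zero b) hψ_reg hψ_mero
    (CalogeroSutherland.hasNoLeadingCoeff_rootFamily b hBinv hb he he_norm hψ_zero hψ_anti hsol
      hψ_per)
  have hΨ0 : ∀ z, Ψ z ∈ LieModule.maxTrivSubmodule ℂ H U := by
    intro z
    refine CalogeroSutherland.mem_maxTrivSubmodule_of_eventually (𝔤 := 𝔤) b
      hΨd.continuous.continuousAt ?_
    filter_upwards [self_mem_nhdsWithin] with x hx
    rw [hΨf hx]
    exact hψ_zero _ ((CalogeroSutherland.mem_hyperplaneCompl_rootFamily b).1 hx)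
  refine ⟨fun x => Ψ (b.equivFun x), fun x => hΨ0 _, fun x hx => ?_, ?_, ?_⟩
  · have hx' : b.equivFun x ∈
        CalogeroSutherland.hyperplaneCompl (CalogeroSutherland.rootFamily b) := by
      rw [CalogeroSutherland.mem_hyperplaneCompl_rootFamily, LinearEquiv.symm_apply_apply]
      exact hx
    simpa only [hf, LinearEquiv.symm_apply_apply] using hΨf hx'
  · simpa only [LinearEquiv.apply_symm_apply] using hΨd
  · intro α hα m l z₀ _
    simpa only [LinearEquiv.apply_symm_apply, CalogeroSutherland.rootFunctional_apply] using
      CalogeroSutherland.isBigO_toEnd_pow b hBinv hb he he_norm ⟨α, hα⟩ m hΨd hΨ0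
        (hsol.congr b hΨf) (fun y hy => hΨz ⟨α, hα⟩ m y hy) l z₀
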